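/- Let $n$ and $m$ be integers with $1\le m\le n$, and let $M$ be a connected complete $n$-dimensional Riemannian manifold, isometrically and smoothly immersed as an oriented hypersurface (with smooth unit normal field $N$) in the unit sphere $S^{n+1}\subset\mathbb{R}^{n+2}$. Let $\lambda_1(p),\dots,\lambda_n(p)$ be the principal curvatures at $p\in M$, i.e. the eigenvalues, repeated according to multiplicity, of the shape operator at $p$ with respect to $N$, and let the $m$-th mean curvature $H_m$ be defined by $$\binom{n}{m}H_m=\sum_{1\le i_1<\dots<i_m\le n}\lambda_{i_1}\cdots\lambda_{i_m}.$$ Suppose that $H_m$ is constant on $M$, and that at every point of $M$ there are exactly two distinct principal curvatures, each of multiplicity greater than $1$. Then there are an integer $k$ with $2\le k\le n-2$ and real numbers $a,b>0$ with $a^2+b^2=1$ such that $M$ is isometric, as a Riemannian manifold, to the Riemannian product $S^k(a)\times S^{n-k}(b)$ of round spheres of radii $a$ and $b$. -/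

import Mathlib

open scoped Manifold ContDiff Bundle

noncomputable section

/-- The unit sphere `S^k` of `ℝ^{k+1}`, with Mathlib's smooth structure. -/
abbrev USphere (k : ℕ) : Type :=
  Metric.sphere (0 : EuclideanSpace ℝ (Fin (k + 1))) 1

section Hypersurface

variable {n : ℕ} {M : Type*} [TopologicalSpace M] [ChartedSpace (EuclideanSpace ℝ (Fin n)) M]

/-- The differential at `p` of a map `f : M → S^{n+1}`, with `T_{f p} S^{n+1}` viewed as a
subspace of `ℝ^{n+2}`. -/
def sphereDifferential (f : M → USphere (n + 1)) (p : M) :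
    TangentSpace (𝓡 n) p →L[ℝ] EuclideanSpace ℝ (Fin (n + 1 + 1)) :=
  mvfderiv (𝓡 n) (fun q : M ↦ (f q : EuclideanSpace ℝ (Fin (n + 1 + 1)))) p

variable [Bundle.RiemannianBundle (fun p : M ↦ TangentSpace (𝓡 n) p)]

/-- `f : M → S^{n+1}` is a smooth isometric immersion of the `n`-dimensional Riemannian manifold
`M`, oriented by the smooth unit normal field `N` of `f` in `S^{n+1}` (as `S^{n+1}` is oriented,
an orientation of `M` is the same thing as such a field). The vectors of
`T_{f p} S^{n+1} = (f p)^⊥` are viewed as vectors of `ℝ^{n+2}`. -/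
structure IsOrientedHypersurface (f : M → USphere (n + 1))
    (N : M → EuclideanSpace ℝ (Fin (n + 1 + 1))) : Prop where
  contMDiff : ContMDiff (𝓡 n) (𝓡 (n + 1)) ∞ f
  isometric : ∀ (p : M) (u v : TangentSpace (𝓡 n) p),
    inner ℝ (sphereDifferential f p u) (sphereDifferential f p v) = inner ℝ u v
  contMDiff_normal : ContMDiff (𝓡 n) 𝓘(ℝ, EuclideanSpace ℝ (Fin (n + 1 + 1))) ∞ N
  norm_normal : ∀ p : M, ‖N p‖ = 1
  normal_tangent_sphere : ∀ p : M,
    inner ℝ (N p) (f p : EuclideanSpace ℝ (Fin (n + 1 + 1))) = 0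
  normal_orthogonal : ∀ (p : M) (u : TangentSpace (𝓡 n) p),
    inner ℝ (N p) (sphereDifferential f p u) = 0

/-- The shape operator `A` of the hypersurface `f` with respect to the unit normal field `N`:
the endomorphism of `T_p M` with `⟪A u, v⟫ = h(u, v) = -⟪dN u, df v⟫` (see
`inner_shapeOperator`), that is, `A = -(df)^* ∘ dN`. -/
def shapeOperator (f : M → USphere (n + 1)) (N : M → EuclideanSpace ℝ (Fin (n + 1 + 1)))
    (p : M) : Module.End ℝ (TangentSpace (𝓡 n) p) :=
  haveI : FiniteDimensional ℝ (TangentSpace (𝓡 n) p) :=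
    inferInstanceAs (FiniteDimensional ℝ (EuclideanSpace ℝ (Fin n)))
  LinearMap.adjoint (sphereDifferential f p).toLinearMap ∘ₗ (-(mvfderiv (𝓡 n) N p).toLinearMap)

theorem inner_shapeOperator (f : M → USphere (n + 1))
    (N : M → EuclideanSpace ℝ (Fin (n + 1 + 1))) (p : M) (u v : TangentSpace (𝓡 n) p) :
    inner ℝ (shapeOperator f N p u) v
      = -inner ℝ (mvfderiv (𝓡 n) N p u) (sphereDifferential f p v) := by
  have : FiniteDimensional ℝ (TangentSpace (𝓡 n) p) :=
    inferInstanceAs (FiniteDimensional ℝ (EuclideanSpace ℝ (Fin n)))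
  simp [shapeOperator, inner_neg_left, LinearMap.adjoint_inner_left]

/-- The principal curvatures at `p`: the eigenvalues of the shape operator. -/
def principalCurvatures (f : M → USphere (n + 1)) (N : M → EuclideanSpace ℝ (Fin (n + 1 + 1)))
    (p : M) : Set ℝ :=
  {c : ℝ | (shapeOperator f N p).HasEigenvalue c}

/-- The multiplicity of `c` as a principal curvature at `p`: the dimension of the space of
principal vectors. -/
def principalMultiplicity (f : M → USphere (n + 1))
    (N : M → EuclideanSpace ℝ (Fin (n + 1 + 1))) (p : M) (c : ℝ) : ℕ :=
  Module.finrank ℝ ((shapeOperator f N p).eigenspace c)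

/-- The `m`-th mean curvature `H_m`, defined by
`C(n, m) H_m = ∑_{i_1 < ⋯ < i_m} λ_{i_1} ⋯ λ_{i_m}`, where `λ_1, …, λ_n` are the principal
curvatures repeated according to multiplicity (the roots of the characteristic polynomial of the
self-adjoint shape operator). -/
def meanCurvature (m : ℕ) (f : M → USphere (n + 1))
    (N : M → EuclideanSpace ℝ (Fin (n + 1 + 1))) (p : M) : ℝ :=
  haveI : FiniteDimensional ℝ (TangentSpace (𝓡 n) p) :=
    inferInstanceAs (FiniteDimensional ℝ (EuclideanSpace ℝ (Fin n)))
  (LinearMap.charpoly (shapeOperator f N p)).roots.esymm m / (n.choose m : ℝ)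

end Hypersurface

section CliffordProduct

/-- The Riemannian metric of the round sphere `S^k(a)` of radius `a`, on the manifold `S^k`
through the parametrization `y ↦ a y` of `S^k(a) ⊆ ℝ^{k+1}`. -/
def roundMetric (k : ℕ) (a : ℝ) (x : USphere k) (u v : TangentSpace (𝓡 k) x) : ℝ :=
  inner ℝ
    (mvfderiv (𝓡 k) (fun y : USphere k ↦ a • (y : EuclideanSpace ℝ (Fin (k + 1)))) x u)
    (mvfderiv (𝓡 k) (fun y : USphere k ↦ a • (y : EuclideanSpace ℝ (Fin (k + 1)))) x v)

/-- The Riemannian product metric of `S^k(a) × S^l(b)`. -/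
def cliffordMetric (k l : ℕ) (a b : ℝ) (z : USphere k × USphere l)
    (u v : TangentSpace ((𝓡 k).prod (𝓡 l)) z) : ℝ :=
  roundMetric k a z.1
      (mfderiv ((𝓡 k).prod (𝓡 l)) (𝓡 k) (Prod.fst : USphere k × USphere l → USphere k) z u)
      (mfderiv ((𝓡 k).prod (𝓡 l)) (𝓡 k) (Prod.fst : USphere k × USphere l → USphere k) z v)
    + roundMetric l b z.2
      (mfderiv ((𝓡 k).prod (𝓡 l)) (𝓡 l) (Prod.snd : USphere k × USphere l → USphere l) z u)
      (mfderiv ((𝓡 k).prod (𝓡 l)) (𝓡 l) (Prod.snd : USphere k × USphere l → USphere l) z v)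

/-- The `n`-dimensional Riemannian manifold `M` is isometric to the Riemannian product
`S^k(a) × S^l(b)`: there is a diffeomorphism carrying one metric to the other. -/
def IsometricToClifford (n : ℕ) (M : Type*) [TopologicalSpace M]
    [ChartedSpace (EuclideanSpace ℝ (Fin n)) M]
    [Bundle.RiemannianBundle (fun p : M ↦ TangentSpace (𝓡 n) p)] (k l : ℕ) (a b : ℝ) : Prop :=
  ∃ φ : Diffeomorph (𝓡 n) ((𝓡 k).prod (𝓡 l)) M (USphere k × USphere l) ∞,
    ∀ (p : M) (u v : TangentSpace (𝓡 n) p),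
      cliffordMetric k l a b (φ p)
          (mfderiv (𝓡 n) ((𝓡 k).prod (𝓡 l)) φ p u)
          (mfderiv (𝓡 n) ((𝓡 k).prod (𝓡 l)) φ p v)
        = inner ℝ u v

end CliffordProduct

end

/-! Write λ, μ for the two principal curvatures (`lam`, `mu` in the code). Local computations take
place in a chart, with maps into ℝ^{n+2} and ordinary second derivatives; Codazzi and Gauss enter
only through the symmetry of these derivatives.

Regularity: the skewness of the spectrum is a continuous function built from traces of powers of the
shape operator. It takes finitely many values and determines the multiplicities, so on the connected
M these are constant, and λ, μ are then smooth (`exists_hasTwoCurvatures`).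

Reduction: symmetry of the second derivative of N + λf shows that a curvature of multiplicity at
least 2 is constant along its own principal directions (`PrincipalPatch.fderiv_lam_proj`). Constancy
of H_m is a polynomial equation for μ, nonconstant where λ ≠ 0. Along a λ-direction λ is fixed, so μ
has finitely many admissible values and is constant as well. Hence dμ = 0 where λ ≠ 0, and
symmetrically. By connectedness both curvatures are constant or one vanishes identically
(`constant_or_zero`).

Zero case, excluded by completeness (`not_forall_eq_zero`): if λ = 0, put ρ = 1/μ. The vector N − ρf
− ∇ρ does not change along λ-directions (`fderiv_leaf_invariant`), so ρ² + |∇ρ|² does not either.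
Classically ρ is then a cosine along a geodesic of the leaf and vanishes after finite length, which
is impossible for 1/μ. Here Ekeland's principle replaces geodesics: the function |ρ|/√(ρ² + |∇ρ|²)
falls along the gradient line with slope √(1 − its square), bounded below under a sublevel, so it
admits no almost-minimum.

Constant case: V = N + μf and W = N + λf have orthogonal differentials with complementary kernels,
and all their second derivatives are orthogonal too (`OrthogonalPair`). This yields 1 + λμ = 0, and
shows that the orthogonal projection to the span of V and the λ-space is a constant operator. So
ℝ^{n+2} splits into fixed subspaces of dimensions k+1 and l+1 (k, l the multiplicities), in which f
has components of constant length (`exists_splitting`). Normalizing them gives a local isometry φ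
from M to the product of spheres.

Globally, completeness lets curves lift through φ. Lifting great circle arcs gives sections over
complements of antipodes, and since k, l ≥ 2 these overlap in connected sets, which makes φ
bijective (`bijective_of_sections`). -/

set_option linter.unusedSectionVars false

/-! ### Second derivatives of maps with orthogonal differentials -/

section SecondDerivatives

variable {E H : Type*} [NormedAddCommGroup E] [NormedSpace ℝ E]
  [NormedAddCommGroup H] [InnerProductSpace ℝ H]

theorem inner_fderiv_add_eq_zero {F G : E → H} {c : ℝ} {U : Set E} (hU : IsOpen U)
    {x : E} (hx : x ∈ U) (hF : DifferentiableAt ℝ F x) (hG : DifferentiableAt ℝ G x)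
    (h : ∀ y ∈ U, inner ℝ (F y) (G y) = c) (b : E) :
    inner ℝ (F x) (fderiv ℝ G x b) + inner ℝ (fderiv ℝ F x b) (G x) = 0 := by
  rw [← fderiv_inner_apply ℝ hF hG]
  have : (fun y ↦ inner ℝ (F y) (G y)) =ᶠ[nhds x] fun _ ↦ c :=
    Filter.eventually_of_mem (hU.mem_nhds hx) h
  rw [this.fderiv_eq]
  simp

theorem ContDiffOn.fderiv_smooth {G : Type*} [NormedAddCommGroup G] [NormedSpace ℝ G]
    {F : E → G} {U : Set E} (hU : IsOpen U) (hF : ContDiffOn ℝ ∞ F U) :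
    ContDiffOn ℝ ∞ (fderiv ℝ F) U :=
  hF.fderiv_of_isOpen hU (by simp)

theorem ContDiffOn.differentiableAt_of_isOpen {G : Type*} [NormedAddCommGroup G] [NormedSpace ℝ G]
    {F : E → G} {U : Set E} (hU : IsOpen U) (hF : ContDiffOn ℝ ∞ F U) {x : E} (hx : x ∈ U) :
    DifferentiableAt ℝ F x :=
  (hF.contDiffAt (hU.mem_nhds hx)).differentiableAt (by simp)

theorem fderiv_fderiv_symm {G : Type*} [NormedAddCommGroup G] [NormedSpace ℝ G]
    {F : E → G} {U : Set E} (hU : IsOpen U) (hF : ContDiffOn ℝ ∞ F U) {x : E} (hx : x ∈ U)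
    (a b : E) : fderiv ℝ (fderiv ℝ F) x a b = fderiv ℝ (fderiv ℝ F) x b a :=
  ((hF.contDiffAt (hU.mem_nhds hx)).isSymmSndFDerivAt
    (by simpa using WithTop.coe_le_coe.2 (le_top (a := (2 : ℕ∞))))).eq a b

theorem fderiv_fderiv_apply {G : Type*} [NormedAddCommGroup G] [NormedSpace ℝ G]
    {F : E → G} {U : Set E} (hU : IsOpen U) (hF : ContDiffOn ℝ ∞ F U) {x : E} (hx : x ∈ U)
    {s : E → E} (hs : DifferentiableAt ℝ s x) (b : E) :
    fderiv ℝ (fun y ↦ fderiv ℝ F y (s y)) x b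
      = fderiv ℝ (fderiv ℝ F) x b (s x) + fderiv ℝ F x (fderiv ℝ s x b) := by
  rw [fderiv_clm_apply ((hF.fderiv_smooth hU).differentiableAt_of_isOpen hU hx) hs]
  simp [add_comm]

theorem fderiv_fderiv_apply_const {G : Type*} [NormedAddCommGroup G] [NormedSpace ℝ G]
    {F : E → G} {U : Set E} (hU : IsOpen U) (hF : ContDiffOn ℝ ∞ F U) {x : E} (hx : x ∈ U)
    (a b : E) :
    fderiv ℝ (fun y ↦ fderiv ℝ F y a) x b = fderiv ℝ (fderiv ℝ F) x b a := by
  simpa using fderiv_fderiv_apply hU hF hx (differentiableAt_const a) b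

theorem differentiableAt_fderiv_apply {G : Type*} [NormedAddCommGroup G] [NormedSpace ℝ G]
    {F : E → G} {U : Set E} (hU : IsOpen U) (hF : ContDiffOn ℝ ∞ F U) {x : E} (hx : x ∈ U)
    {s : E → E} (hs : DifferentiableAt ℝ s x) :
    DifferentiableAt ℝ (fun y ↦ fderiv ℝ F y (s y)) x :=
  ((hF.fderiv_smooth hU).differentiableAt_of_isOpen hU hx).clm_apply hs

/-- Two smooth maps with orthogonal differentials whose kernels are complementary. -/
structure OrthogonalPair (U : Set E) (V W : E → H) (P : E → E →L[ℝ] E) : Prop where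
  isOpen : IsOpen U
  smooth_left : ContDiffOn ℝ ∞ V U
  smooth_right : ContDiffOn ℝ ∞ W U
  smooth_proj : ContDiffOn ℝ ∞ P U
  orthogonal : ∀ x ∈ U, ∀ a c, inner ℝ (fderiv ℝ V x a) (fderiv ℝ W x c) = 0
  left_ker : ∀ x ∈ U, ∀ v, fderiv ℝ V x (v - P x v) = 0
  right_ker : ∀ x ∈ U, ∀ v, fderiv ℝ W x (P x v) = 0

namespace OrthogonalPair

variable {U : Set E} {V W : E → H} {P : E → E →L[ℝ] E} (h : OrthogonalPair U V W P)
include h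

theorem inner_second_add {x : E} (hx : x ∈ U) (a b c : E) :
    inner ℝ (fderiv ℝ V x a) (fderiv ℝ (fderiv ℝ W) x b c)
      + inner ℝ (fderiv ℝ (fderiv ℝ V) x b a) (fderiv ℝ W x c) = 0 := by
  have := inner_fderiv_add_eq_zero h.isOpen hx
    (differentiableAt_fderiv_apply h.isOpen h.smooth_left hx (differentiableAt_const a))
    (differentiableAt_fderiv_apply h.isOpen h.smooth_right hx (differentiableAt_const c))
    (fun y hy ↦ h.orthogonal y hy a c) b
  rwa [fderiv_fderiv_apply_const h.isOpen h.smooth_right hx,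
    fderiv_fderiv_apply_const h.isOpen h.smooth_left hx] at this

/-- The expression is symmetric in a, b by Schwarz and in b, c because, up to sign, it equals ⟨V_a,
W_bc⟩; so it is totally symmetric. One may replace c by c − Pc and move it into a slot of V, whose
differential kills it. -/
theorem inner_second_left {x : E} (hx : x ∈ U) (a b c : E) :
    inner ℝ (fderiv ℝ (fderiv ℝ V) x a b) (fderiv ℝ W x c) = 0 := by
  have symV := fderiv_fderiv_symm h.isOpen h.smooth_left hx
  have symW := fderiv_fderiv_symm h.isOpen h.smooth_right hx
  have swap : ∀ a b c, inner ℝ (fderiv ℝ (fderiv ℝ V) x a b) (fderiv ℝ W x c)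
      = inner ℝ (fderiv ℝ (fderiv ℝ V) x a c) (fderiv ℝ W x b) := by
    intro a b c
    have h1 := h.inner_second_add hx b a c
    have h2 := h.inner_second_add hx b c a
    have h3 := h.inner_second_add hx a c b
    have h4 := h.inner_second_add hx a b c
    have h5 := h.inner_second_add hx c a b
    have h6 := h.inner_second_add hx c b a
    rw [symW] at h1 h3 h5
    rw [symV c b] at h2
    rw [symV c a] at h3
    rw [symV b a] at h4
    linarith
  have hc : fderiv ℝ W x c = fderiv ℝ W x (c - P x c) := by
    simp [map_sub, h.right_ker x hx]
  rw [hc, swap]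
  have := h.inner_second_add hx (c - P x c) a b
  rw [h.left_ker x hx] at this
  simpa using this

theorem inner_second_right {x : E} (hx : x ∈ U) (a b c : E) :
    inner ℝ (fderiv ℝ V x a) (fderiv ℝ (fderiv ℝ W) x b c) = 0 := by
  have := h.inner_second_add hx a b c
  rwa [h.inner_second_left hx, add_zero] at this

/-- Differentiating the identity dV(v − Pv) = 0 lets the derivative fall on P: on kernel vectors a
second derivative is a first derivative. -/
theorem second_left_ker {x : E} (hx : x ∈ U) (a v : E) :
    ∃ u, fderiv ℝ (fderiv ℝ V) x a (v - P x v) = fderiv ℝ V x u := by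
  have dP := h.smooth_proj.differentiableAt_of_isOpen h.isOpen hx
  have hs : DifferentiableAt ℝ (fun y ↦ v - P y v) x :=
    (differentiableAt_const v).sub (dP.clm_apply (differentiableAt_const v))
  have h1 := fderiv_fderiv_apply h.isOpen h.smooth_left hx hs a
  have h2 : (fun y ↦ fderiv ℝ V y (v - P y v)) =ᶠ[nhds x] fun _ ↦ 0 :=
    Filter.eventually_of_mem (h.isOpen.mem_nhds hx) fun y hy ↦ h.left_ker y hy v
  rw [h2.fderiv_eq] at h1
  refine ⟨-fderiv ℝ (fun y ↦ v - P y v) x a, ?_⟩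
  rw [map_neg, eq_neg_iff_add_eq_zero, ← h1]
  simp

theorem second_right_ker {x : E} (hx : x ∈ U) (a v : E) :
    ∃ u, fderiv ℝ (fderiv ℝ W) x a (P x v) = fderiv ℝ W x u := by
  have dP := h.smooth_proj.differentiableAt_of_isOpen h.isOpen hx
  have hs : DifferentiableAt ℝ (fun y ↦ P y v) x := dP.clm_apply (differentiableAt_const v)
  have h1 := fderiv_fderiv_apply h.isOpen h.smooth_right hx hs a
  have h2 : (fun y ↦ fderiv ℝ W y (P y v)) =ᶠ[nhds x] fun _ ↦ 0 :=
    Filter.eventually_of_mem (h.isOpen.mem_nhds hx) fun y hy ↦ h.right_ker y hy v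
  rw [h2.fderiv_eq] at h1
  refine ⟨-fderiv ℝ (fun y ↦ P y v) x a, ?_⟩
  rw [map_neg, eq_neg_iff_add_eq_zero, ← h1]
  simp

/-- Differentiating `inner_second_left` expresses the product through a third derivative of V, so a
and c can be exchanged. Split b into its two parts: on b − Pb the second derivative of V is a first
one, and after the exchange Pb sits in W, where the same happens. Either way the earlier
orthogonality applies. -/
theorem inner_second_second {x : E} (hx : x ∈ U) (a b c d : E) :
    inner ℝ (fderiv ℝ (fderiv ℝ V) x a b) (fderiv ℝ (fderiv ℝ W) x c d) = 0 := by
  have symV := fderiv_fderiv_symm h.isOpen h.smooth_left hx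
  have symW := fderiv_fderiv_symm h.isOpen h.smooth_right hx
  have smV := h.smooth_left.fderiv_smooth h.isOpen
  have dV := smV.differentiableAt_of_isOpen h.isOpen hx
  have d2V := (smV.fderiv_smooth h.isOpen).differentiableAt_of_isOpen h.isOpen hx
  have third : ∀ a b c d, inner ℝ (fderiv ℝ (fderiv ℝ V) x a b) (fderiv ℝ (fderiv ℝ W) x c d)
      + inner ℝ (fderiv ℝ (fderiv ℝ (fderiv ℝ V)) x c a b) (fderiv ℝ W x d) = 0 := by
    intro a b c d
    have := inner_fderiv_add_eq_zero (F := fun y ↦ fderiv ℝ (fderiv ℝ V) y a b) h.isOpen hx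
      ((d2V.clm_apply (differentiableAt_const a)).clm_apply (differentiableAt_const b))
      (differentiableAt_fderiv_apply h.isOpen h.smooth_right hx (differentiableAt_const d))
      (fun y hy ↦ h.inner_second_left hy a b d) c
    rw [fderiv_fderiv_apply_const h.isOpen h.smooth_right hx,
      fderiv_clm_apply (d2V.clm_apply (differentiableAt_const a)) (differentiableAt_const b)] at this
    simpa [fderiv_fderiv_apply_const h.isOpen smV hx] using this
  have swap : ∀ a b c d, inner ℝ (fderiv ℝ (fderiv ℝ V) x a b) (fderiv ℝ (fderiv ℝ W) x c d)
      = inner ℝ (fderiv ℝ (fderiv ℝ V) x c b) (fderiv ℝ (fderiv ℝ W) x a d) := by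
    intro a b c d
    have h1 := third a b c d
    have h2 := third c b a d
    rw [fderiv_fderiv_symm h.isOpen smV hx] at h1
    linarith
  have zeroL : ∀ a v c d, inner ℝ (fderiv ℝ (fderiv ℝ V) x a (v - P x v))
      (fderiv ℝ (fderiv ℝ W) x c d) = 0 := by
    intro a v c d
    obtain ⟨u, hu⟩ := h.second_left_ker hx a v
    rw [hu, h.inner_second_right hx]
  have zeroR : ∀ a b c v, inner ℝ (fderiv ℝ (fderiv ℝ V) x a b)
      (fderiv ℝ (fderiv ℝ W) x c (P x v)) = 0 := by
    intro a b c v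
    obtain ⟨u, hu⟩ := h.second_right_ker hx c v
    rw [hu, h.inner_second_left hx]
  have hb : b = (b - P x b) + P x b := by abel
  rw [hb, map_add, inner_add_left, zeroL, zero_add, symV, swap, symW, zeroR]

end OrthogonalPair

end SecondDerivatives

/-! ### Local geometry of a hypersurface with two principal curvatures -/

section Patch

variable {E H : Type*} [NormedAddCommGroup E] [NormedSpace ℝ E]
  [NormedAddCommGroup H] [InnerProductSpace ℝ H]

/-- A parametrized hypersurface `f : U → S ⊆ H` of the unit sphere with unit normal `N`, two
distinct principal curvatures `lam` and `mu`, and `P x` the projection to the principal space of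
`lam` along that of `mu`. -/
structure PrincipalPatch (U : Set E) (f N : E → H) (P : E → E →L[ℝ] E) (lam mu : E → ℝ) :
    Prop where
  isOpen : IsOpen U
  smooth_f : ContDiffOn ℝ ∞ f U
  smooth_N : ContDiffOn ℝ ∞ N U
  smooth_P : ContDiffOn ℝ ∞ P U
  smooth_lam : ContDiffOn ℝ ∞ lam U
  smooth_mu : ContDiffOn ℝ ∞ mu U
  inner_ff : ∀ x ∈ U, inner ℝ (f x) (f x) = 1
  inner_NN : ∀ x ∈ U, inner ℝ (N x) (N x) = 1
  inner_fN : ∀ x ∈ U, inner ℝ (f x) (N x) = 0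
  inner_df_N : ∀ x ∈ U, ∀ v, inner ℝ (fderiv ℝ f x v) (N x) = 0
  injective : ∀ x ∈ U, ∀ v, fderiv ℝ f x v = 0 → v = 0
  proj : ∀ x ∈ U, ∀ v, P x (P x v) = P x v
  orth : ∀ x ∈ U, ∀ v w, inner ℝ (fderiv ℝ f x (P x v)) (fderiv ℝ f x (w - P x w)) = 0
  shape : ∀ x ∈ U, ∀ v, fderiv ℝ N x v
    = -(lam x • fderiv ℝ f x (P x v) + mu x • fderiv ℝ f x (v - P x v))
  ne : ∀ x ∈ U, lam x ≠ mu x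
  complete : ∀ x ∈ U, ∀ h : H, inner ℝ h (f x) = 0 → inner ℝ h (N x) = 0 →
    (∀ v, inner ℝ h (fderiv ℝ f x v) = 0) → h = 0

namespace PrincipalPatch

variable {U : Set E} {f N : E → H} {P : E → E →L[ℝ] E} {lam mu : E → ℝ}
  (h : PrincipalPatch U f N P lam mu)
include h

theorem swap : PrincipalPatch U f N (fun x ↦ ContinuousLinearMap.id ℝ E - P x) mu lam where
  isOpen := h.isOpen
  smooth_f := h.smooth_f
  smooth_N := h.smooth_N
  smooth_P := contDiffOn_const.sub h.smooth_P
  smooth_lam := h.smooth_mu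
  smooth_mu := h.smooth_lam
  inner_ff := h.inner_ff
  inner_NN := h.inner_NN
  inner_fN := h.inner_fN
  inner_df_N := h.inner_df_N
  injective := h.injective
  proj x hx v := by simp [h.proj x hx]
  orth x hx v w := by
    rw [real_inner_comm]
    simpa using h.orth x hx w v
  shape x hx v := by
    rw [h.shape x hx]
    simp [add_comm]
  ne x hx := (h.ne x hx).symm
  complete := h.complete

theorem diff_f {x : E} (hx : x ∈ U) : DifferentiableAt ℝ f x :=
  h.smooth_f.differentiableAt_of_isOpen h.isOpen hx

theorem diff_N {x : E} (hx : x ∈ U) : DifferentiableAt ℝ N x :=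
  h.smooth_N.differentiableAt_of_isOpen h.isOpen hx

theorem diff_P {x : E} (hx : x ∈ U) : DifferentiableAt ℝ P x :=
  h.smooth_P.differentiableAt_of_isOpen h.isOpen hx

theorem diff_lam {x : E} (hx : x ∈ U) : DifferentiableAt ℝ lam x :=
  h.smooth_lam.differentiableAt_of_isOpen h.isOpen hx

theorem diff_mu {x : E} (hx : x ∈ U) : DifferentiableAt ℝ mu x :=
  h.smooth_mu.differentiableAt_of_isOpen h.isOpen hx

theorem inner_f_df {x : E} (hx : x ∈ U) (v : E) : inner ℝ (f x) (fderiv ℝ f x v) = 0 := by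
  have := inner_fderiv_add_eq_zero h.isOpen hx (h.diff_f hx) (h.diff_f hx) h.inner_ff v
  rw [real_inner_comm (f x)] at this
  linarith

theorem inner_f_second {x : E} (hx : x ∈ U) (a b : E) :
    inner ℝ (f x) (fderiv ℝ (fderiv ℝ f) x a b)
      = -inner ℝ (fderiv ℝ f x a) (fderiv ℝ f x b) := by
  have := inner_fderiv_add_eq_zero h.isOpen hx (h.diff_f hx)
    (differentiableAt_fderiv_apply h.isOpen h.smooth_f hx (differentiableAt_const b))
    (fun y hy ↦ h.inner_f_df hy b) a
  rw [fderiv_fderiv_apply_const h.isOpen h.smooth_f hx] at this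
  linarith

theorem proj_compl {x : E} (hx : x ∈ U) (v : E) : P x (v - P x v) = 0 := by
  simp [h.proj x hx]

theorem orth' {x : E} (hx : x ∈ U) (v w : E) :
    inner ℝ (fderiv ℝ f x (v - P x v)) (fderiv ℝ f x (P x w)) = 0 := by
  rw [real_inner_comm]; exact h.orth x hx w v

/-- The differential of `N + s f`. -/
theorem fderiv_add_smul {s : E → ℝ} {x : E} (hx : x ∈ U) (hs : DifferentiableAt ℝ s x) (v : E) :
    fderiv ℝ (fun y ↦ N y + s y • f y) x v
      = (s x - lam x) • fderiv ℝ f x (P x v) + (s x - mu x) • fderiv ℝ f x (v - P x v)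
        + fderiv ℝ s x v • f x := by
  rw [fderiv_fun_add (h.diff_N hx) (hs.fun_smul (h.diff_f hx)), fderiv_fun_smul hs (h.diff_f hx)]
  simp only [add_apply, h.shape x hx, smul_apply,
    ContinuousLinearMap.smulRight_apply, map_sub]
  module

/-- A principal curvature of multiplicity at least two is constant in the directions of its
principal vectors. -/
theorem fderiv_lam_proj [FiniteDimensional ℝ E] {x : E} (hx : x ∈ U)
    (hrank : 1 < Module.finrank ℝ (LinearMap.range (P x).toLinearMap)) (v : E) :
    fderiv ℝ lam x (P x v) = 0 := by
  set W : E → H := fun y ↦ N y + lam y • f y with hW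
  have smW : ContDiffOn ℝ ∞ W U := h.smooth_N.add (h.smooth_lam.smul h.smooth_f)
  have hW' : ∀ y ∈ U, ∀ a, fderiv ℝ W y a
      = (lam y - mu y) • fderiv ℝ f y (a - P y a) + fderiv ℝ lam y a • f y := by
    intro y hy a
    rw [hW, h.fderiv_add_smul hy (h.diff_lam hy)]
    simp
  -- The differential of W is orthogonal to the λ-space. Differentiate this and antisymmetrize in a,
  -- b: the second derivative of W drops out, and of the rest only the pairing of f with second
  -- derivatives of f survives, which is minus the metric.
  have key : ∀ a b c, fderiv ℝ lam x (P x a) * inner ℝ (fderiv ℝ f x (P x b)) (fderiv ℝ f x (P x c))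
      = fderiv ℝ lam x (P x b) * inner ℝ (fderiv ℝ f x (P x a)) (fderiv ℝ f x (P x c)) := by
    intro a b c
    have hPc : DifferentiableAt ℝ (fun y ↦ P y c) x :=
      (h.diff_P hx).clm_apply (differentiableAt_const c)
    have main : ∀ a b, inner ℝ (fderiv ℝ W x a) (fderiv ℝ (fderiv ℝ f) x b (P x c)
        + fderiv ℝ f x (fderiv ℝ (fun y ↦ P y c) x b))
        + inner ℝ (fderiv ℝ (fderiv ℝ W) x b a) (fderiv ℝ f x (P x c)) = 0 := by
      intro a b
      have := inner_fderiv_add_eq_zero (c := 0) h.isOpen hx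
        (differentiableAt_fderiv_apply h.isOpen smW hx (differentiableAt_const a))
        (differentiableAt_fderiv_apply h.isOpen h.smooth_f hx hPc)
        (fun y hy ↦ by
          rw [hW' y hy, inner_add_left, inner_smul_left, inner_smul_left, h.orth' hy,
            h.inner_f_df hy]
          simp) b
      rwa [fderiv_fderiv_apply_const h.isOpen smW hx,
        fderiv_fderiv_apply h.isOpen h.smooth_f hx hPc] at this
    have h1 := main (P x a) (P x b)
    have h2 := main (P x b) (P x a)
    rw [fderiv_fderiv_symm h.isOpen smW hx] at h1
    simp only [hW' x hx, h.proj x hx, sub_self, map_zero, smul_zero, zero_add, inner_smul_left,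
      inner_add_right, h.inner_f_df hx, h.inner_f_second hx, conj_trivial] at h1 h2
    linarith
  -- If dλ(Pv) ≠ 0, `key` makes every Pw a multiple of Pv, so the principal space would be a line.
  by_contra hv
  have hsub : LinearMap.range (P x).toLinearMap ≤ Submodule.span ℝ {P x v} := by
    rintro _ ⟨w, rfl⟩
    rw [Submodule.mem_span_singleton]
    set t := fderiv ℝ lam x (P x w) / fderiv ℝ lam x (P x v) with ht
    refine ⟨t, ?_⟩
    have hz : fderiv ℝ f x (P x (w - t • v)) = 0 := by
      rw [← inner_self_eq_zero (𝕜 := ℝ)]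
      have h1 := key v w (w - t • v)
      have h2 : fderiv ℝ lam x (P x w) = t * fderiv ℝ lam x (P x v) := by
        rw [ht]; field_simp
      rw [h2, mul_comm t, mul_assoc] at h1
      have h3 := mul_left_cancel₀ hv h1
      conv_lhs => enter [2]; rw [map_sub, map_smul, map_sub, map_smul]
      rw [inner_sub_left, inner_smul_left, h3]
      simp
    have := h.injective x hx _ hz
    rw [map_sub, map_smul, sub_eq_zero] at this
    exact this.symm
  have := (Submodule.finrank_mono hsub).trans (finrank_span_le_card ({P x v} : Set E))
  simp at this
  omega

/-- With constant curvatures d(N + μf) sees only the λ-space and d(N + λf) only the μ-space: up to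
scaling these are the two focal maps. -/
theorem orthogonalPair_of_fderiv_eq_zero (hlam : ∀ x ∈ U, fderiv ℝ lam x = 0)
    (hmu : ∀ x ∈ U, fderiv ℝ mu x = 0) :
    OrthogonalPair U (fun y ↦ N y + mu y • f y) (fun y ↦ N y + lam y • f y) P where
  isOpen := h.isOpen
  smooth_left := h.smooth_N.add (h.smooth_mu.smul h.smooth_f)
  smooth_right := h.smooth_N.add (h.smooth_lam.smul h.smooth_f)
  smooth_proj := h.smooth_P
  orthogonal x hx a c := by
    rw [h.fderiv_add_smul hx (h.diff_mu hx), h.fderiv_add_smul hx (h.diff_lam hx), hlam x hx,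
      hmu x hx]
    simp [inner_smul_left, inner_smul_right, -map_sub, h.orth x hx]
  left_ker x hx v := by
    rw [h.fderiv_add_smul hx (h.diff_mu hx), hmu x hx]
    simp [h.proj x hx]
  right_ker x hx v := by
    rw [h.fderiv_add_smul hx (h.diff_lam hx), hlam x hx]
    simp [h.proj x hx]

/-- The difference between v and its orthogonal projection to the image of df is orthogonal to f, N
and df, hence zero by `complete`. -/
theorem exists_fderiv_eq [FiniteDimensional ℝ E] {x : E} (hx : x ∈ U) {v : H}
    (hf : inner ℝ v (f x) = 0) (hN : inner ℝ v (N x) = 0) : ∃ u, v = fderiv ℝ f x u := by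
  set K : Submodule ℝ H := LinearMap.range (fderiv ℝ f x).toLinearMap with hK
  obtain ⟨u, hu⟩ : K.starProjection v ∈ K := K.starProjection_apply_mem v
  refine ⟨u, ?_⟩
  have hu' : fderiv ℝ f x u = K.starProjection v := hu
  rw [← sub_eq_zero]
  apply h.complete x hx
  · rw [inner_sub_left, hf, real_inner_comm, h.inner_f_df hx, sub_zero]
  · rw [inner_sub_left, hN, h.inner_df_N x hx, sub_zero]
  · intro w
    rw [hu']
    exact K.starProjection_inner_eq_zero v _ ⟨w, rfl⟩

theorem inner_Nf {x : E} (hx : x ∈ U) : inner ℝ (N x) (f x) = 0 := by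
  rw [real_inner_comm]; exact h.inner_fN x hx

theorem inner_N_df {x : E} (hx : x ∈ U) (v : E) : inner ℝ (N x) (fderiv ℝ f x v) = 0 := by
  rw [real_inner_comm]; exact h.inner_df_N x hx v

theorem inner_df_f {x : E} (hx : x ∈ U) (v : E) : inner ℝ (fderiv ℝ f x v) (f x) = 0 := by
  rw [real_inner_comm]; exact h.inner_f_df hx v

theorem exists_decomposition [FiniteDimensional ℝ E] {x : E} (hx : x ∈ U) (v : H) :
    ∃ u, v = inner ℝ v (f x) • f x + inner ℝ v (N x) • N x + fderiv ℝ f x u := by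
  obtain ⟨u, hu⟩ := h.exists_fderiv_eq hx
    (v := v - inner ℝ v (f x) • f x - inner ℝ v (N x) • N x)
    (by rw [inner_sub_left, inner_sub_left, inner_smul_left, inner_smul_left, h.inner_ff x hx,
          h.inner_Nf hx]; simp)
    (by rw [inner_sub_left, inner_sub_left, inner_smul_left, inner_smul_left, h.inner_NN x hx,
          h.inner_fN x hx]; simp)
  exact ⟨u, by rw [← hu]; abel⟩

theorem exists_decomposition_proj [FiniteDimensional ℝ E] {x : E} (hx : x ∈ U) {v : H}
    (hv : ∀ c, inner ℝ v (fderiv ℝ f x (c - P x c)) = 0) :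
    ∃ u, v = inner ℝ v (f x) • f x + inner ℝ v (N x) • N x + fderiv ℝ f x (P x u) := by
  obtain ⟨u, hu⟩ := h.exists_decomposition hx v
  refine ⟨u, ?_⟩
  have h0 : fderiv ℝ f x (u - P x u) = 0 := by
    rw [← inner_self_eq_zero (𝕜 := ℝ)]
    have h1 := hv u
    rw [hu, inner_add_left, inner_add_left, inner_smul_left, inner_smul_left, h.inner_f_df hx,
      h.inner_N_df hx] at h1
    have h2 := h.orth x hx u u
    conv_lhs => enter [2]; rw [map_sub]
    rw [inner_sub_left, h2, sub_zero]
    simpa using h1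
  rw [map_sub, sub_eq_zero] at h0
  rwa [← h0]

/-- The inner product of two vectors, one of them without component in the principal space of
`mu`, the other without component in that of `lam`. -/
theorem inner_eq_normal_part [FiniteDimensional ℝ E] {x : E} (hx : x ∈ U) {v w : H}
    (hv : ∀ c, inner ℝ v (fderiv ℝ f x (c - P x c)) = 0)
    (hw : ∀ c, inner ℝ w (fderiv ℝ f x (P x c)) = 0) :
    inner ℝ v w = inner ℝ v (f x) * inner ℝ w (f x) + inner ℝ v (N x) * inner ℝ w (N x) := by
  obtain ⟨u, hu⟩ := h.exists_decomposition_proj hx hv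
  conv_lhs => rw [hu]
  rw [inner_add_left, inner_add_left, inner_smul_left, inner_smul_left,
    real_inner_comm w (fderiv ℝ f x _), hw, real_inner_comm w, real_inner_comm w]
  simp

theorem inner_second_f {V : E → H} (smV : ContDiffOn ℝ ∞ V U) {x : E} (hx : x ∈ U) (b : E)
    (hV : ∀ y ∈ U, inner ℝ (fderiv ℝ V y b) (f y) = 0) (a : E) :
    inner ℝ (fderiv ℝ (fderiv ℝ V) x a b) (f x)
      = -inner ℝ (fderiv ℝ V x b) (fderiv ℝ f x a) := by
  have := inner_fderiv_add_eq_zero h.isOpen hx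
    (differentiableAt_fderiv_apply h.isOpen smV hx (differentiableAt_const b)) (h.diff_f hx) hV a
  rw [fderiv_fderiv_apply_const h.isOpen smV hx] at this
  linarith

theorem inner_second_N {V : E → H} (smV : ContDiffOn ℝ ∞ V U) {x : E} (hx : x ∈ U) (b : E)
    (hV : ∀ y ∈ U, inner ℝ (fderiv ℝ V y b) (N y) = 0) (a : E) :
    inner ℝ (fderiv ℝ (fderiv ℝ V) x a b) (N x)
      = -inner ℝ (fderiv ℝ V x b) (fderiv ℝ N x a) := by
  have := inner_fderiv_add_eq_zero h.isOpen hx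
    (differentiableAt_fderiv_apply h.isOpen smV hx (differentiableAt_const b)) (h.diff_N hx) hV a
  rw [fderiv_fderiv_apply_const h.isOpen smV hx] at this
  linarith

theorem inner_df_self_ne_zero {x : E} (hx : x ∈ U) {v : E} (hv : v ≠ 0) :
    inner ℝ (fderiv ℝ f x v) (fderiv ℝ f x v) ≠ 0 := by
  rw [Ne, inner_self_eq_zero]
  exact fun h0 ↦ hv (h.injective x hx v h0)

/-- If both principal curvatures are constant, their product is `-1`. -/
theorem one_add_mul_eq_zero [FiniteDimensional ℝ E] (hlam : ∀ x ∈ U, fderiv ℝ lam x = 0)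
    (hmu : ∀ x ∈ U, fderiv ℝ mu x = 0) {x : E} (hx : x ∈ U) {v w : E} (hv : P x v ≠ 0)
    (hw : w - P x w ≠ 0) : 1 + lam x * mu x = 0 := by
  have hp := h.orthogonalPair_of_fderiv_eq_zero hlam hmu
  set V := fun y ↦ N y + mu y • f y with hV
  set W := fun y ↦ N y + lam y • f y with hW
  have dV : ∀ y ∈ U, ∀ a, fderiv ℝ V y a = (mu y - lam y) • fderiv ℝ f y (P y a) := by
    intro y hy a
    rw [hV, h.fderiv_add_smul hy (h.diff_mu hy), hmu y hy]; simp
  have dW : ∀ y ∈ U, ∀ a, fderiv ℝ W y a = (lam y - mu y) • fderiv ℝ f y (a - P y a) := by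
    intro y hy a
    rw [hW, h.fderiv_add_smul hy (h.diff_lam hy), hlam y hy]; simp
  have hne := sub_ne_zero.2 (h.ne x hx)
  have hf0 : ∀ y ∈ U, ∀ a, inner ℝ (fderiv ℝ f y a) (f y) = 0 := fun y hy a ↦ by
    rw [real_inner_comm, h.inner_f_df hy]
  set X := P x v with hX
  set Y := w - P x w with hY
  -- The product ⟨V_XX, W_YY⟩ = 0 has only components along f and N, and these add up to −(λ −
  -- μ)²|X|²|Y|²(1 + λμ). The last factor is the sectional curvature of the mixed plane.
  have e1 := h.inner_eq_normal_part hx (v := fderiv ℝ (fderiv ℝ V) x X X)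
    (w := fderiv ℝ (fderiv ℝ W) x Y Y)
    (fun c ↦ by
      have := hp.inner_second_left hx X X c
      rw [dW x hx, inner_smul_right] at this
      exact (mul_eq_zero.1 this).resolve_left hne)
    (fun c ↦ by
      have := hp.inner_second_right hx c Y Y
      rw [dV x hx, inner_smul_left, real_inner_comm] at this
      refine (mul_eq_zero.1 this).resolve_left ?_
      simpa [sub_eq_zero] using (h.ne x hx).symm)
  rw [hp.inner_second_second hx,
    h.inner_second_f hp.smooth_left hx X (fun y hy ↦ by rw [dV y hy, inner_smul_left, hf0 y hy]; simp),
    h.inner_second_f hp.smooth_right hx Y (fun y hy ↦ by rw [dW y hy, inner_smul_left, hf0 y hy]; simp),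
    h.inner_second_N hp.smooth_left hx X
      (fun y hy ↦ by rw [dV y hy, inner_smul_left, h.inner_df_N y hy]; simp),
    h.inner_second_N hp.smooth_right hx Y
      (fun y hy ↦ by rw [dW y hy, inner_smul_left, h.inner_df_N y hy]; simp),
    dV x hx, dW x hx, h.shape x hx, h.shape x hx] at e1
  have hPX : P x X = X := h.proj x hx v
  have hPY : P x Y = 0 := h.proj_compl hx w
  rw [hPX, hPY] at e1
  simp only [sub_self, map_zero, smul_zero, add_zero, sub_zero, zero_add, inner_smul_left,
    inner_neg_right, inner_smul_right, conj_trivial] at e1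
  have h1 := h.inner_df_self_ne_zero hx hv
  have h2 := h.inner_df_self_ne_zero hx hw
  have h3 : (lam x - mu x) ^ 2 * (inner ℝ (fderiv ℝ f x X) (fderiv ℝ f x X)
      * inner ℝ (fderiv ℝ f x Y) (fderiv ℝ f x Y)) * (1 + lam x * mu x) = 0 := by
    linear_combination e1
  exact (mul_eq_zero.1 h3).resolve_left (mul_ne_zero (pow_ne_zero 2 hne) (mul_ne_zero h1 h2))

/-- In the case of constant principal curvatures, the projection onto the space spanned by
`N + mu f` and its derivatives is constant. -/
theorem fderiv_projection_eq_zero [FiniteDimensional ℝ E] (hlam : ∀ x ∈ U, fderiv ℝ lam x = 0)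
    (hmu : ∀ x ∈ U, fderiv ℝ mu x = 0) {T : E → H →L[ℝ] H} {x : E} (hx : x ∈ U)
    (hT : DifferentiableAt ℝ T x)
    (hTV : ∀ y ∈ U, T y (N y + mu y • f y) = N y + mu y • f y)
    (hTP : ∀ y ∈ U, ∀ v, T y (fderiv ℝ f y (P y v)) = fderiv ℝ f y (P y v))
    (hTW : ∀ y ∈ U, T y (N y + lam y • f y) = 0)
    (hTQ : ∀ y ∈ U, ∀ v, T y (fderiv ℝ f y (v - P y v)) = 0) (hmul : 1 + lam x * mu x = 0) :
    fderiv ℝ T x = 0 := by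
  have hp := h.orthogonalPair_of_fderiv_eq_zero hlam hmu
  set V := fun y ↦ N y + mu y • f y with hV
  set W := fun y ↦ N y + lam y • f y with hW
  have dV : ∀ y ∈ U, ∀ a, fderiv ℝ V y a = (mu y - lam y) • fderiv ℝ f y (P y a) := by
    intro y hy a
    rw [hV, h.fderiv_add_smul hy (h.diff_mu hy), hmu y hy]; simp
  have dW : ∀ y ∈ U, ∀ a, fderiv ℝ W y a = (lam y - mu y) • fderiv ℝ f y (a - P y a) := by
    intro y hy a
    rw [hW, h.fderiv_add_smul hy (h.diff_lam hy), hlam y hy]; simp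
  have hne := sub_ne_zero.2 (h.ne x hx)
  have hne' := sub_ne_zero.2 (h.ne x hx).symm
  have product_rule : ∀ {s : E → H}, DifferentiableAt ℝ s x → ∀ b,
      fderiv ℝ (fun y ↦ T y (s y)) x b = T x (fderiv ℝ s x b) + fderiv ℝ T x b (s x) := by
    intro s hs b
    rw [fderiv_clm_apply hT hs]
    simp
  -- As λμ = −1, the part in span(f, N) of a vector orthogonal to W is a multiple of V; the
  -- coefficient −λ⟨v, f⟩ comes from ⟨v, N⟩ = −λ⟨v, f⟩.
  have fixV : ∀ v : H, inner ℝ v (W x) = 0 → (∀ c, inner ℝ v (fderiv ℝ f x (c - P x c)) = 0) →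
      T x v = v := by
    intro v hvW hv
    obtain ⟨u, hu⟩ := h.exists_decomposition_proj hx hv
    simp only [hW, inner_add_right, inner_smul_right] at hvW
    have hcomb : v = (-(lam x * inner ℝ v (f x))) • V x + fderiv ℝ f x (P x u) := by
      conv_lhs => rw [hu, show inner ℝ v (N x) = -(lam x * inner ℝ v (f x)) by linarith]
      simp only [hV]
      rw [smul_add, smul_smul, show -(lam x * inner ℝ v (f x)) * mu x = inner ℝ v (f x) by
        linear_combination (-inner ℝ v (f x)) * hmul]
      abel
    rw [hcomb, map_add, map_smul, hTV x hx, hTP x hx]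
  have killW : ∀ v : H, inner ℝ v (V x) = 0 → (∀ c, inner ℝ v (fderiv ℝ f x (P x c)) = 0) →
      T x v = 0 := by
    intro v hvV hv
    obtain ⟨u, hu⟩ := h.swap.exists_decomposition_proj hx (v := v) (by simpa using hv)
    simp only [hV, inner_add_right, inner_smul_right] at hvV
    have hcomb : v = (-(mu x * inner ℝ v (f x))) • W x + fderiv ℝ f x (u - P x u) := by
      conv_lhs => rw [hu, show inner ℝ v (N x) = -(mu x * inner ℝ v (f x)) by linarith]
      simp only [hW]
      rw [smul_add, smul_smul, show -(mu x * inner ℝ v (f x)) * lam x = inner ℝ v (f x) by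
        linear_combination (-inner ℝ v (f x)) * hmul]
      simp only [sub_apply, ContinuousLinearMap.id_apply]
      abel
    rw [hcomb, map_add, map_smul, hTW x hx, hTQ x hx]
    simp
  have dVx := hp.smooth_left.differentiableAt_of_isOpen h.isOpen hx
  have dWx := hp.smooth_right.differentiableAt_of_isOpen h.isOpen hx
  have cW : ∀ y ∈ U, ∀ a, inner ℝ (fderiv ℝ V y a) (W y) = 0 := by
    intro y hy a
    rw [dV y hy, hW, inner_smul_left, inner_add_right, h.inner_df_N y hy, inner_smul_right,
      h.inner_df_f hy]
    simp
  have cV : ∀ y ∈ U, ∀ a, inner ℝ (fderiv ℝ W y a) (V y) = 0 := by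
    intro y hy a
    rw [dW y hy, hV, inner_smul_left, inner_add_right, h.inner_df_N y hy, inner_smul_right,
      h.inner_df_f hy]
    simp
  ext b v
  have eV : fderiv ℝ T x b (V x) = 0 := by
    have h1 := product_rule dVx b
    have h2 : (fun y ↦ T y (V y)) =ᶠ[nhds x] V :=
      Filter.eventually_of_mem (h.isOpen.mem_nhds hx) hTV
    rw [h2.fderiv_eq, dV x hx, map_smul, hTP x hx] at h1
    simpa using h1
  have eW : fderiv ℝ T x b (W x) = 0 := by
    have h1 := product_rule dWx b
    have h2 : (fun y ↦ T y (W y)) =ᶠ[nhds x] fun _ ↦ 0 :=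
      Filter.eventually_of_mem (h.isOpen.mem_nhds hx) hTW
    rw [h2.fderiv_eq, dW x hx, map_smul, hTQ x hx] at h1
    simpa using h1.symm
  -- Differentiate T(dV u) = dV u. The second derivative of V is orthogonal to W and to the μ-space,
  -- so T fixes it too, and the derivative of T must vanish on dV u.
  have eP : ∀ u, fderiv ℝ T x b (fderiv ℝ f x (P x u)) = 0 := by
    intro u
    have h1 := product_rule
      (differentiableAt_fderiv_apply h.isOpen hp.smooth_left hx (differentiableAt_const u)) b
    have h2 : (fun y ↦ T y (fderiv ℝ V y u)) =ᶠ[nhds x] fun y ↦ fderiv ℝ V y u :=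
      Filter.eventually_of_mem (h.isOpen.mem_nhds hx) fun y hy ↦ by
        simp only [dV y hy, map_smul, hTP y hy]
    rw [h2.fderiv_eq, fderiv_fderiv_apply_const h.isOpen hp.smooth_left hx, fixV, dV x hx,
      map_smul] at h1
    · simpa [hne'] using h1
    · have := inner_fderiv_add_eq_zero h.isOpen hx
        (differentiableAt_fderiv_apply h.isOpen hp.smooth_left hx (differentiableAt_const u))
        dWx (fun y hy ↦ cW y hy u) b
      rwa [hp.orthogonal x hx, zero_add,
        fderiv_fderiv_apply_const h.isOpen hp.smooth_left hx] at this
    · intro c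
      have := hp.inner_second_left hx b u c
      rw [dW x hx, inner_smul_right] at this
      exact (mul_eq_zero.1 this).resolve_left hne
  have eQ : ∀ u, fderiv ℝ T x b (fderiv ℝ f x (u - P x u)) = 0 := by
    intro u
    have h1 := product_rule
      (differentiableAt_fderiv_apply h.isOpen hp.smooth_right hx (differentiableAt_const u)) b
    have h2 : (fun y ↦ T y (fderiv ℝ W y u)) =ᶠ[nhds x] fun y ↦ 0 :=
      Filter.eventually_of_mem (h.isOpen.mem_nhds hx) fun y hy ↦ by
        simp only [dW y hy, map_smul, hTQ y hy, smul_zero]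
    rw [h2.fderiv_eq, fderiv_fderiv_apply_const h.isOpen hp.smooth_right hx, killW, dW x hx,
      map_smul] at h1
    · simpa [hne, -map_sub] using h1.symm
    · have := inner_fderiv_add_eq_zero h.isOpen hx
        (differentiableAt_fderiv_apply h.isOpen hp.smooth_right hx (differentiableAt_const u))
        dVx (fun y hy ↦ cV y hy u) b
      rwa [real_inner_comm, hp.orthogonal x hx, zero_add,
        fderiv_fderiv_apply_const h.isOpen hp.smooth_right hx] at this
    · intro c
      have := hp.inner_second_right hx c b u
      rw [dV x hx, inner_smul_left, real_inner_comm] at this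
      exact (mul_eq_zero.1 this).resolve_left (by simpa using hne')
  obtain ⟨u, hu⟩ := h.exists_decomposition hx v
  have ef : fderiv ℝ T x b (f x) = 0 := by
    have : (mu x - lam x) • f x = V x - W x := by simp only [hV, hW]; module
    have h1 : (mu x - lam x) • fderiv ℝ T x b (f x) = 0 := by
      rw [← map_smul, this, map_sub, eV, eW, sub_zero]
    exact (smul_eq_zero.1 h1).resolve_left hne'
  have eN : fderiv ℝ T x b (N x) = 0 := by
    have : N x = V x - mu x • f x := by simp only [hV]; abel
    rw [this, map_sub, map_smul, eV, ef]; simp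
  have eu : fderiv ℝ T x b (fderiv ℝ f x u) = 0 := by
    have := eQ u
    rwa [map_sub, map_sub, eP, sub_zero] at this
  rw [hu, map_add, map_add, map_smul, map_smul, ef, eN, eu]
  simp

end PrincipalPatch

end Patch

/-! ### The invariant of a nullity leaf, and propagation of constancy along principal directions -/

section Patch

variable {E H : Type*} [NormedAddCommGroup E] [NormedSpace ℝ E]
  [NormedAddCommGroup H] [InnerProductSpace ℝ H]

namespace PrincipalPatch

variable {U : Set E} {f N : E → H} {P : E → E →L[ℝ] E} {lam mu : E → ℝ}
  (h : PrincipalPatch U f N P lam mu)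
include h

/-- The common squared length, minus one, of the focal normal along a relative nullity leaf. -/
theorem fderiv_leaf_invariant [FiniteDimensional ℝ E] (hlam : ∀ x ∈ U, lam x = 0)
    (hmu : ∀ x ∈ U, ∀ v, fderiv ℝ mu x (v - P x v) = 0)
    (hQ : ∀ x ∈ U, ∃ w, w - P x w ≠ 0) {z : E → E} (sz : ContDiffOn ℝ ∞ z U)
    (hz : ∀ x ∈ U, ∀ v, inner ℝ (fderiv ℝ f x (z x)) (fderiv ℝ f x v)
      = fderiv ℝ (fun y ↦ (mu y)⁻¹) x v) {x : E} (hx : x ∈ U) (v : E) :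
    fderiv ℝ (fun y ↦ (mu y)⁻¹ ^ 2 + inner ℝ (fderiv ℝ f y (z y)) (fderiv ℝ f y (z y))) x (P x v)
      = 0 := by
  set ρ : E → ℝ := fun y ↦ (mu y)⁻¹ with hρ
  have hmu0 : ∀ y ∈ U, mu y ≠ 0 := fun y hy h0 ↦ h.ne y hy ((hlam y hy).trans h0.symm)
  have sρ : ContDiffOn ℝ ∞ ρ U := h.smooth_mu.inv hmu0
  have dρ : ∀ y ∈ U, DifferentiableAt ℝ ρ y := fun y hy ↦ sρ.differentiableAt_of_isOpen h.isOpen hy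
  have hρmu : ∀ y ∈ U, ρ y * mu y = 1 := fun y hy ↦ inv_mul_cancel₀ (hmu0 y hy)
  have ρQ : ∀ y ∈ U, ∀ v, fderiv ℝ ρ y (v - P y v) = 0 := by
    intro y hy v
    have h1 := ((hasDerivAt_inv (hmu0 y hy)).comp_hasFDerivAt y (h.diff_mu hy).hasFDerivAt).fderiv
    change fderiv ℝ ρ y = _ at h1
    rw [h1, smul_apply, hmu y hy, smul_zero]
  have dN : ∀ y ∈ U, ∀ a, fderiv ℝ N y a = (-mu y) • fderiv ℝ f y (a - P y a) := by
    intro y hy a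
    rw [h.shape y hy, hlam y hy]; simp
  -- A focal map, V divided by μ. Its differential involves only the λ-space and N, so F and N form
  -- an orthogonal pair although μ is not constant.
  set F : E → H := fun y ↦ f y + ρ y • N y with hF
  have sF : ContDiffOn ℝ ∞ F U := h.smooth_f.add (sρ.smul h.smooth_N)
  have dF : ∀ y ∈ U, ∀ a, fderiv ℝ F y a = fderiv ℝ f y (P y a) + fderiv ℝ ρ y a • N y := by
    intro y hy a
    rw [hF, fderiv_fun_add (h.diff_f hy) ((dρ y hy).fun_smul (h.diff_N hy)),
      fderiv_fun_smul (dρ y hy) (h.diff_N hy)]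
    simp only [add_apply, dN y hy, smul_apply, ContinuousLinearMap.smulRight_apply, smul_smul,
      mul_neg, hρmu y hy, map_sub]
    module
  have hp : OrthogonalPair U F N P :=
    { isOpen := h.isOpen
      smooth_left := sF
      smooth_right := h.smooth_N
      smooth_proj := h.smooth_P
      orthogonal := fun y hy a c ↦ by
        rw [dF y hy, dN y hy, inner_smul_right, inner_add_left, h.orth y hy, inner_smul_left,
          h.inner_N_df hy]
        simp
      left_ker := fun y hy v ↦ by rw [dF y hy, ρQ y hy, h.proj_compl hy]; simp
      right_ker := fun y hy v ↦ by rw [dN y hy, h.proj y hy]; simp }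
  set ζ : E → H := fun y ↦ fderiv ℝ f y (z y) with hζ
  have sζ : ContDiffOn ℝ ∞ ζ U := (h.smooth_f.fderiv_smooth h.isOpen).clm_apply sz
  -- G is orthogonal to the images of dF and dN and has N-component 1. As ⟨G, f⟩ = −ρ, its constancy
  -- along a leaf says that ρ is there the restriction of a linear function; and |G|² − 1 is the
  -- quantity in question.
  set G : E → H := fun y ↦ N y - ρ y • f y - ζ y with hG
  have sG : ContDiffOn ℝ ∞ G U := (h.smooth_N.sub (sρ.smul h.smooth_f)).sub sζ
  have dG : DifferentiableAt ℝ G x := sG.differentiableAt_of_isOpen h.isOpen hx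
  have GN : ∀ y ∈ U, inner ℝ (G y) (N y) = 1 := by
    intro y hy
    simp only [hG, hζ, inner_sub_left, inner_smul_left, h.inner_NN y hy, h.inner_fN y hy,
      h.inner_df_N y hy]
    simp
  have Gf : ∀ y ∈ U, inner ℝ (G y) (f y) = -ρ y := by
    intro y hy
    simp only [hG, hζ, inner_sub_left, inner_smul_left, h.inner_Nf hy, h.inner_ff y hy,
      h.inner_df_f hy]
    simp
  have Gdf : ∀ y ∈ U, ∀ a, inner ℝ (G y) (fderiv ℝ f y a) = -fderiv ℝ ρ y a := by
    intro y hy a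
    simp only [hG, hζ, inner_sub_left, inner_smul_left, h.inner_N_df hy, h.inner_f_df hy, hz y hy]
    simp
  have GdF : ∀ y ∈ U, ∀ a, inner ℝ (G y) (fderiv ℝ F y a) = 0 := by
    intro y hy a
    have h1 := ρQ y hy a
    rw [map_sub, sub_eq_zero] at h1
    rw [dF y hy, inner_add_right, inner_smul_right, Gdf y hy, GN y hy, h1]
    ring
  have GdN : ∀ y ∈ U, ∀ a, inner ℝ (G y) (fderiv ℝ N y a) = 0 := by
    intro y hy a
    rw [dN y hy, inner_smul_right, Gdf y hy, ρQ y hy]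
    simp
  obtain ⟨w, hw⟩ := hQ x hx
  -- The multiple s is chosen so that N_YY + sG has no component along f, N or the λ-space. It is
  -- then orthogonal to F_ab, and so is N_YY, by the pair identity.
  have GF2 : ∀ a b, inner ℝ (G x) (fderiv ℝ (fderiv ℝ F) x a b) = 0 := by
    intro a b
    set Y := w - P x w with hY
    set s : ℝ := mu x ^ 2 * inner ℝ (fderiv ℝ f x Y) (fderiv ℝ f x Y) with hs
    have hs0 : s ≠ 0 := mul_ne_zero (pow_ne_zero 2 (hmu0 x hx)) (h.inner_df_self_ne_zero hx hw)
    have hPY : P x Y = 0 := h.proj_compl hx w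
    have nf : inner ℝ (fderiv ℝ (fderiv ℝ N) x Y Y) (f x)
        = mu x * inner ℝ (fderiv ℝ f x Y) (fderiv ℝ f x Y) := by
      rw [h.inner_second_f h.smooth_N hx Y (fun y hy ↦ by
        rw [dN y hy, inner_smul_left, h.inner_df_f hy, mul_zero]), dN x hx, hPY, inner_smul_left]
      simp
    have nN : inner ℝ (fderiv ℝ (fderiv ℝ N) x Y Y) (N x) = -s := by
      rw [h.inner_second_N h.smooth_N hx Y (fun y hy ↦ by
        rw [dN y hy, inner_smul_left, h.inner_df_N y hy, mul_zero]), dN x hx, hPY, inner_smul_left,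
        inner_smul_right, hs]
      simp
      ring
    have e1 := h.inner_eq_normal_part hx (v := fderiv ℝ (fderiv ℝ F) x a b)
      (w := fderiv ℝ (fderiv ℝ N) x Y Y + s • G x)
      (fun c ↦ by
        have := hp.inner_second_left hx a b c
        rw [dN x hx, inner_smul_right] at this
        exact (mul_eq_zero.1 this).resolve_left (neg_ne_zero.2 (hmu0 x hx)))
      (fun c ↦ by
        have h1 := hp.inner_second_right hx (P x c) Y Y
        rw [dF x hx, h.proj x hx, inner_add_left, inner_smul_left, real_inner_comm,
          real_inner_comm _ (N x), nN] at h1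
        rw [inner_add_left, inner_smul_left, Gdf x hx]
        simp only [conj_trivial] at h1 ⊢
        linarith)
    have e2 : inner ℝ (fderiv ℝ (fderiv ℝ N) x Y Y + s • G x) (f x) = 0 := by
      rw [inner_add_left, inner_smul_left, nf, Gf x hx, hs]
      simp only [conj_trivial]
      linear_combination (-mu x * inner ℝ (fderiv ℝ f x Y) (fderiv ℝ f x Y)) * hρmu x hx
    have e3 : inner ℝ (fderiv ℝ (fderiv ℝ N) x Y Y + s • G x) (N x) = 0 := by
      rw [inner_add_left, inner_smul_left, nN, GN x hx]
      simp
    rw [e2, e3, inner_add_right, hp.inner_second_second hx, inner_smul_right] at e1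
    rw [real_inner_comm]
    simpa [hs0] using e1
  -- Differentiate the defining products of G in a λ-direction: the result is orthogonal to N, f, dF
  -- and dN, which together span everything.
  have hdG : fderiv ℝ G x (P x v) = 0 := by
    have g1 : inner ℝ (fderiv ℝ G x (P x v)) (N x) = 0 := by
      have := inner_fderiv_add_eq_zero h.isOpen hx dG (h.diff_N hx) GN (P x v)
      rwa [GdN x hx, zero_add] at this
    have g2 : inner ℝ (fderiv ℝ G x (P x v)) (f x) = 0 := by
      have h1 : (fun y ↦ inner ℝ (G y) (f y)) =ᶠ[nhds x] fun y ↦ -ρ y :=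
        Filter.eventually_of_mem (h.isOpen.mem_nhds hx) Gf
      have h2 := fderiv_inner_apply ℝ dG (h.diff_f hx) (P x v)
      rw [h1.fderiv_eq, Gdf x hx, fderiv_fun_neg] at h2
      simpa using h2
    have g3 : ∀ c, inner ℝ (fderiv ℝ G x (P x v)) (fderiv ℝ F x c) = 0 := by
      intro c
      have := inner_fderiv_add_eq_zero h.isOpen hx dG
        (differentiableAt_fderiv_apply h.isOpen sF hx (differentiableAt_const c))
        (fun y hy ↦ GdF y hy c) (P x v)
      rwa [fderiv_fderiv_apply_const h.isOpen sF hx, GF2, zero_add] at this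
    have g4 : ∀ c, inner ℝ (fderiv ℝ G x (P x v)) (fderiv ℝ N x c) = 0 := by
      intro c
      have := inner_fderiv_add_eq_zero h.isOpen hx dG
        (differentiableAt_fderiv_apply h.isOpen h.smooth_N hx (differentiableAt_const c))
        (fun y hy ↦ GdN y hy c) (P x v)
      obtain ⟨u, hu⟩ := hp.second_right_ker hx c v
      rwa [fderiv_fderiv_apply_const h.isOpen h.smooth_N hx,
        fderiv_fderiv_symm h.isOpen h.smooth_N hx, hu, GdN x hx, zero_add] at this
    apply h.complete x hx _ g2 g1
    intro c
    have h1 := g3 c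
    rw [dF x hx, inner_add_right, inner_smul_right, g1, mul_zero, add_zero] at h1
    have h2 := g4 c
    rw [dN x hx, inner_smul_right, map_sub, inner_sub_right, h1, sub_zero] at h2
    exact (mul_eq_zero.1 h2).resolve_left (neg_ne_zero.2 (hmu0 x hx))
  have hnorm : (fun y ↦ ρ y ^ 2 + inner ℝ (ζ y) (ζ y)) =ᶠ[nhds x]
      fun y ↦ inner ℝ (G y) (G y) - 1 := by
    refine Filter.eventually_of_mem (h.isOpen.mem_nhds hx) fun y hy ↦ ?_
    simp only [hG, hζ, inner_sub_left, inner_sub_right, inner_smul_left, inner_smul_right,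
      h.inner_Nf hy, h.inner_ff y hy, h.inner_df_f hy, h.inner_NN y hy, h.inner_fN y hy,
      h.inner_df_N y hy, h.inner_f_df hy, h.inner_N_df hy]
    simp
    ring
  change fderiv ℝ (fun y ↦ ρ y ^ 2 + inner ℝ (ζ y) (ζ y)) x (P x v) = 0
  rw [hnorm.fderiv_eq, fderiv_sub_const, fderiv_inner_apply ℝ dG dG, hdG]
  simp

/-- Follow the integral curve of the field Pv through x. There λ stays constant, so μ runs
continuously through a finite set, hence is constant, and its derivative at time 0 is the one
wanted. -/
theorem fderiv_mu_proj_of_finite [CompleteSpace E] {F : ℝ → ℝ → ℝ} {c : ℝ}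
    (hlam : ∀ x ∈ U, ∀ v, fderiv ℝ lam x (P x v) = 0)
    (hF : ∀ x ∈ U, F (lam x) (mu x) = c) {x : E} (hx : x ∈ U)
    (hfin : {y | F (lam x) y = c}.Finite) (v : E) : fderiv ℝ mu x (P x v) = 0 := by
  have hvf : ContDiffAt ℝ 1 (fun y ↦ P y v) x :=
    ((h.smooth_P.contDiffAt (h.isOpen.mem_nhds hx)).of_le (by simp)).clm_apply contDiffAt_const
  obtain ⟨r, hr, ε, hε, hγ⟩ :=
    hvf.exists_forall_mem_closedBall_exists_eq_forall_mem_Ioo_hasDerivAt 0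
  obtain ⟨γ, hγ0, hγ⟩ := hγ x (Metric.mem_closedBall_self hr.le)
  have hγc : ContinuousAt γ 0 := (hγ 0 (by simp [hε])).continuousAt
  obtain ⟨δ, hδ, hδε, hδU⟩ : ∃ δ > 0, δ ≤ ε ∧ ∀ t ∈ Set.Ioo (-δ) δ, γ t ∈ U := by
    have hU : U ∈ nhds (γ 0) := by rw [hγ0]; exact h.isOpen.mem_nhds hx
    obtain ⟨d, hd, hdU⟩ := Metric.eventually_nhds_iff.1 (hγc.eventually hU)
    refine ⟨min d ε, lt_min hd hε, min_le_right _ _, fun t ht ↦ hdU ?_⟩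
    rw [Real.dist_eq, sub_zero, abs_lt]
    exact ⟨by linarith [ht.1, min_le_left d ε], ht.2.trans_le (min_le_left _ _)⟩
  have h0 : (0 : ℝ) ∈ Set.Ioo (-δ) δ := by simp [hδ]
  have hγ' : ∀ t ∈ Set.Ioo (-δ) δ, HasDerivAt γ (P (γ t) v) t := fun t ht ↦
    hγ t ⟨by linarith [ht.1], by linarith [ht.2]⟩
  have dlam : ∀ t ∈ Set.Ioo (-δ) δ, HasDerivAt (fun t ↦ lam (γ t)) 0 t := fun t ht ↦ by
    have := (h.diff_lam (hδU t ht)).hasFDerivAt.comp_hasDerivAt t (hγ' t ht)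
    rwa [hlam _ (hδU t ht)] at this
  have clam : ∀ t ∈ Set.Ioo (-δ) δ, lam (γ t) = lam x := fun t ht ↦ by
    rw [← hγ0]
    exact isOpen_Ioo.is_const_of_deriv_eq_zero isPreconnected_Ioo
      (fun s hs ↦ (dlam s hs).differentiableAt.differentiableWithinAt)
      (fun s hs ↦ (dlam s hs).deriv) ht h0
  have dmu : ∀ t ∈ Set.Ioo (-δ) δ,
      HasDerivAt (fun t ↦ mu (γ t)) (fderiv ℝ mu (γ t) (P (γ t) v)) t := fun t ht ↦
    (h.diff_mu (hδU t ht)).hasFDerivAt.comp_hasDerivAt t (hγ' t ht)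
  have himage : ((fun t ↦ mu (γ t)) '' Set.Ioo (-δ) δ).Subsingleton := by
    refine hfin.countable.isTotallyDisconnected _ ?_
      (isPreconnected_Ioo.image _ fun t ht ↦ (dmu t ht).continuousAt.continuousWithinAt)
    · rintro _ ⟨t, ht, rfl⟩
      change F (lam x) (mu (γ t)) = c
      rw [← clam t ht]
      exact hF _ (hδU t ht)
  have hev : (fun t ↦ mu (γ t)) =ᶠ[nhds 0] fun _ ↦ mu x := by
    filter_upwards [isOpen_Ioo.mem_nhds h0] with t ht
    rw [← hγ0]
    exact himage (Set.mem_image_of_mem _ ht) (Set.mem_image_of_mem _ h0)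
  have h1 := (dmu 0 h0).deriv
  rw [hev.deriv_eq, hγ0] at h1
  simpa using h1.symm

end PrincipalPatch

end Patch

/-! ### Symmetric operators with two eigenvalues -/

section TwoEigenvalues

namespace LinearMap.IsSymmetric

variable {V : Type*} [NormedAddCommGroup V] [InnerProductSpace ℝ V] [FiniteDimensional ℝ V]
  {T : V →ₗ[ℝ] V} (hT : T.IsSymmetric) {a b : ℝ}
  (hspec : {c : ℝ | Module.End.HasEigenvalue T c} = {a, b})
include hT hspec

/-- Checked on an orthonormal eigenbasis. The relation (T − a)(T − b) = 0 is what makes (A − μ)/(λ −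
μ) a projection. -/
theorem mul_eq_zero_of_two (v : V) : T (T v) = (a + b) • T v - (a * b) • v := by
  have : T ∘ₗ T = (a + b) • T - (a * b) • LinearMap.id := by
    refine (hT.eigenvectorBasis rfl).toBasis.ext fun i ↦ ?_
    have h1 : hT.eigenvalues rfl i ∈ {c : ℝ | Module.End.HasEigenvalue T c} :=
      hT.hasEigenvalue_eigenvalues rfl i
    rw [hspec] at h1
    simp only [OrthonormalBasis.coe_toBasis, LinearMap.comp_apply, hT.apply_eigenvectorBasis,
      LinearMap.sub_apply, LinearMap.smul_apply, LinearMap.id_apply, map_smul]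
    rcases h1 with h1 | h1
    · rw [h1]; simp only [RCLike.ofReal_real_eq_id, _root_.id]; module
    · rw [h1]; simp only [RCLike.ofReal_real_eq_id, _root_.id]; module
  exact LinearMap.congr_fun this v

variable (hab : a ≠ b)
include hab

theorem map_eigenvalues_of_two {α : Type*} (g : ℝ → α) :
    Multiset.map (g ∘ hT.eigenvalues rfl) Finset.univ.val
      = Multiset.replicate (Module.finrank ℝ (Module.End.eigenspace T a)) (g a)
        + Multiset.replicate (Module.finrank ℝ (Module.End.eigenspace T b)) (g b) := by
  have hval : ∀ i, hT.eigenvalues rfl i = a ∨ hT.eigenvalues rfl i = b := by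
    intro i
    have h1 : hT.eigenvalues rfl i ∈ {c : ℝ | Module.End.HasEigenvalue T c} :=
      hT.hasEigenvalue_eigenvalues rfl i
    rwa [hspec] at h1
  have ha := hT.card_filter_eigenvalues_eq rfl a
  have hb := hT.card_filter_eigenvalues_eq rfl b
  rw [← ha, ← hb, ← Multiset.filter_add_not (fun i ↦ hT.eigenvalues rfl i = a) Finset.univ.val,
    Multiset.map_add]
  congr 1
  · rw [Multiset.eq_replicate]
    refine ⟨by rw [Multiset.card_map]; rfl, ?_⟩
    simp only [Multiset.mem_map, Multiset.mem_filter]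
    rintro _ ⟨i, ⟨-, hi⟩, rfl⟩
    simp [hi]
  · have hfe : Multiset.filter (fun i ↦ ¬ hT.eigenvalues rfl i = a) Finset.univ.val
        = Multiset.filter (fun i ↦ hT.eigenvalues rfl i = b) Finset.univ.val := by
      refine Multiset.filter_congr fun i _ ↦ ⟨fun h ↦ (hval i).resolve_left h, fun h ↦ ?_⟩
      rw [h]; exact hab.symm
    rw [hfe, Multiset.eq_replicate]
    refine ⟨by rw [Multiset.card_map]; rfl, ?_⟩
    simp only [Multiset.mem_map, Multiset.mem_filter]
    rintro _ ⟨i, ⟨-, hi⟩, rfl⟩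
    simp [hi]

theorem finrank_add_finrank_of_two :
    Module.finrank ℝ (Module.End.eigenspace T a) + Module.finrank ℝ (Module.End.eigenspace T b)
      = Module.finrank ℝ V := by
  simpa using (congrArg Multiset.card (hT.map_eigenvalues_of_two hspec hab (fun x ↦ x))).symm

theorem roots_charpoly_of_two :
    T.charpoly.roots
      = Multiset.replicate (Module.finrank ℝ (Module.End.eigenspace T a)) a
        + Multiset.replicate (Module.finrank ℝ (Module.End.eigenspace T b)) b := by
  rw [hT.roots_charpoly_eq_eigenvalues rfl]
  exact hT.map_eigenvalues_of_two hspec hab (fun x ↦ x)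

theorem trace_pow_of_two (i : ℕ) :
    LinearMap.trace ℝ V (T ^ i)
      = Module.finrank ℝ (Module.End.eigenspace T a) * a ^ i
        + Module.finrank ℝ (Module.End.eigenspace T b) * b ^ i := by
  rw [LinearMap.trace_eq_matrix_trace ℝ (hT.eigenvectorBasis rfl).toBasis,
    ← LinearMap.toMatrix_pow, hT.toMatrix_eigenvectorBasis rfl, Matrix.diagonal_pow,
    Matrix.trace_diagonal]
  have := congrArg Multiset.sum (hT.map_eigenvalues_of_two hspec hab (fun x ↦ x ^ i))
  simp only [Multiset.sum_add, Multiset.sum_replicate, nsmul_eq_mul] at this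
  rw [← this]
  rfl

end LinearMap.IsSymmetric

end TwoEigenvalues

/-! ### Elementary symmetric functions of two repeated values -/

section SymmetricFunction

open Polynomial in
-- Reading the symmetric function as the coefficient of X^{k+l−m} in (X + x)^k (X + y)^l gives a
-- polynomial in y. It is nonconstant for x ≠ 0, so it takes each value finitely often.
theorem finite_setOf_esymm_eq {k l m : ℕ} (hm : 1 ≤ m) (hmn : m ≤ k + l) (hl : 1 ≤ l) {x : ℝ}
    (hx : x ≠ 0) (c : ℝ) :
    {y : ℝ | (Multiset.replicate k x + Multiset.replicate l y).esymm m = c}.Finite := by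
  have key : ∀ y : ℝ, (Multiset.replicate k x + Multiset.replicate l y).esymm m
      = ∑ ij ∈ Finset.HasAntidiagonal.antidiagonal (k + l - m),
        (x ^ (k - ij.1) * (k.choose ij.1 : ℝ)) * (y ^ (l - ij.2) * (l.choose ij.2 : ℝ)) := by
    intro y
    have h1 := Multiset.prod_X_add_C_coeff (Multiset.replicate k x + Multiset.replicate l y)
      (k := k + l - m) (by simp)
    rw [Multiset.card_add, Multiset.card_replicate, Multiset.card_replicate,
      Nat.sub_sub_self hmn] at h1
    rw [← h1]
    simp only [Multiset.map_add, Multiset.map_replicate, Multiset.prod_add,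
      Multiset.prod_replicate]
    rw [coeff_mul]
    simp only [coeff_X_add_C_pow]
  set Q : ℝ[X] := ∑ ij ∈ Finset.HasAntidiagonal.antidiagonal (k + l - m),
    C ((x ^ (k - ij.1) * (k.choose ij.1 : ℝ)) * (l.choose ij.2 : ℝ)) * X ^ (l - ij.2) with hQ
  have hQe : ∀ y, (Multiset.replicate k x + Multiset.replicate l y).esymm m = Q.eval y := by
    intro y
    rw [key, hQ, eval_finsetSum]
    refine Finset.sum_congr rfl fun ij _ ↦ ?_
    simp only [eval_mul, eval_C, eval_pow, eval_X]
    ring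
  -- Choice of a power y^{l−j} of positive degree whose coefficient is nonzero: j ≤ l − 1 makes the
  -- degree positive, and the complementary index k + l − m − j is at most k because m ≥ 1.
  set j := min (l - 1) (k + l - m) with hj
  have hne : Q - C c ≠ 0 := by
    intro h0
    have h1 : (Q - C c).coeff (l - j) = 0 := by rw [h0, coeff_zero]
    rw [coeff_sub, coeff_C, if_neg (by omega), sub_zero, hQ, finsetSum_coeff,
      Finset.sum_eq_single (k + l - m - j, j)] at h1
    · rw [coeff_C_mul, coeff_X_pow, if_pos rfl, mul_one] at h1
      have c1 : (k.choose (k + l - m - j) : ℝ) ≠ 0 := by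
        exact_mod_cast (Nat.choose_pos (by omega)).ne'
      have c2 : (l.choose j : ℝ) ≠ 0 := by
        exact_mod_cast (Nat.choose_pos (by omega)).ne'
      exact mul_ne_zero (mul_ne_zero (pow_ne_zero _ hx) c1) c2 h1
    · rintro ⟨i', j'⟩ hmem hne
      rw [Finset.HasAntidiagonal.mem_antidiagonal] at hmem
      simp only at hmem
      rw [coeff_C_mul, coeff_X_pow]
      by_cases hjl : j' ≤ l
      · rw [if_neg, mul_zero]
        intro h2
        apply hne
        ext <;> simp only <;> omega
      · simp only
        rw [Nat.choose_eq_zero_of_lt (n := l) (by omega)]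
        simp
    · intro hmem
      exact absurd (Finset.HasAntidiagonal.mem_antidiagonal.2 (by omega)) hmem
  refine ((Q - C c).roots.toFinset.finite_toSet).subset fun y hy ↦ ?_
  simp only [Finset.mem_coe, Multiset.mem_toFinset, mem_roots hne, IsRoot.def, eval_sub, eval_C]
  rw [← hQe, sub_eq_zero]
  exact hy

end SymmetricFunction

/-! ### Smooth left inverses of injective linear maps -/

section PseudoInverse

variable {E H : Type*} [NormedAddCommGroup E] [InnerProductSpace ℝ E] [FiniteDimensional ℝ E]
  [NormedAddCommGroup H] [InnerProductSpace ℝ H] [FiniteDimensional ℝ H]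

/-- The left inverse `(LᵀL)⁻¹Lᵀ` of an injective linear map `L`. -/
noncomputable def pseudoInverse (L : E →L[ℝ] H) : H →L[ℝ] E :=
  (ContinuousLinearMap.inverse (L.adjoint ∘L L)) ∘L L.adjoint

theorem exists_equiv_adjoint_comp {L : E →L[ℝ] H} (hL : ∀ v, L v = 0 → v = 0) :
    ∃ e : E ≃L[ℝ] E, (e : E →L[ℝ] E) = L.adjoint ∘L L := by
  have hinj : Function.Injective (L.adjoint ∘L L).toLinearMap := by
    rw [← LinearMap.ker_eq_bot, LinearMap.ker_eq_bot']
    intro v hv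
    apply hL
    rw [← inner_self_eq_zero (𝕜 := ℝ), ← ContinuousLinearMap.adjoint_inner_left]
    have : (L.adjoint) (L v) = 0 := hv
    rw [this, inner_zero_left]
  refine ⟨(LinearEquiv.ofInjectiveEndo _ hinj).toContinuousLinearEquiv, ?_⟩
  ext v
  rfl

theorem pseudoInverse_apply_self {L : E →L[ℝ] H} (hL : ∀ v, L v = 0 → v = 0) (v : E) :
    pseudoInverse L (L v) = v := by
  obtain ⟨e, he⟩ := exists_equiv_adjoint_comp hL
  rw [pseudoInverse, ← he, ContinuousLinearMap.inverse_equiv]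
  have : L.adjoint (L v) = e v := by
    change _ = (e : E →L[ℝ] E) v
    rw [he]; rfl
  simp [this]

/-- Inversion is smooth at the invertible operator LᵀL. This allows tangent vectors of the
hypersurface to be read in the chart with smooth dependence on the point. -/
theorem ContDiffOn.pseudoInverse {F : Type*} [NormedAddCommGroup F] [NormedSpace ℝ F]
    {U : Set F} {L : F → E →L[ℝ] H} (hL : ContDiffOn ℝ ∞ L U)
    (hinj : ∀ x ∈ U, ∀ v, L x v = 0 → v = 0) :
    ContDiffOn ℝ ∞ (fun x ↦ pseudoInverse (L x)) U := by
  have hadj : ContDiffOn ℝ ∞ (fun x ↦ (L x).adjoint) U :=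
    (ContinuousLinearMap.adjoint (𝕜 := ℝ) (E := E) (F := H)).toContinuousLinearEquiv.contDiff
      |>.comp_contDiffOn hL
  have hcomp : ContDiffOn ℝ ∞ (fun x ↦ (L x).adjoint ∘L L x) U := hadj.clm_comp hL
  refine ContDiffOn.clm_comp (fun x hx ↦ ?_) hadj
  obtain ⟨e, he⟩ := exists_equiv_adjoint_comp (hinj x hx)
  have h1 : ContDiffAt ℝ ∞ ContinuousLinearMap.inverse ((L x).adjoint ∘L L x) := by
    rw [← he]; exact contDiffAt_map_inverse e
  exact h1.comp_contDiffWithinAt x (hcomp x hx)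

end PseudoInverse

/-! ### Passing between the manifold and its charts -/

section ChartFrame

variable {n : ℕ} {M : Type*} [TopologicalSpace M] [ChartedSpace (EuclideanSpace ℝ (Fin n)) M]

/-- The frame at `(extChartAt p₀).symm y` given by the chart at `p₀`. -/
noncomputable def chartFrame (p₀ : M) (y : EuclideanSpace ℝ (Fin n)) :
    EuclideanSpace ℝ (Fin n) →ₗ[ℝ] TangentSpace (𝓡 n) ((extChartAt (𝓡 n) p₀).symm y) :=
  (mfderiv 𝓘(ℝ, EuclideanSpace ℝ (Fin n)) (𝓡 n) (extChartAt (𝓡 n) p₀).symm y).toLinearMap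

variable [IsManifold (𝓡 n) ∞ M]

theorem isOpen_target (p₀ : M) : IsOpen (extChartAt (𝓡 n) p₀).target :=
  isOpen_extChartAt_target p₀

theorem bijective_chartFrame (p₀ : M) {y : EuclideanSpace ℝ (Fin n)}
    (hy : y ∈ (extChartAt (𝓡 n) p₀).target) : Function.Bijective (chartFrame p₀ y) := by
  have : IsManifold (𝓡 n) 1 M := IsManifold.of_le (n := ∞) (by simp)
  have h1 := isInvertible_mfderivWithin_extChartAt_symm (I := 𝓡 n) hy
  rw [ModelWithCorners.range_eq_univ, mfderivWithin_univ] at h1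
  exact h1.bijective

theorem mdifferentiableAt_chart_symm (p₀ : M) {y : EuclideanSpace ℝ (Fin n)}
    (hy : y ∈ (extChartAt (𝓡 n) p₀).target) :
    MDifferentiableAt 𝓘(ℝ, EuclideanSpace ℝ (Fin n)) (𝓡 n) (extChartAt (𝓡 n) p₀).symm y :=
  ((contMDiffOn_extChartAt_symm (n := ∞) p₀).contMDiffAt
    ((isOpen_target p₀).mem_nhds hy)).mdifferentiableAt (by simp)

theorem fderiv_comp_chart {G : Type*} [NormedAddCommGroup G] [NormedSpace ℝ G] {g : M → G}
    (p₀ : M) {y : EuclideanSpace ℝ (Fin n)} (hy : y ∈ (extChartAt (𝓡 n) p₀).target)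
    (hg : MDifferentiableAt (𝓡 n) 𝓘(ℝ, G) g ((extChartAt (𝓡 n) p₀).symm y))
    (v : EuclideanSpace ℝ (Fin n)) :
    fderiv ℝ (g ∘ (extChartAt (𝓡 n) p₀).symm) y v
      = mvfderiv (𝓡 n) g ((extChartAt (𝓡 n) p₀).symm y) (chartFrame p₀ y v) := by
  have h1 := mfderiv_comp_apply y hg (mdifferentiableAt_chart_symm p₀ hy) v
  rw [mfderiv_eq_fderiv] at h1
  exact h1

theorem ContMDiff.contDiffOn_chart {G : Type*} [NormedAddCommGroup G] [NormedSpace ℝ G] {g : M → G}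
    (hg : ContMDiff (𝓡 n) 𝓘(ℝ, G) ∞ g) (p₀ : M) :
    ContDiffOn ℝ ∞ (g ∘ (extChartAt (𝓡 n) p₀).symm) (extChartAt (𝓡 n) p₀).target := by
  rw [← contMDiffOn_iff_contDiffOn]
  exact hg.comp_contMDiffOn (contMDiffOn_extChartAt_symm p₀)

theorem contMDiff_of_contDiffOn_chart {G : Type*} [NormedAddCommGroup G] [NormedSpace ℝ G]
    {g : M → G} (hg : ∀ p₀ : M,
      ContDiffOn ℝ ∞ (g ∘ (extChartAt (𝓡 n) p₀).symm) (extChartAt (𝓡 n) p₀).target) :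
    ContMDiff (𝓡 n) 𝓘(ℝ, G) ∞ g := by
  intro p
  have h1 : ContMDiffAt 𝓘(ℝ, EuclideanSpace ℝ (Fin n)) 𝓘(ℝ, G) ∞
      (g ∘ (extChartAt (𝓡 n) p).symm) (extChartAt (𝓡 n) p p) :=
    ((hg p).contDiffAt ((isOpen_target p).mem_nhds (mem_extChartAt_target p))).contMDiffAt
  have h2 := h1.comp p (contMDiffAt_extChartAt (n := ∞) (I := 𝓡 n) (x := p))
  refine h2.congr_of_eventuallyEq ?_
  filter_upwards [extChartAt_source_mem_nhds (I := 𝓡 n) p] with q hq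
  simp only [Function.comp_apply]
  rw [(extChartAt (𝓡 n) p).left_inv hq]

/-- A function with vanishing differential in each chart is locally constant. -/
theorem eventually_eq_of_fderiv_chart_eq_zero {G : Type*} [NormedAddCommGroup G] [NormedSpace ℝ G]
    {g : M → G} (p : M) {U : Set (EuclideanSpace ℝ (Fin n))} (hU : IsOpen U)
    (hpU : extChartAt (𝓡 n) p p ∈ U)
    (hg : DifferentiableOn ℝ (g ∘ (extChartAt (𝓡 n) p).symm) U)
    (hz : ∀ y ∈ U, fderiv ℝ (g ∘ (extChartAt (𝓡 n) p).symm) y = 0) :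
    ∀ᶠ q in nhds p, g q = g p := by
  obtain ⟨r, hr, hrU⟩ := Metric.isOpen_iff.1 hU _ hpU
  have h1 : ∀ᶠ q in nhds p, extChartAt (𝓡 n) p q ∈ Metric.ball (extChartAt (𝓡 n) p p) r :=
    (continuousAt_extChartAt (I := 𝓡 n) p).eventually (Metric.ball_mem_nhds _ hr)
  filter_upwards [h1, extChartAt_source_mem_nhds (I := 𝓡 n) p] with q hq hqs
  have := (Metric.isOpen_ball).is_const_of_fderiv_eq_zero
    (convex_ball (extChartAt (𝓡 n) p p) r).isPreconnected (hg.mono hrU)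
    (fun y hy ↦ hz y (hrU hy)) hq (Metric.mem_ball_self hr)
  rwa [Function.comp_apply, Function.comp_apply, (extChartAt (𝓡 n) p).left_inv hqs,
    extChartAt_to_inv] at this

/-- At the centre of the chart at p the frame is onto the tangent space. The base point there equals
p only propositionally, so the claim is carried along that equation. -/
theorem forall_tangent_of_forall_chart {Φ : ∀ p : M, TangentSpace (𝓡 n) p → Prop}
    (h : ∀ p₀ : M, ∀ y ∈ (extChartAt (𝓡 n) p₀).target, ∀ v,
      Φ ((extChartAt (𝓡 n) p₀).symm y) (chartFrame p₀ y v)) (p : M) (u : TangentSpace (𝓡 n) p) :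
    Φ p u := by
  have key : ∀ q : M, q = p → (∀ v : TangentSpace (𝓡 n) q, Φ q v) → Φ p u := by
    rintro _ rfl hv
    exact hv u
  have hy := mem_extChartAt_target (I := 𝓡 n) p
  refine key _ (extChartAt_to_inv (I := 𝓡 n) p) fun w ↦ ?_
  obtain ⟨v, rfl⟩ := (bijective_chartFrame p hy).2 w
  exact h p _ hy v

end ChartFrame

/-! ### The shape operator: Weingarten formula, symmetry, smooth traces -/

section Hypersurface

variable {n : ℕ} {M : Type*} [TopologicalSpace M] [ChartedSpace (EuclideanSpace ℝ (Fin n)) M]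
  [IsManifold (𝓡 n) ∞ M]
  [Bundle.RiemannianBundle (fun p : M ↦ TangentSpace (𝓡 n) p)]

/-- A hypersurface of the sphere as a map to the ambient Euclidean space. -/
def ambientMap (f : M → USphere (n + 1)) (q : M) : EuclideanSpace ℝ (Fin (n + 1 + 1)) := f q

instance finiteDimensional_tangentSpace (p : M) : FiniteDimensional ℝ (TangentSpace (𝓡 n) p) :=
  inferInstanceAs (FiniteDimensional ℝ (EuclideanSpace ℝ (Fin n)))

theorem finrank_tangentSpace (p : M) : Module.finrank ℝ (TangentSpace (𝓡 n) p) = n := by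
  have : Module.finrank ℝ (EuclideanSpace ℝ (Fin n)) = n := by simp
  exact this

/-- The shape operator in the chart at `p₀`. -/
noncomputable def shapeCoord (f : M → USphere (n + 1))
    (N : M → EuclideanSpace ℝ (Fin (n + 1 + 1))) (p₀ : M) (y : EuclideanSpace ℝ (Fin n)) :
    EuclideanSpace ℝ (Fin n) →L[ℝ] EuclideanSpace ℝ (Fin n) :=
  -(pseudoInverse (fderiv ℝ (ambientMap f ∘ (extChartAt (𝓡 n) p₀).symm) y) ∘L
    fderiv ℝ (N ∘ (extChartAt (𝓡 n) p₀).symm) y)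

namespace IsOrientedHypersurface

variable {f : M → USphere (n + 1)} {N : M → EuclideanSpace ℝ (Fin (n + 1 + 1))}
  (hf : IsOrientedHypersurface f N)
include hf

theorem contMDiff_ambient :
    ContMDiff (𝓡 n) 𝓘(ℝ, EuclideanSpace ℝ (Fin (n + 1 + 1))) ∞ (ambientMap f) :=
  have : Fact (Module.finrank ℝ (EuclideanSpace ℝ (Fin (n + 1 + 1))) = n + 1 + 1) :=
    Fact.mk finrank_euclideanSpace_fin
  (contMDiff_coe_sphere (E := EuclideanSpace ℝ (Fin (n + 1 + 1))) (m := ∞) (n := n + 1)).comp hf.contMDiff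

theorem mdiff_ambient (p : M) :
    MDifferentiableAt (𝓡 n) 𝓘(ℝ, EuclideanSpace ℝ (Fin (n + 1 + 1))) (ambientMap f) p :=
  hf.contMDiff_ambient.mdifferentiableAt (by simp)

theorem mdiff_normal (p : M) :
    MDifferentiableAt (𝓡 n) 𝓘(ℝ, EuclideanSpace ℝ (Fin (n + 1 + 1))) N p :=
  hf.contMDiff_normal.mdifferentiableAt (by simp)

theorem fderiv_ambient (p₀ : M) {y : EuclideanSpace ℝ (Fin n)}
    (hy : y ∈ (extChartAt (𝓡 n) p₀).target) (v : EuclideanSpace ℝ (Fin n)) :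
    fderiv ℝ (ambientMap f ∘ (extChartAt (𝓡 n) p₀).symm) y v
      = sphereDifferential f ((extChartAt (𝓡 n) p₀).symm y) (chartFrame p₀ y v) :=
  fderiv_comp_chart p₀ hy (hf.mdiff_ambient _) v

theorem fderiv_normal (p₀ : M) {y : EuclideanSpace ℝ (Fin n)}
    (hy : y ∈ (extChartAt (𝓡 n) p₀).target) (v : EuclideanSpace ℝ (Fin n)) :
    fderiv ℝ (N ∘ (extChartAt (𝓡 n) p₀).symm) y v
      = mvfderiv (𝓡 n) N ((extChartAt (𝓡 n) p₀).symm y) (chartFrame p₀ y v) :=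
  fderiv_comp_chart p₀ hy (hf.mdiff_normal _) v

theorem inner_ambient_self (p : M) : inner ℝ (ambientMap f p) (ambientMap f p) = 1 := by
  simp [ambientMap]

theorem inner_normal_self (p : M) : inner ℝ (N p) (N p) = 1 := by
  simp [hf.norm_normal p]

theorem inner_ambient_normal (p : M) : inner ℝ (ambientMap f p) (N p) = 0 := by
  rw [real_inner_comm]; exact hf.normal_tangent_sphere p

theorem inner_differential_normal (p : M) (u : TangentSpace (𝓡 n) p) :
    inner ℝ (sphereDifferential f p u) (N p) = 0 := by
  rw [real_inner_comm]; exact hf.normal_orthogonal p u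

theorem injective_differential (p : M) (u : TangentSpace (𝓡 n) p)
    (hu : sphereDifferential f p u = 0) : u = 0 := by
  rw [← inner_self_eq_zero (𝕜 := ℝ), ← hf.isometric p u u, hu, inner_zero_left]

theorem smooth_ambient_chart (p₀ : M) :
    ContDiffOn ℝ ∞ (ambientMap f ∘ (extChartAt (𝓡 n) p₀).symm) (extChartAt (𝓡 n) p₀).target :=
  hf.contMDiff_ambient.contDiffOn_chart p₀

theorem smooth_normal_chart (p₀ : M) :
    ContDiffOn ℝ ∞ (N ∘ (extChartAt (𝓡 n) p₀).symm) (extChartAt (𝓡 n) p₀).target :=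
  hf.contMDiff_normal.contDiffOn_chart p₀

theorem inner_ambient_differential (p : M) (u : TangentSpace (𝓡 n) p) :
    inner ℝ (ambientMap f p) (sphereDifferential f p u) = 0 := by
  revert p
  refine forall_tangent_of_forall_chart fun p₀ y hy v ↦ ?_
  have hd := (hf.smooth_ambient_chart p₀).differentiableAt_of_isOpen (isOpen_target p₀) hy
  have h1 := inner_fderiv_add_eq_zero (isOpen_target p₀) hy hd hd
    (fun z _ ↦ hf.inner_ambient_self _) v
  rw [hf.fderiv_ambient p₀ hy, real_inner_comm _ (sphereDifferential f _ _)] at h1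
  simp only [Function.comp_apply] at h1
  linarith

theorem inner_normal_dnormal (p : M) (u : TangentSpace (𝓡 n) p) :
    inner ℝ (N p) (mvfderiv (𝓡 n) N p u) = 0 := by
  revert p
  refine forall_tangent_of_forall_chart fun p₀ y hy v ↦ ?_
  have hd := (hf.smooth_normal_chart p₀).differentiableAt_of_isOpen (isOpen_target p₀) hy
  have h1 := inner_fderiv_add_eq_zero (isOpen_target p₀) hy hd hd
    (fun z _ ↦ hf.inner_normal_self _) v
  rw [hf.fderiv_normal p₀ hy, real_inner_comm _ (mvfderiv (𝓡 n) N _ _)] at h1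
  simp only [Function.comp_apply] at h1
  linarith

theorem inner_ambient_dnormal (p : M) (u : TangentSpace (𝓡 n) p) :
    inner ℝ (ambientMap f p) (mvfderiv (𝓡 n) N p u) = 0 := by
  revert p
  refine forall_tangent_of_forall_chart fun p₀ y hy v ↦ ?_
  have hd := (hf.smooth_normal_chart p₀).differentiableAt_of_isOpen (isOpen_target p₀) hy
  have hd' := (hf.smooth_ambient_chart p₀).differentiableAt_of_isOpen (isOpen_target p₀) hy
  have h1 := inner_fderiv_add_eq_zero (isOpen_target p₀) hy hd' hd
    (fun z _ ↦ hf.inner_ambient_normal _) v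
  rw [hf.fderiv_normal p₀ hy, hf.fderiv_ambient p₀ hy] at h1
  simp only [Function.comp_apply, hf.inner_differential_normal] at h1
  linarith

/-- The image of df together with f and N is independent and has dimension n + 2, so it is the whole
space. -/
theorem eq_zero_of_orthogonal (p : M) {w : EuclideanSpace ℝ (Fin (n + 1 + 1))}
    (h1 : inner ℝ w (ambientMap f p) = 0) (h2 : inner ℝ w (N p) = 0)
    (h3 : ∀ u, inner ℝ w (sphereDifferential f p u) = 0) : w = 0 := by
  set Φ : (TangentSpace (𝓡 n) p × ℝ × ℝ) →ₗ[ℝ] EuclideanSpace ℝ (Fin (n + 1 + 1)) :=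
    (sphereDifferential f p).toLinearMap.coprod
      ((LinearMap.toSpanSingleton ℝ _ (ambientMap f p)).coprod
        (LinearMap.toSpanSingleton ℝ _ (N p))) with hΦ
  have hΦa : ∀ u s t, Φ (u, s, t) = sphereDifferential f p u + (s • ambientMap f p + t • N p) := by
    intro u s t
    simp [hΦ]
  have hinj : Function.Injective Φ := by
    rw [← LinearMap.ker_eq_bot, LinearMap.ker_eq_bot']
    rintro ⟨u, s, t⟩ h0
    rw [hΦa] at h0
    have hs := congrArg (inner ℝ (ambientMap f p)) h0
    have ht := congrArg (inner ℝ (N p)) h0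
    simp only [inner_add_right, inner_smul_right, hf.inner_ambient_differential p,
      hf.inner_ambient_self p, hf.inner_ambient_normal p, hf.normal_orthogonal p,
      hf.inner_normal_self p, real_inner_comm (ambientMap f p) (N p), inner_zero_right] at hs ht
    have hs' : s = 0 := by linarith
    have ht' : t = 0 := by linarith
    subst hs' ht'
    simp only [zero_smul, add_zero] at h0
    rw [hf.injective_differential p u h0]
    rfl
  have hsurj : Function.Surjective Φ := by
    rw [← LinearMap.range_eq_top]
    apply Submodule.eq_top_of_finrank_eq
    rw [LinearMap.finrank_range_of_inj hinj, Module.finrank_prod, Module.finrank_prod,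
      finrank_tangentSpace]
    simp
  obtain ⟨⟨u, s, t⟩, hust⟩ := hsurj w
  rw [hΦa] at hust
  rw [← inner_self_eq_zero (𝕜 := ℝ)]
  conv_lhs => rw [← hust]
  rw [real_inner_comm, hust]
  conv_lhs => enter [3]; rw [← hust]
  simp [inner_add_right, inner_smul_right, h1, h2, h3]

/-- The Weingarten formula. -/
theorem dnormal_eq (p : M) (u : TangentSpace (𝓡 n) p) :
    mvfderiv (𝓡 n) N p u = -sphereDifferential f p (shapeOperator f N p u) := by
  rw [eq_neg_iff_add_eq_zero]
  apply hf.eq_zero_of_orthogonal p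
  · rw [inner_add_left, real_inner_comm, hf.inner_ambient_dnormal, real_inner_comm,
      hf.inner_ambient_differential, add_zero]
  · rw [inner_add_left, real_inner_comm, hf.inner_normal_dnormal, hf.inner_differential_normal,
      add_zero]
  · intro v
    rw [inner_add_left, hf.isometric, inner_shapeOperator]
    ring

/-- In a chart the second fundamental form is ⟨N, f_ab⟩, by differentiating ⟨N, df b⟩ = 0, and f_ab
is symmetric. -/
theorem isSymmetric_shapeOperator (p : M) : (shapeOperator f N p).IsSymmetric := by
  intro u v
  revert v
  revert p
  refine forall_tangent_of_forall_chart fun p₀ y hy a w ↦ ?_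
  obtain ⟨b, rfl⟩ := (bijective_chartFrame p₀ hy).2 w
  rw [inner_shapeOperator, real_inner_comm (shapeOperator f N _ (chartFrame p₀ y b)),
    inner_shapeOperator, ← hf.fderiv_ambient p₀ hy, ← hf.fderiv_ambient p₀ hy,
    ← hf.fderiv_normal p₀ hy, ← hf.fderiv_normal p₀ hy]
  have hd := (hf.smooth_normal_chart p₀).differentiableAt_of_isOpen (isOpen_target p₀) hy
  have key : ∀ a b, inner ℝ (fderiv ℝ (N ∘ (extChartAt (𝓡 n) p₀).symm) y a)
      (fderiv ℝ (ambientMap f ∘ (extChartAt (𝓡 n) p₀).symm) y b)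
      = -inner ℝ ((N ∘ (extChartAt (𝓡 n) p₀).symm) y)
        (fderiv ℝ (fderiv ℝ (ambientMap f ∘ (extChartAt (𝓡 n) p₀).symm)) y a b) := by
    intro a b
    have h1 := inner_fderiv_add_eq_zero (c := 0) (isOpen_target p₀) hy hd
      (differentiableAt_fderiv_apply (isOpen_target p₀) (hf.smooth_ambient_chart p₀) hy
        (differentiableAt_const b))
      (fun z hz ↦ by rw [hf.fderiv_ambient p₀ hz]; exact hf.normal_orthogonal _ _) a
    rw [fderiv_fderiv_apply_const (isOpen_target p₀) (hf.smooth_ambient_chart p₀) hy] at h1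
    linarith
  rw [key, key, fderiv_fderiv_symm (isOpen_target p₀) (hf.smooth_ambient_chart p₀) hy]

theorem injective_fderiv_ambient (p₀ : M) {y : EuclideanSpace ℝ (Fin n)}
    (hy : y ∈ (extChartAt (𝓡 n) p₀).target) (v : EuclideanSpace ℝ (Fin n))
    (hv : fderiv ℝ (ambientMap f ∘ (extChartAt (𝓡 n) p₀).symm) y v = 0) : v = 0 := by
  rw [hf.fderiv_ambient p₀ hy] at hv
  have h1 := hf.injective_differential _ _ hv
  exact (bijective_chartFrame p₀ hy).1 (h1.trans (map_zero _).symm)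

theorem chartFrame_shapeCoord (p₀ : M) {y : EuclideanSpace ℝ (Fin n)}
    (hy : y ∈ (extChartAt (𝓡 n) p₀).target) (v : EuclideanSpace ℝ (Fin n)) :
    chartFrame p₀ y (shapeCoord f N p₀ y v)
      = shapeOperator f N ((extChartAt (𝓡 n) p₀).symm y) (chartFrame p₀ y v) := by
  obtain ⟨w, hw⟩ := (bijective_chartFrame p₀ hy).2
    (shapeOperator f N ((extChartAt (𝓡 n) p₀).symm y) (chartFrame p₀ y v))
  rw [← hw]
  congr 1
  simp only [shapeCoord, neg_apply, ContinuousLinearMap.comp_apply]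
  rw [hf.fderiv_normal p₀ hy, hf.dnormal_eq, ← hw, ← hf.fderiv_ambient p₀ hy, map_neg,
    pseudoInverse_apply_self (hf.injective_fderiv_ambient p₀ hy), neg_neg]

theorem smooth_shapeCoord (p₀ : M) :
    ContDiffOn ℝ ∞ (shapeCoord f N p₀) (extChartAt (𝓡 n) p₀).target :=
  (((hf.smooth_ambient_chart p₀).fderiv_smooth (isOpen_target p₀)).pseudoInverse
    (fun _ hy ↦ hf.injective_fderiv_ambient p₀ hy)).clm_comp
      ((hf.smooth_normal_chart p₀).fderiv_smooth (isOpen_target p₀)) |>.neg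

theorem trace_shapeCoord_pow (p₀ : M) {y : EuclideanSpace ℝ (Fin n)}
    (hy : y ∈ (extChartAt (𝓡 n) p₀).target) (i : ℕ) :
    LinearMap.trace ℝ _ ((shapeCoord f N p₀ y ^ i).toLinearMap)
      = LinearMap.trace ℝ _ (shapeOperator f N ((extChartAt (𝓡 n) p₀).symm y) ^ i) := by
  set D := LinearEquiv.ofBijective (chartFrame p₀ y) (bijective_chartFrame p₀ hy) with hD
  have h1 : D.conj ((shapeCoord f N p₀ y ^ i).toLinearMap)
      = shapeOperator f N ((extChartAt (𝓡 n) p₀).symm y) ^ i := by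
    ext w
    obtain ⟨v, rfl⟩ := D.surjective w
    rw [LinearEquiv.conj_apply_apply, D.symm_apply_apply]
    change chartFrame p₀ y ((shapeCoord f N p₀ y ^ i) v)
      = (shapeOperator f N ((extChartAt (𝓡 n) p₀).symm y) ^ i) (chartFrame p₀ y v)
    induction i generalizing v with
    | zero => rfl
    | succ i ih =>
      rw [pow_succ, pow_succ]
      change chartFrame p₀ y ((shapeCoord f N p₀ y ^ i) (shapeCoord f N p₀ y v)) = _
      rw [ih, hf.chartFrame_shapeCoord p₀ hy]
      rfl
  rw [← h1, LinearMap.trace_conj']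

/-- Traces do not depend on the frame, so they may be computed from the smooth matrix field
`shapeCoord`. They are smooth before anything is known about the eigenvalues. -/
theorem contMDiff_trace_pow (i : ℕ) :
    ContMDiff (𝓡 n) 𝓘(ℝ, ℝ) ∞
      (fun p ↦ LinearMap.trace ℝ (TangentSpace (𝓡 n) p) (shapeOperator f N p ^ i)) := by
  refine contMDiff_of_contDiffOn_chart fun p₀ ↦ ?_
  have h1 : ContDiffOn ℝ ∞ (fun y ↦ shapeCoord f N p₀ y ^ i) (extChartAt (𝓡 n) p₀).target :=
    (hf.smooth_shapeCoord p₀).pow i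
  have h2 : ContDiff ℝ ∞ (fun L : EuclideanSpace ℝ (Fin n) →L[ℝ] EuclideanSpace ℝ (Fin n) ↦
      LinearMap.trace ℝ _ L.toLinearMap) :=
    (LinearMap.toContinuousLinearMap ((LinearMap.trace ℝ (EuclideanSpace ℝ (Fin n))) ∘ₗ
      (ContinuousLinearMap.coeLM ℝ))).contDiff
  refine (h2.comp_contDiffOn h1).congr fun y hy ↦ ?_
  exact (hf.trace_shapeCoord_pow p₀ hy i).symm

end IsOrientedHypersurface

end Hypersurface

/-! ### Constant multiplicities and smooth principal curvatures -/

section TwoCurvatures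

variable {n : ℕ} {M : Type*} [TopologicalSpace M] [ChartedSpace (EuclideanSpace ℝ (Fin n)) M]
  [IsManifold (𝓡 n) ∞ M]
  [Bundle.RiemannianBundle (fun p : M ↦ TangentSpace (𝓡 n) p)]

/-- The hypersurface has exactly two principal curvatures `lam` and `mu`, which are smooth
functions and have constant multiplicities `k` and `l`. -/
structure HasTwoCurvatures (f : M → USphere (n + 1)) (N : M → EuclideanSpace ℝ (Fin (n + 1 + 1)))
    (lam mu : M → ℝ) (k l : ℕ) : Prop where
  ne : ∀ p, lam p ≠ mu p
  spec : ∀ p, principalCurvatures f N p = {lam p, mu p}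
  rank_lam : ∀ p, principalMultiplicity f N p (lam p) = k
  rank_mu : ∀ p, principalMultiplicity f N p (mu p) = l
  smooth_lam : ContMDiff (𝓡 n) 𝓘(ℝ, ℝ) ∞ lam
  smooth_mu : ContMDiff (𝓡 n) 𝓘(ℝ, ℝ) ∞ mu

theorem HasTwoCurvatures.swap {f : M → USphere (n + 1)}
    {N : M → EuclideanSpace ℝ (Fin (n + 1 + 1))} {lam mu : M → ℝ} {k l : ℕ}
    (h : HasTwoCurvatures f N lam mu k l) : HasTwoCurvatures f N mu lam l k where
  ne p := (h.ne p).symm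
  spec p := by rw [h.spec p, Set.pair_comm]
  rank_lam := h.rank_mu
  rank_mu := h.rank_lam
  smooth_lam := h.smooth_mu
  smooth_mu := h.smooth_lam

/-- The skewness of a two-valued distribution determines the weights. -/
theorem skewness_injective {n k k' : ℝ} (hk : 0 < k) (hkn : k < n) (hk' : 0 < k') (hkn' : k' < n)
    (h : (2 * k - n) / (n * √(k * (n - k) / n)) = (2 * k' - n) / (n * √(k' * (n - k') / n))) :
    k = k' := by
  have hn : 0 < n := hk.trans hkn
  have hp : 0 < k * (n - k) / n := div_pos (mul_pos hk (sub_pos.2 hkn)) hn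
  have hp' : 0 < k' * (n - k') / n := div_pos (mul_pos hk' (sub_pos.2 hkn')) hn
  set s := √(k * (n - k) / n) with hs
  set s' := √(k' * (n - k') / n) with hs'
  have s0 : 0 < s := Real.sqrt_pos.2 hp
  have s0' : 0 < s' := Real.sqrt_pos.2 hp'
  have e : s ^ 2 * n = k * (n - k) := by
    rw [hs, Real.sq_sqrt hp.le]; field_simp
  have e' : s' ^ 2 * n = k' * (n - k') := by
    rw [hs', Real.sq_sqrt hp'.le]; field_simp
  rw [div_eq_div_iff (by positivity) (by positivity)] at h
  have h1 : (2 * k - n) * s' = (2 * k' - n) * s :=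
    mul_left_cancel₀ hn.ne' (by linear_combination h)
  have h2 : n ^ 2 * (s' ^ 2 - s ^ 2) = 0 := by
    linear_combination congrArg (· ^ 2) h1 - 4 * s' ^ 2 * e + 4 * s ^ 2 * e'
  have h3 : s' = s := by
    have h4 : s' ^ 2 = s ^ 2 := sub_eq_zero.1 ((mul_eq_zero.1 h2).resolve_left (by positivity))
    exact (pow_left_inj₀ s0'.le s0.le two_ne_zero).1 h4
  rw [h3] at h1
  have := mul_right_cancel₀ s0.ne' h1
  linarith

namespace IsOrientedHypersurface

variable {f : M → USphere (n + 1)} {N : M → EuclideanSpace ℝ (Fin (n + 1 + 1))}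
  (hf : IsOrientedHypersurface f N)
include hf

/-- The skewness of the spectrum depends, once the curvatures are ordered, on the multiplicity alone
and injectively. Being continuous with finitely many values on a connected space, it is constant. -/
theorem exists_hasTwoCurvatures [ConnectedSpace M]
    (htwo : ∀ p : M, (principalCurvatures f N p).ncard = 2)
    (hmult : ∀ p : M, ∀ c ∈ principalCurvatures f N p, 1 < principalMultiplicity f N p c) :
    ∃ (lam mu : M → ℝ) (k l : ℕ), HasTwoCurvatures f N lam mu k l ∧ 2 ≤ k ∧ 2 ≤ l ∧ k + l = n := by
  have hex : ∀ p : M, ∃ a b : ℝ, a < b ∧ principalCurvatures f N p = {a, b} := by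
    intro p
    obtain ⟨x, y, hxy, hp⟩ := Set.ncard_eq_two.1 (htwo p)
    rcases lt_or_gt_of_ne hxy with h | h
    · exact ⟨x, y, h, hp⟩
    · exact ⟨y, x, h, by rw [hp, Set.pair_comm]⟩
  choose lam mu hlt hspec using hex
  set κ : M → ℕ := fun p ↦ principalMultiplicity f N p (lam p) with hκ
  set ℓ : M → ℕ := fun p ↦ principalMultiplicity f N p (mu p) with hℓ
  have hκ2 : ∀ p, 2 ≤ κ p := fun p ↦ hmult p _ (by rw [hspec p]; simp)
  have hℓ2 : ∀ p, 2 ≤ ℓ p := fun p ↦ hmult p _ (by rw [hspec p]; simp)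
  have hsum : ∀ p, κ p + ℓ p = n := fun p ↦
    ((hf.isSymmetric_shapeOperator p).finrank_add_finrank_of_two (hspec p) (hlt p).ne).trans
      (finrank_tangentSpace p)
  set t : ℕ → M → ℝ := fun i p ↦
    LinearMap.trace ℝ (TangentSpace (𝓡 n) p) (shapeOperator f N p ^ i) with ht
  have htr : ∀ i p, t i p = κ p * lam p ^ i + ℓ p * mu p ^ i := fun i p ↦
    (hf.isSymmetric_shapeOperator p).trace_pow_of_two (hspec p) (hlt p).ne i
  have st : ∀ i, ContMDiff (𝓡 n) 𝓘(ℝ, ℝ) ∞ (t i) := fun i ↦ hf.contMDiff_trace_pow i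
  obtain ⟨p₁⟩ : Nonempty M := inferInstance
  have hn0 : (0 : ℝ) < n := by
    have h1 := hsum p₁
    have h2 := hκ2 p₁
    exact_mod_cast (by omega : 0 < n)
  have hsumR : ∀ p, (ℓ p : ℝ) = n - κ p := fun p ↦ by
    rw [← hsum p]; push_cast; ring
  have hκ0 : ∀ p, (0 : ℝ) < κ p := fun p ↦ by exact_mod_cast (by have := hκ2 p; omega : 0 < κ p)
  have hℓ0 : ∀ p, (0 : ℝ) < ℓ p := fun p ↦ by exact_mod_cast (by have := hℓ2 p; omega : 0 < ℓ p)
  have hκn : ∀ p, (κ p : ℝ) < n := fun p ↦ by have := hℓ0 p; rw [hsumR] at this; linarith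
  -- The second and third central moments of the spectrum, summed rather than averaged, written in
  -- power traces; m2 > 0 because the two curvatures differ.
  set m2 : M → ℝ := fun p ↦ t 2 p - t 1 p ^ 2 / n with hm2
  set m3 : M → ℝ := fun p ↦ t 3 p - 3 * (t 1 p / n) * t 2 p + 2 * t 1 p ^ 3 / n ^ 2 with hm3
  have em2 : ∀ p, m2 p = (κ p * (n - κ p) / n) * (mu p - lam p) ^ 2 := by
    intro p
    simp only [hm2, htr, hsumR]
    field_simp
    ring
  have em3 : ∀ p, m3 p = κ p * (n - κ p) * (2 * κ p - n) / n ^ 2 * (mu p - lam p) ^ 3 := by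
    intro p
    simp only [hm3, htr, hsumR]
    field_simp
    ring
  have hkl0 : ∀ p, 0 < (κ p : ℝ) * (n - κ p) / n := fun p ↦
    div_pos (mul_pos (hκ0 p) (sub_pos.2 (hκn p))) hn0
  have m2pos : ∀ p, 0 < m2 p := fun p ↦ by
    rw [em2]; exact mul_pos (hkl0 p) (pow_pos (sub_pos.2 (hlt p)) 2)
  have esqrt : ∀ p, √(m2 p) = √(κ p * (n - κ p) / n) * (mu p - lam p) := by
    intro p
    rw [em2, Real.sqrt_mul (hkl0 p).le, Real.sqrt_sq (sub_pos.2 (hlt p)).le]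
  have sm2 : ContMDiff (𝓡 n) 𝓘(ℝ, ℝ) ∞ m2 := (st 2).sub (((st 1).pow 2).div_const _)
  have ssqrt : ContMDiff (𝓡 n) 𝓘(ℝ, ℝ) ∞ (fun p ↦ √(m2 p)) := fun p ↦
    (Real.contDiffAt_sqrt (m2pos p).ne').contMDiffAt.comp p (sm2 p)
  set r : M → ℝ := fun p ↦ m3 p / (m2 p * √(m2 p)) with hr
  have cr : Continuous r := by
    have c1 := (st 1).continuous
    have c2 := (st 2).continuous
    have c3 := (st 3).continuous
    refine Continuous.div ?_ (sm2.continuous.mul ssqrt.continuous) fun p ↦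
      (mul_pos (m2pos p) (Real.sqrt_pos.2 (m2pos p))).ne'
    simp only [hm3]
    fun_prop
  have er : ∀ p, r p = (2 * κ p - n) / (n * √(κ p * (n - κ p) / n)) := by
    intro p
    have h1 := Real.sqrt_pos.2 (hkl0 p)
    have h2 := sub_pos.2 (hlt p)
    have h3 := sub_pos.2 (hκn p)
    have h4 := hκ0 p
    simp only [hr]
    rw [esqrt, em2, em3]
    generalize √(κ p * (n - κ p) / n) = s at h1
    field_simp
  have hconst : ∀ p, κ p = κ p₁ := by
    intro p
    have hfin : (Set.range r).Finite := by
      refine ((Finset.range (n + 1)).finite_toSet.image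
        (fun j : ℕ ↦ (2 * (j : ℝ) - n) / (n * √(j * (n - j) / n)))).subset ?_
      rintro _ ⟨q, rfl⟩
      refine ⟨κ q, ?_, (er q).symm⟩
      have := hsum q
      simp only [Finset.coe_range, Set.mem_Iio]
      omega
    have hsub := hfin.countable.isTotallyDisconnected _ subset_rfl (isPreconnected_range cr)
    have h1 := hsub (Set.mem_range_self p) (Set.mem_range_self p₁)
    rw [er, er] at h1
    exact_mod_cast skewness_injective (hκ0 p) (hκn p) (hκ0 p₁) (hκn p₁) h1
  have hconst' : ∀ p, ℓ p = ℓ p₁ := fun p ↦ by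
    have h1 := hsum p
    have h2 := hsum p₁
    rw [hconst p] at h1
    omega
  set c : ℝ := √(κ p₁ * (n - κ p₁) / n) with hc
  have hc0 : 0 < c := Real.sqrt_pos.2 (hkl0 p₁)
  -- With fixed multiplicities the gap is √m2 up to a constant; together with the mean t₁/n it
  -- recovers both curvatures as smooth functions.
  have eδ : ∀ p, mu p - lam p = √(m2 p) / c := by
    intro p
    rw [esqrt, hconst p, ← hc]; field_simp
  have hlam : lam = fun p ↦ t 1 p / n - (ℓ p₁ : ℝ) / n * (√(m2 p) / c) := by
    ext p
    rw [← eδ, htr, hsumR p, hsumR p₁, hconst p]; field_simp; ring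
  have hmu : mu = fun p ↦ t 1 p / n + (κ p₁ : ℝ) / n * (√(m2 p) / c) := by
    ext p
    rw [← eδ, htr, hsumR p, hconst p]; field_simp; ring
  refine ⟨lam, mu, κ p₁, ℓ p₁, ⟨fun p ↦ (hlt p).ne, hspec, hconst, hconst', ?_, ?_⟩, hκ2 p₁,
    hℓ2 p₁, hsum p₁⟩
  · rw [hlam]
    exact ((st 1).div_const _).sub (contMDiff_const.mul (ssqrt.div_const _))
  · rw [hmu]
    exact ((st 1).div_const _).add (contMDiff_const.mul (ssqrt.div_const _))

end IsOrientedHypersurface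

end TwoCurvatures

/-! ### Both curvatures constant, or one identically zero -/

section TwoCurvatures

variable {n : ℕ} {M : Type*} [TopologicalSpace M] [ChartedSpace (EuclideanSpace ℝ (Fin n)) M]
  [IsManifold (𝓡 n) ∞ M]
  [Bundle.RiemannianBundle (fun p : M ↦ TangentSpace (𝓡 n) p)]

/-- The projection to the principal space of `lam` along that of `mu`, in the chart at `p₀`. -/
noncomputable def principalProjection (f : M → USphere (n + 1))
    (N : M → EuclideanSpace ℝ (Fin (n + 1 + 1))) (lam mu : M → ℝ) (p₀ : M)
    (y : EuclideanSpace ℝ (Fin n)) : EuclideanSpace ℝ (Fin n) →L[ℝ] EuclideanSpace ℝ (Fin n) :=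
  (lam ((extChartAt (𝓡 n) p₀).symm y) - mu ((extChartAt (𝓡 n) p₀).symm y))⁻¹ •
    (shapeCoord f N p₀ y
      - mu ((extChartAt (𝓡 n) p₀).symm y) • ContinuousLinearMap.id ℝ (EuclideanSpace ℝ (Fin n)))

namespace HasTwoCurvatures

variable {f : M → USphere (n + 1)} {N : M → EuclideanSpace ℝ (Fin (n + 1 + 1))}
  {lam mu : M → ℝ} {k l : ℕ} (h : HasTwoCurvatures f N lam mu k l)
  (hf : IsOrientedHypersurface f N)
include h

theorem smul_principalProjection (p₀ : M) (y v : EuclideanSpace ℝ (Fin n)) :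
    (lam ((extChartAt (𝓡 n) p₀).symm y) - mu ((extChartAt (𝓡 n) p₀).symm y)) •
      principalProjection f N lam mu p₀ y v
      = shapeCoord f N p₀ y v - mu ((extChartAt (𝓡 n) p₀).symm y) • v := by
  simp only [principalProjection, smul_apply, sub_apply, ContinuousLinearMap.id_apply]
  rw [smul_inv_smul₀ (sub_ne_zero.2 (h.ne _))]

theorem principalProjection_swap (p₀ : M) (y v : EuclideanSpace ℝ (Fin n)) :
    principalProjection f N mu lam p₀ y v = v - principalProjection f N lam mu p₀ y v := by
  have h1 := h.smul_principalProjection p₀ y v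
  have h2 := h.swap.smul_principalProjection p₀ y v
  apply smul_right_injective _ (sub_ne_zero.2 (h.ne ((extChartAt (𝓡 n) p₀).symm y)))
  simp only [smul_sub]
  rw [h1]
  have h3 : (lam ((extChartAt (𝓡 n) p₀).symm y) - mu ((extChartAt (𝓡 n) p₀).symm y)) •
      principalProjection f N mu lam p₀ y v
      = -((mu ((extChartAt (𝓡 n) p₀).symm y) - lam ((extChartAt (𝓡 n) p₀).symm y)) •
        principalProjection f N mu lam p₀ y v) := by module
  rw [h3, h2]
  module

include hf

theorem shapeCoord_shapeCoord (p₀ : M) {y : EuclideanSpace ℝ (Fin n)}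
    (hy : y ∈ (extChartAt (𝓡 n) p₀).target) (v : EuclideanSpace ℝ (Fin n)) :
    shapeCoord f N p₀ y (shapeCoord f N p₀ y v)
      = (lam ((extChartAt (𝓡 n) p₀).symm y) + mu ((extChartAt (𝓡 n) p₀).symm y)) •
          shapeCoord f N p₀ y v
        - (lam ((extChartAt (𝓡 n) p₀).symm y) * mu ((extChartAt (𝓡 n) p₀).symm y)) • v := by
  apply (bijective_chartFrame p₀ hy).1
  rw [hf.chartFrame_shapeCoord p₀ hy, map_sub, map_smul, map_smul,
    hf.chartFrame_shapeCoord p₀ hy]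
  exact (hf.isSymmetric_shapeOperator _).mul_eq_zero_of_two (h.spec _) _

theorem shapeCoord_principalProjection (p₀ : M) {y : EuclideanSpace ℝ (Fin n)}
    (hy : y ∈ (extChartAt (𝓡 n) p₀).target) (v : EuclideanSpace ℝ (Fin n)) :
    shapeCoord f N p₀ y (principalProjection f N lam mu p₀ y v)
      = lam ((extChartAt (𝓡 n) p₀).symm y) • principalProjection f N lam mu p₀ y v := by
  apply smul_right_injective _ (sub_ne_zero.2 (h.ne ((extChartAt (𝓡 n) p₀).symm y)))
  simp only
  rw [← map_smul, smul_comm, h.smul_principalProjection, map_sub, map_smul,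
    h.shapeCoord_shapeCoord hf p₀ hy]
  module

theorem chartFrame_mem_eigenspace (p₀ : M) {y : EuclideanSpace ℝ (Fin n)}
    (hy : y ∈ (extChartAt (𝓡 n) p₀).target) (v : EuclideanSpace ℝ (Fin n)) :
    chartFrame p₀ y (principalProjection f N lam mu p₀ y v)
      ∈ Module.End.eigenspace (shapeOperator f N ((extChartAt (𝓡 n) p₀).symm y))
        (lam ((extChartAt (𝓡 n) p₀).symm y)) := by
  rw [Module.End.mem_eigenspace_iff, ← hf.chartFrame_shapeCoord p₀ hy,
    h.shapeCoord_principalProjection hf p₀ hy, map_smul]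

theorem principalProjection_of_mem_eigenspace (p₀ : M) {y : EuclideanSpace ℝ (Fin n)}
    (hy : y ∈ (extChartAt (𝓡 n) p₀).target) {v : EuclideanSpace ℝ (Fin n)}
    (hv : chartFrame p₀ y v
      ∈ Module.End.eigenspace (shapeOperator f N ((extChartAt (𝓡 n) p₀).symm y))
        (lam ((extChartAt (𝓡 n) p₀).symm y))) :
    principalProjection f N lam mu p₀ y v = v := by
  rw [Module.End.mem_eigenspace_iff, ← hf.chartFrame_shapeCoord p₀ hy, ← map_smul] at hv
  have hv' := (bijective_chartFrame p₀ hy).1 hv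
  apply smul_right_injective _ (sub_ne_zero.2 (h.ne ((extChartAt (𝓡 n) p₀).symm y)))
  simp only
  rw [h.smul_principalProjection, hv']
  module

theorem finrank_range_principalProjection (p₀ : M) {y : EuclideanSpace ℝ (Fin n)}
    (hy : y ∈ (extChartAt (𝓡 n) p₀).target) :
    Module.finrank ℝ (LinearMap.range (principalProjection f N lam mu p₀ y).toLinearMap) = k := by
  rw [← h.rank_lam ((extChartAt (𝓡 n) p₀).symm y), principalMultiplicity]
  have hmap : (LinearMap.range (principalProjection f N lam mu p₀ y).toLinearMap).map
      (chartFrame p₀ y) = Module.End.eigenspace (shapeOperator f N ((extChartAt (𝓡 n) p₀).symm y))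
        (lam ((extChartAt (𝓡 n) p₀).symm y)) := by
    ext w
    constructor
    · rintro ⟨_, ⟨v, rfl⟩, rfl⟩
      exact h.chartFrame_mem_eigenspace hf p₀ hy v
    · intro hw
      obtain ⟨v, rfl⟩ := (bijective_chartFrame p₀ hy).2 w
      exact ⟨v, ⟨v, h.principalProjection_of_mem_eigenspace hf p₀ hy hw⟩, rfl⟩
  rw [← hmap]
  exact (LinearEquiv.finrank_eq (Submodule.equivMapOfInjective _
    (bijective_chartFrame p₀ hy).1 _))

theorem principalPatch (p₀ : M) :
    PrincipalPatch (extChartAt (𝓡 n) p₀).target (ambientMap f ∘ (extChartAt (𝓡 n) p₀).symm)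
      (N ∘ (extChartAt (𝓡 n) p₀).symm) (principalProjection f N lam mu p₀)
      (lam ∘ (extChartAt (𝓡 n) p₀).symm) (mu ∘ (extChartAt (𝓡 n) p₀).symm) where
  isOpen := isOpen_target p₀
  smooth_f := hf.smooth_ambient_chart p₀
  smooth_N := hf.smooth_normal_chart p₀
  smooth_P := by
    have s1 := h.smooth_lam.contDiffOn_chart p₀
    have s2 := h.smooth_mu.contDiffOn_chart p₀
    exact ((s1.sub s2).inv fun y _ ↦ sub_ne_zero.2 (h.ne _)).smul
      ((hf.smooth_shapeCoord p₀).sub (s2.smul contDiffOn_const))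
  smooth_lam := h.smooth_lam.contDiffOn_chart p₀
  smooth_mu := h.smooth_mu.contDiffOn_chart p₀
  inner_ff _ _ := hf.inner_ambient_self _
  inner_NN _ _ := hf.inner_normal_self _
  inner_fN _ _ := hf.inner_ambient_normal _
  inner_df_N y hy v := by
    rw [hf.fderiv_ambient p₀ hy]; exact hf.inner_differential_normal _ _
  injective y hy v := hf.injective_fderiv_ambient p₀ hy v
  proj y hy v :=
    h.principalProjection_of_mem_eigenspace hf p₀ hy (h.chartFrame_mem_eigenspace hf p₀ hy v)
  orth y hy v w := by
    rw [hf.fderiv_ambient p₀ hy, hf.fderiv_ambient p₀ hy, hf.isometric,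
      ← h.principalProjection_swap]
    have h1 := h.chartFrame_mem_eigenspace hf p₀ hy v
    have h2 := h.swap.chartFrame_mem_eigenspace hf p₀ hy w
    rw [Module.End.mem_eigenspace_iff] at h1 h2
    have h3 := hf.isSymmetric_shapeOperator ((extChartAt (𝓡 n) p₀).symm y)
      (chartFrame p₀ y (principalProjection f N lam mu p₀ y v))
      (chartFrame p₀ y (principalProjection f N mu lam p₀ y w))
    rw [h1, h2, inner_smul_left, inner_smul_right] at h3
    have h4 := sub_ne_zero.2 (h.ne ((extChartAt (𝓡 n) p₀).symm y))
    refine (mul_eq_zero.1 (?_ : (lam ((extChartAt (𝓡 n) p₀).symm y)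
      - mu ((extChartAt (𝓡 n) p₀).symm y)) * _ = 0)).resolve_left h4
    rw [sub_mul, sub_eq_zero]
    exact h3
  shape y hy v := by
    have h1 : lam ((extChartAt (𝓡 n) p₀).symm y) • principalProjection f N lam mu p₀ y v
        + mu ((extChartAt (𝓡 n) p₀).symm y) • (v - principalProjection f N lam mu p₀ y v)
        = shapeCoord f N p₀ y v := by
      have := h.smul_principalProjection p₀ y v
      rw [sub_smul, sub_eq_sub_iff_add_eq_add] at this
      rw [smul_sub, ← add_sub_assoc, this]
      abel
    rw [hf.fderiv_normal p₀ hy, hf.dnormal_eq, ← hf.chartFrame_shapeCoord p₀ hy,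
      ← hf.fderiv_ambient p₀ hy, ← h1, map_add, map_smul, map_smul]
    rfl
  ne y _ := h.ne _
  complete y hy w h1 h2 h3 := by
    refine hf.eq_zero_of_orthogonal _ h1 h2 fun u ↦ ?_
    obtain ⟨v, rfl⟩ := (bijective_chartFrame p₀ hy).2 u
    rw [← hf.fderiv_ambient p₀ hy]
    exact h3 v

theorem fderiv_lam_proj (hk : 2 ≤ k) (p₀ : M) {y : EuclideanSpace ℝ (Fin n)}
    (hy : y ∈ (extChartAt (𝓡 n) p₀).target) (v : EuclideanSpace ℝ (Fin n)) :
    fderiv ℝ (lam ∘ (extChartAt (𝓡 n) p₀).symm) y (principalProjection f N lam mu p₀ y v) = 0 :=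
  (h.principalPatch hf p₀).fderiv_lam_proj hy
    (by rw [h.finrank_range_principalProjection hf p₀ hy]; omega) v

theorem fderiv_mu_proj_compl (hl : 2 ≤ l) (p₀ : M) {y : EuclideanSpace ℝ (Fin n)}
    (hy : y ∈ (extChartAt (𝓡 n) p₀).target) (v : EuclideanSpace ℝ (Fin n)) :
    fderiv ℝ (mu ∘ (extChartAt (𝓡 n) p₀).symm) y (v - principalProjection f N lam mu p₀ y v)
      = 0 := by
  rw [← h.principalProjection_swap]
  exact h.swap.fderiv_lam_proj hf hl p₀ hy v

theorem esymm_eq {m : ℕ} (hmn : m ≤ n) {c : ℝ}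
    (hH : ∀ p : M, meanCurvature m f N p = c) (p : M) :
    (Multiset.replicate k (lam p) + Multiset.replicate l (mu p)).esymm m
      = c * (n.choose m : ℝ) := by
  have h1 := hH p
  rw [meanCurvature, (hf.isSymmetric_shapeOperator p).roots_charpoly_of_two (h.spec p) (h.ne p),
    div_eq_iff (by exact_mod_cast (Nat.choose_pos hmn).ne')] at h1
  rw [← h1]
  have e1 : Module.finrank ℝ ((shapeOperator f N p).eigenspace (lam p)) = k := h.rank_lam p
  have e2 : Module.finrank ℝ ((shapeOperator f N p).eigenspace (mu p)) = l := h.rank_mu p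
  rw [e1, e2]

/-- On λ-directions H_m leaves μ finitely many values since λ ≠ 0 is fixed there; on μ-directions μ
is constant by its multiplicity. The two kinds of directions span. -/
theorem fderiv_mu_eq_zero {m : ℕ} (hm : 1 ≤ m) (hmn : m ≤ n) (hk : 2 ≤ k) (hl : 2 ≤ l)
    (hkl : k + l = n) {c : ℝ} (hH : ∀ p : M, meanCurvature m f N p = c) (p₀ : M)
    {y : EuclideanSpace ℝ (Fin n)} (hy : y ∈ (extChartAt (𝓡 n) p₀).target)
    (h0 : lam ((extChartAt (𝓡 n) p₀).symm y) ≠ 0) :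
    fderiv ℝ (mu ∘ (extChartAt (𝓡 n) p₀).symm) y = 0 := by
  ext v
  have h1 := (h.principalPatch hf p₀).fderiv_mu_proj_of_finite
    (F := fun a b ↦ (Multiset.replicate k a + Multiset.replicate l b).esymm m)
    (c := c * (n.choose m : ℝ)) (fun z hz ↦ h.fderiv_lam_proj hf hk p₀ hz)
    (fun z hz ↦ h.esymm_eq hf hmn hH _) hy
    (finite_setOf_esymm_eq hm (by omega) (by omega) h0 _) v
  have h2 := h.fderiv_mu_proj_compl hf hl p₀ hy v
  rw [map_sub, h1, sub_zero] at h2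
  simpa using h2

theorem eventually_mu_eq {m : ℕ} (hm : 1 ≤ m) (hmn : m ≤ n) (hk : 2 ≤ k) (hl : 2 ≤ l)
    (hkl : k + l = n) {c : ℝ} (hH : ∀ p : M, meanCurvature m f N p = c) {p : M}
    (h0 : lam p ≠ 0) : ∀ᶠ q in nhds p, mu q = mu p := by
  have s1 := (h.smooth_lam.contDiffOn_chart p).continuousOn
  have s2 := h.smooth_mu.contDiffOn_chart p
  have hU := s1.isOpen_inter_preimage (isOpen_target p) (isOpen_ne (x := (0 : ℝ)))
  refine eventually_eq_of_fderiv_chart_eq_zero p hU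
    ⟨mem_extChartAt_target p, ?_⟩ (fun y hy ↦ ?_) (fun y hy ↦ ?_)
  · simp only [Set.mem_preimage, Function.comp_apply, extChartAt_to_inv]
    exact h0
  · exact (s2.differentiableAt_of_isOpen (isOpen_target p) hy.1).differentiableWithinAt
  · exact h.fderiv_mu_eq_zero hf hm hmn hk hl hkl hH p hy.1 hy.2

/-- Either both principal curvatures are constant or one of them vanishes identically. -/
theorem constant_or_zero [ConnectedSpace M] {m : ℕ} (hm : 1 ≤ m) (hmn : m ≤ n) (hk : 2 ≤ k)
    (hl : 2 ≤ l) (hkl : k + l = n) {c : ℝ} (hH : ∀ p : M, meanCurvature m f N p = c) :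
    (∃ a b : ℝ, (∀ p, lam p = a) ∧ ∀ p, mu p = b) ∨ (∀ p, lam p = 0) ∨ ∀ p, mu p = 0 := by
  have cl := h.smooth_lam.continuous
  have cm := h.smooth_mu.continuous
  by_cases hex : ∃ p₁, lam p₁ ≠ 0 ∧ mu p₁ ≠ 0
  · obtain ⟨p₁, h1, h2⟩ := hex
    left
    refine ⟨lam p₁, mu p₁, ?_⟩
    set S : Set M := {q | lam q = lam p₁ ∧ mu q = mu p₁} with hS
    have hclosed : IsClosed S :=
      (isClosed_eq cl continuous_const).inter (isClosed_eq cm continuous_const)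
    have hopen : IsOpen S := by
      rw [isOpen_iff_mem_nhds]
      rintro q ⟨hq1, hq2⟩
      filter_upwards [h.eventually_mu_eq hf hm hmn hk hl hkl hH (p := q) (by rwa [hq1]),
        h.swap.eventually_mu_eq hf hm hmn hl hk (by omega) hH (p := q) (by rwa [hq2])]
        with x hx1 hx2
      exact ⟨hx2.trans hq1, hx1.trans hq2⟩
    have huniv : S = Set.univ := IsClopen.eq_univ ⟨hclosed, hopen⟩ ⟨p₁, rfl, rfl⟩
    exact ⟨fun p ↦ (huniv ▸ Set.mem_univ p : p ∈ S).1, fun p ↦ (huniv ▸ Set.mem_univ p : p ∈ S).2⟩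
  · right
    push Not at hex
    set S : Set M := {q | lam q = 0} with hS
    have hclosed : IsClosed S := isClosed_eq cl continuous_const
    -- If λμ = 0 everywhere, then, as λ ≠ μ, exactly one of them vanishes at each point, so the
    -- closed set {λ = 0} is also the open set {μ ≠ 0}.
    have hSc : S = {q | mu q ≠ 0} := by
      ext q
      constructor
      · intro hq h0
        exact h.ne q ((show lam q = 0 from hq).trans h0.symm)
      · intro hq
        by_contra h0
        exact hq (hex q h0)
    have hopen : IsOpen S := by
      rw [hSc]
      exact isOpen_ne.preimage cm
    rcases isClopen_iff.1 ⟨hclosed, hopen⟩ with h0 | h0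
    · right
      intro p
      by_contra hp
      have : p ∈ S := by rw [hSc]; exact hp
      rw [h0] at this
      exact this
    · left
      intro p
      exact (h0 ▸ Set.mem_univ p : p ∈ S)

end HasTwoCurvatures

end TwoCurvatures

/-! ### Almost-minima on complete metric spaces -/

section Ekeland

/-- Ekeland's variational principle. -/
theorem exists_forall_le_add_mul_dist {X : Type*} [MetricSpace X] [CompleteSpace X] {φ : X → ℝ}
    (hφ : Continuous φ) {m : ℝ} (hm : ∀ x, m ≤ φ x) (x₀ : X) {ε : ℝ} (hε : 0 < ε) :
    ∃ p, φ p ≤ φ x₀ ∧ ∀ x, φ p ≤ φ x + ε * dist p x := by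
  set S : X → Set X := fun x ↦ {y | φ y + ε * dist x y ≤ φ x} with hS
  have hself : ∀ x, x ∈ S x := fun x ↦ by simp [hS]
  have htrans : ∀ {x y z}, y ∈ S x → z ∈ S y → z ∈ S x := by
    intro x y z hy hz
    simp only [hS, Set.mem_ofPred] at *
    nlinarith [dist_triangle x y z]
  have hclosed : ∀ x, IsClosed (S x) := fun x ↦
    isClosed_le (hφ.add (continuous_const.mul (continuous_const.dist continuous_id)))
      continuous_const
  have hbdd : ∀ x, BddBelow (φ '' S x) := fun x ↦ ⟨m, by rintro _ ⟨y, -, rfl⟩; exact hm y⟩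
  -- Each next point nearly minimizes φ on the current set S. The values of φ decrease to a limit
  -- and control the distances, so the sequence converges; its limit lies in all the sets and cannot
  -- be improved.
  have hstep : ∀ (j : ℕ) (x : X), ∃ y ∈ S x, φ y < sInf (φ '' S x) + (1 / 2) ^ j := by
    intro j x
    obtain ⟨_, ⟨y, hy, rfl⟩, hlt⟩ := exists_lt_of_csInf_lt (⟨φ x, x, hself x, rfl⟩ : (φ '' S x).Nonempty)
      (lt_add_of_pos_right (sInf (φ '' S x)) (by positivity : (0 : ℝ) < (1 / 2) ^ j))
    exact ⟨y, hy, hlt⟩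
  choose g hgS hglt using hstep
  let s : ℕ → X := fun j ↦ Nat.rec x₀ (fun j x ↦ g j x) j
  have hs : ∀ j, s (j + 1) = g j (s j) := fun j ↦ rfl
  have hmem : ∀ i j, i ≤ j → s j ∈ S (s i) := by
    intro i j hij
    induction j, hij using Nat.le_induction with
    | base => exact hself _
    | succ j _ ih => exact htrans ih (hs j ▸ hgS j (s j))
  have hanti : Antitone (φ ∘ s) := by
    refine antitone_nat_of_succ_le fun j ↦ ?_
    have h1 : φ (s (j + 1)) + ε * dist (s j) (s (j + 1)) ≤ φ (s j) := hmem j (j + 1) j.le_succ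
    have h2 : 0 ≤ ε * dist (s j) (s (j + 1)) := by positivity
    simp only [Function.comp_apply]
    linarith
  have hlim := tendsto_atTop_ciInf hanti ⟨m, by rintro _ ⟨j, rfl⟩; exact hm _⟩
  have hcauchy : CauchySeq s := by
    rw [Metric.cauchySeq_iff']
    intro δ hδ
    obtain ⟨K, hK⟩ := (Metric.cauchySeq_iff'.1 hlim.cauchySeq) (ε * δ) (by positivity)
    refine ⟨K, fun j hj ↦ ?_⟩
    have h1 : φ (s j) + ε * dist (s K) (s j) ≤ φ (s K) := hmem K j hj
    have h2 := hK j hj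
    rw [Real.dist_eq, abs_lt] at h2
    simp only [Function.comp_apply] at h2
    rw [dist_comm]
    exact lt_of_mul_lt_mul_left (by linarith [h2.1]) hε.le
  obtain ⟨p, hp⟩ := cauchySeq_tendsto_of_complete hcauchy
  have hpS : ∀ i, p ∈ S (s i) := fun i ↦
    (hclosed (s i)).mem_of_tendsto hp (Filter.eventually_atTop.2 ⟨i, fun j hj ↦ hmem i j hj⟩)
  refine ⟨p, ?_, fun x ↦ ?_⟩
  · have h1 : φ p + ε * dist (s 0) p ≤ φ x₀ := hpS 0
    have h2 : 0 ≤ ε * dist (s 0) p := by positivity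
    linarith
  · by_contra! hx
    have hxS : x ∈ S p := hx.le
    have h1 : ∀ j : ℕ, φ p ≤ φ x + (1 / 2) ^ j := by
      intro j
      have h2 : sInf (φ '' S (s j)) ≤ φ x := csInf_le (hbdd _) ⟨x, htrans (hpS j) hxS, rfl⟩
      have h3 := hglt j (s j)
      have h4 : φ p + ε * dist (s (j + 1)) p ≤ φ (s (j + 1)) := hpS (j + 1)
      rw [hs] at h4
      have h5 : 0 ≤ ε * dist (g j (s j)) p := by positivity
      linarith
    have h2 : φ p ≤ φ x := by
      have h3 : Filter.Tendsto (fun j : ℕ ↦ φ x + (1 / 2 : ℝ) ^ j) Filter.atTop (nhds (φ x + 0)) :=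
        tendsto_const_nhds.add (tendsto_pow_atTop_nhds_zero_of_lt_one (by norm_num) (by norm_num))
      rw [add_zero] at h3
      exact ge_of_tendsto' h3 h1
    have h3 : 0 ≤ ε * dist p x := by positivity
    linarith

end Ekeland

/-! ### Riemannian distance and ambient speed -/

section Distance

variable {n : ℕ} {M : Type*} [MetricSpace M] [ChartedSpace (EuclideanSpace ℝ (Fin n)) M]
  [IsManifold (𝓡 n) ∞ M]
  [Bundle.RiemannianBundle (fun p : M ↦ TangentSpace (𝓡 n) p)]
  [IsContMDiffRiemannianBundle (𝓡 n) ∞ (EuclideanSpace ℝ (Fin n))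
      (fun p : M ↦ TangentSpace (𝓡 n) p)]
  [IsRiemannianManifold (𝓡 n) M]

/-- The distance of the end points of a curve is bounded in terms of the speed of its image under
an isometric immersion. -/
theorem IsOrientedHypersurface.dist_le_mul {f : M → USphere (n + 1)}
    {N : M → EuclideanSpace ℝ (Fin (n + 1 + 1))} (hf : IsOrientedHypersurface f N)
    {γ : ℝ → M} {a b L : ℝ} (hab : a ≤ b) (hL : 0 ≤ L)
    (hγ : ContMDiffOn 𝓘(ℝ, ℝ) (𝓡 n) 1 γ (Set.Icc a b))
    (hd : ∀ t ∈ Set.Ioo a b, ‖deriv (ambientMap f ∘ γ) t‖ ≤ L) :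
    dist (γ a) (γ b) ≤ L * (b - a) := by
  have h1 : edist (γ a) (γ b) ≤ Manifold.pathELength (𝓡 n) γ a b := by
    rw [IsRiemannianManifold.out (I := 𝓡 n) (γ a) (γ b)]
    exact Manifold.riemannianEDist_le_pathELength hγ rfl rfl hab
  have h2 : Manifold.pathELength (𝓡 n) γ a b ≤ ENNReal.ofReal (L * (b - a)) := by
    rw [Manifold.pathELength_eq_lintegral_mfderiv_Ioo]
    calc _ ≤ ∫⁻ t in Set.Ioo a b, ENNReal.ofReal L := by
          refine MeasureTheory.setLIntegral_mono measurable_const fun t ht ↦ ?_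
          have hγt : MDifferentiableAt 𝓘(ℝ, ℝ) (𝓡 n) γ t :=
            (hγ.contMDiffAt (Icc_mem_nhds ht.1 ht.2)).mdifferentiableAt one_ne_zero
          have e1 := mfderiv_comp_apply t (hf.mdiff_ambient (γ t)) hγt (1 : ℝ)
          rw [mfderiv_eq_fderiv] at e1
          have e2 : deriv (ambientMap f ∘ γ) t
              = sphereDifferential f (γ t) (mfderiv 𝓘(ℝ, ℝ) (𝓡 n) γ t (1 : ℝ)) := by
            rw [← fderiv_apply_one_eq_deriv]; exact e1
          have e3 : ‖mfderiv 𝓘(ℝ, ℝ) (𝓡 n) γ t (1 : ℝ)‖ = ‖deriv (ambientMap f ∘ γ) t‖ := by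
            rw [e2, @norm_eq_sqrt_real_inner (EuclideanSpace ℝ (Fin (n + 1 + 1))), hf.isometric,
              ← norm_eq_sqrt_real_inner]
          rw [← ofReal_norm]
          exact ENNReal.ofReal_le_ofReal (e3.le.trans (hd t ht))
      _ = ENNReal.ofReal (L * (b - a)) := by
          rw [MeasureTheory.setLIntegral_const, Real.volume_Ioo, ENNReal.ofReal_mul hL]
  rw [edist_dist] at h1
  exact (ENNReal.ofReal_le_ofReal_iff (mul_nonneg hL (sub_nonneg.2 hab))).1 (h1.trans h2)

end Distance

/-! ### Gradients for a pulled-back inner product -/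

section PseudoInverse

variable {E H : Type*} [NormedAddCommGroup E] [InnerProductSpace ℝ E] [FiniteDimensional ℝ E]
  [NormedAddCommGroup H] [InnerProductSpace ℝ H] [FiniteDimensional ℝ H]

theorem inner_apply_pseudoInverse {L : E →L[ℝ] H} (hL : ∀ v, L v = 0 → v = 0) (w : H) (v : E) :
    inner ℝ (L (pseudoInverse L w)) (L v) = inner ℝ w (L v) := by
  obtain ⟨e, he⟩ := exists_equiv_adjoint_comp hL
  have h1 : (L.adjoint ∘L L) (pseudoInverse L w) = L.adjoint w := by
    rw [pseudoInverse, ← he, ContinuousLinearMap.inverse_equiv]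
    simp
  rw [← ContinuousLinearMap.adjoint_inner_left, ← ContinuousLinearMap.adjoint_inner_left, ← h1]
  rfl

/-- The vector representing the linear form `a` for the inner product pulled back by `L`. -/
noncomputable def pullbackGradient (L : E →L[ℝ] H) (a : E →L[ℝ] ℝ) : E :=
  pseudoInverse L ((pseudoInverse L).adjoint ((InnerProductSpace.toDual ℝ E).symm a))

theorem inner_pullbackGradient {L : E →L[ℝ] H} (hL : ∀ v, L v = 0 → v = 0) (a : E →L[ℝ] ℝ)
    (v : E) : inner ℝ (L (pullbackGradient L a)) (L v) = a v := by
  rw [pullbackGradient, inner_apply_pseudoInverse hL, ContinuousLinearMap.adjoint_inner_left,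
    pseudoInverse_apply_self hL, InnerProductSpace.toDual_symm_apply]

theorem ContDiffOn.pullbackGradient {F : Type*} [NormedAddCommGroup F] [NormedSpace ℝ F]
    {U : Set F} {L : F → E →L[ℝ] H} {a : F → E →L[ℝ] ℝ} (hL : ContDiffOn ℝ ∞ L U)
    (hinj : ∀ x ∈ U, ∀ v, L x v = 0 → v = 0) (ha : ContDiffOn ℝ ∞ a U) :
    ContDiffOn ℝ ∞ (fun x ↦ pullbackGradient (L x) (a x)) U := by
  have h1 := hL.pseudoInverse hinj
  have h2 : ContDiffOn ℝ ∞ (fun x ↦ (_root_.pseudoInverse (L x)).adjoint) U :=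
    (ContinuousLinearMap.adjoint (𝕜 := ℝ) (E := H) (F := E)).toContinuousLinearEquiv.contDiff
      |>.comp_contDiffOn h1
  have h3 : ContDiffOn ℝ ∞ (fun x ↦ (InnerProductSpace.toDual ℝ E).symm (a x)) U :=
    (InnerProductSpace.toDual ℝ E).symm.toContinuousLinearEquiv.contDiff.comp_contDiffOn ha
  exact h1.clm_apply (h2.clm_apply h3)

end PseudoInverse

/-! ### The Riemannian gradient in charts -/

section Gradient

variable {n : ℕ} {M : Type*} [TopologicalSpace M] [ChartedSpace (EuclideanSpace ℝ (Fin n)) M]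
  [IsManifold (𝓡 n) ∞ M]
  [Bundle.RiemannianBundle (fun p : M ↦ TangentSpace (𝓡 n) p)]

/-- The Riemannian gradient. -/
noncomputable def riemannianGradient (g : M → ℝ) (p : M) : TangentSpace (𝓡 n) p :=
  (InnerProductSpace.toDual ℝ (TangentSpace (𝓡 n) p)).symm
    (LinearMap.toContinuousLinearMap (mvfderiv (𝓡 n) g p).toLinearMap)

theorem inner_riemannianGradient (g : M → ℝ) (p : M) (v : TangentSpace (𝓡 n) p) :
    inner ℝ (riemannianGradient (n := n) g p) v = mvfderiv (𝓡 n) g p v := by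
  rw [riemannianGradient, InnerProductSpace.toDual_symm_apply]
  rfl

variable {f : M → USphere (n + 1)} {N : M → EuclideanSpace ℝ (Fin (n + 1 + 1))}
  (hf : IsOrientedHypersurface f N)
include hf

/-- The gradient of `g` in the chart at `p₀`. -/
theorem IsOrientedHypersurface.exists_gradient_chart {g : M → ℝ}
    (hg : ContMDiff (𝓡 n) 𝓘(ℝ, ℝ) ∞ g) (p₀ : M) :
    ∃ z : EuclideanSpace ℝ (Fin n) → EuclideanSpace ℝ (Fin n),
      ContDiffOn ℝ ∞ z (extChartAt (𝓡 n) p₀).target ∧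
      (∀ y ∈ (extChartAt (𝓡 n) p₀).target, ∀ v,
        inner ℝ (fderiv ℝ (ambientMap f ∘ (extChartAt (𝓡 n) p₀).symm) y (z y))
          (fderiv ℝ (ambientMap f ∘ (extChartAt (𝓡 n) p₀).symm) y v)
          = fderiv ℝ (g ∘ (extChartAt (𝓡 n) p₀).symm) y v) ∧
      ∀ y ∈ (extChartAt (𝓡 n) p₀).target,
        inner ℝ (fderiv ℝ (ambientMap f ∘ (extChartAt (𝓡 n) p₀).symm) y (z y))
          (fderiv ℝ (ambientMap f ∘ (extChartAt (𝓡 n) p₀).symm) y (z y))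
          = inner ℝ (riemannianGradient (n := n) g ((extChartAt (𝓡 n) p₀).symm y))
              (riemannianGradient (n := n) g ((extChartAt (𝓡 n) p₀).symm y)) := by
  have hz : ∀ y ∈ (extChartAt (𝓡 n) p₀).target, ∀ v,
      inner ℝ (fderiv ℝ (ambientMap f ∘ (extChartAt (𝓡 n) p₀).symm) y
        (pullbackGradient (fderiv ℝ (ambientMap f ∘ (extChartAt (𝓡 n) p₀).symm) y)
          (fderiv ℝ (g ∘ (extChartAt (𝓡 n) p₀).symm) y)))
        (fderiv ℝ (ambientMap f ∘ (extChartAt (𝓡 n) p₀).symm) y v)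
        = fderiv ℝ (g ∘ (extChartAt (𝓡 n) p₀).symm) y v := fun y hy v ↦
    inner_pullbackGradient (hf.injective_fderiv_ambient p₀ hy) _ v
  refine ⟨fun y ↦ pullbackGradient (fderiv ℝ (ambientMap f ∘ (extChartAt (𝓡 n) p₀).symm) y)
    (fderiv ℝ (g ∘ (extChartAt (𝓡 n) p₀).symm) y),
    ((hf.smooth_ambient_chart p₀).fderiv_smooth (isOpen_target p₀)).pullbackGradient
      (fun y hy ↦ hf.injective_fderiv_ambient p₀ hy)
      ((hg.contDiffOn_chart p₀).fderiv_smooth (isOpen_target p₀)), hz, fun y hy ↦ ?_⟩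
  set w := pullbackGradient (fderiv ℝ (ambientMap f ∘ (extChartAt (𝓡 n) p₀).symm) y)
    (fderiv ℝ (g ∘ (extChartAt (𝓡 n) p₀).symm) y) with hw
  have hgrad : chartFrame p₀ y w = riemannianGradient (n := n) g ((extChartAt (𝓡 n) p₀).symm y) := by
    refine ext_inner_right ℝ fun u ↦ ?_
    obtain ⟨v, rfl⟩ := (bijective_chartFrame p₀ hy).2 u
    rw [inner_riemannianGradient, ← hf.isometric, ← hf.fderiv_ambient p₀ hy,
      ← hf.fderiv_ambient p₀ hy, hz y hy,
      fderiv_comp_chart p₀ hy (hg.mdifferentiableAt (by simp))]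
  rw [← hgrad, hf.fderiv_ambient p₀ hy, hf.isometric]

theorem IsOrientedHypersurface.contMDiff_inner_gradient {g : M → ℝ}
    (hg : ContMDiff (𝓡 n) 𝓘(ℝ, ℝ) ∞ g) :
    ContMDiff (𝓡 n) 𝓘(ℝ, ℝ) ∞
      (fun p ↦ (inner ℝ (riemannianGradient (n := n) g p) (riemannianGradient (n := n) g p) : ℝ)) := by
  refine contMDiff_of_contDiffOn_chart fun p₀ ↦ ?_
  obtain ⟨z, sz, -, hz⟩ := hf.exists_gradient_chart hg p₀
  have s1 := ((hf.smooth_ambient_chart p₀).fderiv_smooth (isOpen_target p₀)).clm_apply sz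
  exact (s1.inner ℝ s1).congr fun y hy ↦ (hz y hy).symm

end Gradient

/-! ### Completeness excludes a vanishing principal curvature -/

section NullCurvature

variable {n : ℕ} {M : Type*}

theorem HasTwoCurvatures.exists_proj_ne_zero [TopologicalSpace M]
    [ChartedSpace (EuclideanSpace ℝ (Fin n)) M] [IsManifold (𝓡 n) ∞ M]
    [Bundle.RiemannianBundle (fun p : M ↦ TangentSpace (𝓡 n) p)]
    {f : M → USphere (n + 1)} {N : M → EuclideanSpace ℝ (Fin (n + 1 + 1))}
    {lam mu : M → ℝ} {k l : ℕ} (h : HasTwoCurvatures f N lam mu k l)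
    (hf : IsOrientedHypersurface f N) (hk : 2 ≤ k) (p₀ : M) {y : EuclideanSpace ℝ (Fin n)}
    (hy : y ∈ (extChartAt (𝓡 n) p₀).target) :
    ∃ v, principalProjection f N lam mu p₀ y v ≠ 0 := by
  by_contra! h0
  have h1 := h.finrank_range_principalProjection hf p₀ hy
  have h2 : LinearMap.range (principalProjection f N lam mu p₀ y).toLinearMap = ⊥ := by
    rw [LinearMap.range_eq_bot]
    ext1 v
    exact h0 v
  rw [h2, finrank_bot] at h1
  omega

theorem HasTwoCurvatures.exists_compl_ne_zero [TopologicalSpace M]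
    [ChartedSpace (EuclideanSpace ℝ (Fin n)) M] [IsManifold (𝓡 n) ∞ M]
    [Bundle.RiemannianBundle (fun p : M ↦ TangentSpace (𝓡 n) p)]
    {f : M → USphere (n + 1)} {N : M → EuclideanSpace ℝ (Fin (n + 1 + 1))}
    {lam mu : M → ℝ} {k l : ℕ} (h : HasTwoCurvatures f N lam mu k l)
    (hf : IsOrientedHypersurface f N) (hl : 2 ≤ l) (p₀ : M) {y : EuclideanSpace ℝ (Fin n)}
    (hy : y ∈ (extChartAt (𝓡 n) p₀).target) :
    ∃ v, v - principalProjection f N lam mu p₀ y v ≠ 0 := by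
  obtain ⟨v, hv⟩ := h.swap.exists_proj_ne_zero hf hl p₀ hy
  exact ⟨v, by rwa [← h.principalProjection_swap]⟩

/-- If both curvatures are constant, then `lam mu = -1`. -/
theorem HasTwoCurvatures.one_add_mul_eq_zero [TopologicalSpace M]
    [ChartedSpace (EuclideanSpace ℝ (Fin n)) M] [IsManifold (𝓡 n) ∞ M]
    [Bundle.RiemannianBundle (fun p : M ↦ TangentSpace (𝓡 n) p)]
    {f : M → USphere (n + 1)} {N : M → EuclideanSpace ℝ (Fin (n + 1 + 1))}
    {lam mu : M → ℝ} {k l : ℕ} (h : HasTwoCurvatures f N lam mu k l)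
    (hf : IsOrientedHypersurface f N) (hk : 2 ≤ k) (hl : 2 ≤ l) (p : M)
    (hlam : ∀ y ∈ (extChartAt (𝓡 n) p).target,
      fderiv ℝ (lam ∘ (extChartAt (𝓡 n) p).symm) y = 0)
    (hmu : ∀ y ∈ (extChartAt (𝓡 n) p).target,
      fderiv ℝ (mu ∘ (extChartAt (𝓡 n) p).symm) y = 0) : 1 + lam p * mu p = 0 := by
  have hy := mem_extChartAt_target (I := 𝓡 n) p
  obtain ⟨v, hv⟩ := h.exists_proj_ne_zero hf hk p hy
  obtain ⟨w, hw⟩ := h.exists_compl_ne_zero hf hl p hy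
  simpa only [Function.comp_apply, extChartAt_to_inv] using
    (h.principalPatch hf p).one_add_mul_eq_zero hlam hmu hy hv hw

/-- On a complete hypersurface with two principal curvatures of multiplicities at least two,
neither of them vanishes identically. -/
theorem HasTwoCurvatures.not_forall_eq_zero [MetricSpace M] [ConnectedSpace M] [CompleteSpace M]
    [ChartedSpace (EuclideanSpace ℝ (Fin n)) M] [IsManifold (𝓡 n) ∞ M]
    [Bundle.RiemannianBundle (fun p : M ↦ TangentSpace (𝓡 n) p)]
    [IsContMDiffRiemannianBundle (𝓡 n) ∞ (EuclideanSpace ℝ (Fin n))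
      (fun p : M ↦ TangentSpace (𝓡 n) p)]
    [IsRiemannianManifold (𝓡 n) M]
    {f : M → USphere (n + 1)} {N : M → EuclideanSpace ℝ (Fin (n + 1 + 1))}
    {lam mu : M → ℝ} {k l : ℕ} (h : HasTwoCurvatures f N lam mu k l)
    (hf : IsOrientedHypersurface f N) (hk : 2 ≤ k) (hl : 2 ≤ l) : ¬ ∀ p, lam p = 0 := by
  intro hlam
  have hmu0 : ∀ p, mu p ≠ 0 := fun p h0 ↦ h.ne p ((hlam p).trans h0.symm)
  set ρ : M → ℝ := fun p ↦ (mu p)⁻¹ with hρ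
  have hρ0 : ∀ p, ρ p ≠ 0 := fun p ↦ inv_ne_zero (hmu0 p)
  have sρ : ContMDiff (𝓡 n) 𝓘(ℝ, ℝ) ∞ ρ := fun p ↦
    ((contDiffAt_inv ℝ (hmu0 p)).contMDiffAt).comp p (h.smooth_mu p)
  set q : M → ℝ := fun p ↦ inner ℝ (riemannianGradient (n := n) ρ p) (riemannianGradient (n := n) ρ p) with hq
  have sq : ContMDiff (𝓡 n) 𝓘(ℝ, ℝ) ∞ q := hf.contMDiff_inner_gradient sρ
  have hq0 : ∀ p, 0 ≤ q p := fun p ↦ real_inner_self_nonneg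
  set c : M → ℝ := fun p ↦ ρ p ^ 2 + q p with hc
  have hc0 : ∀ p, 0 < c p := fun p ↦
    add_pos_of_pos_of_nonneg (by have := hρ0 p; positivity) (hq0 p)
  have sc : ContMDiff (𝓡 n) 𝓘(ℝ, ℝ) ∞ c := (sρ.pow 2).add sq
  -- If ∇ρ = 0 everywhere, both curvatures are constant and 1 + λμ = 0 reads 1 = 0.
  obtain ⟨p₁, hp₁⟩ : ∃ p, q p ≠ 0 := by
    by_contra! hall
    obtain ⟨p⟩ : Nonempty M := inferInstance
    have h1 := h.one_add_mul_eq_zero hf hk hl p (fun y hy ↦ ?_) (fun y hy ↦ ?_)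
    · rw [hlam, zero_mul, add_zero] at h1
      exact one_ne_zero h1
    · have : lam ∘ (extChartAt (𝓡 n) p).symm = fun _ ↦ 0 := funext fun _ ↦ hlam _
      rw [this]; simp
    · have dρ : ∀ v, fderiv ℝ (ρ ∘ (extChartAt (𝓡 n) p).symm) y v = 0 := by
        intro v
        rw [fderiv_comp_chart p hy (sρ.mdifferentiableAt (by simp)), ← inner_riemannianGradient,
          inner_self_eq_zero.1 (hall _), inner_zero_left]
      have e1 : mu ∘ (extChartAt (𝓡 n) p).symm = fun y ↦ ((ρ ∘ (extChartAt (𝓡 n) p).symm) y)⁻¹ :=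
        funext fun _ ↦ by simp [hρ]
      have d1 := ((sρ.contDiffOn_chart p).differentiableAt_of_isOpen (isOpen_target p) hy)
      have h2 := ((hasDerivAt_inv (hρ0 ((extChartAt (𝓡 n) p).symm y))).comp_hasFDerivAt y
        d1.hasFDerivAt).fderiv
      rw [show fderiv ℝ (ρ ∘ (extChartAt (𝓡 n) p).symm) y = 0 from
        ContinuousLinearMap.ext dρ, smul_zero] at h2
      rw [e1]
      exact h2
  -- Heuristically |cos| of the arc parameter along a leaf geodesic: 1 − φ² = q/c, and φ falls along
  -- the gradient line at unit speed with slope √(q/c).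
  set φ : M → ℝ := fun p ↦ |ρ p| / √(c p) with hφ
  have cφ : Continuous φ := (sρ.continuous.abs).div (sc.continuous.sqrt)
    fun p ↦ (Real.sqrt_pos.2 (hc0 p)).ne'
  have hφ0 : ∀ p, 0 ≤ φ p := fun p ↦ by positivity
  have hφq : ∀ p, 1 - φ p ^ 2 = q p / c p := by
    intro p
    simp only [hφ]
    rw [div_pow, sq_abs, Real.sq_sqrt (hc0 p).le, eq_div_iff (hc0 p).ne', sub_mul,
      div_mul_cancel₀ _ (hc0 p).ne']
    simp only [hc]; ring
  set δ : ℝ := √(q p₁ / c p₁) with hδ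
  have hδ0 : 0 < δ := Real.sqrt_pos.2 (div_pos (lt_of_le_of_ne (hq0 _) (Ne.symm hp₁)) (hc0 _))
  -- Since φ(p) ≤ φ(p₁), the slope √(q/c) at p is at least δ, whereas Ekeland's principle allows
  -- descent at rate at most δ/4 per unit distance.
  obtain ⟨p, hpp, hmin⟩ := exists_forall_le_add_mul_dist cφ hφ0 p₁ (ε := δ / 4) (by positivity)
  have hδp : δ ≤ √(q p / c p) := by
    apply Real.sqrt_le_sqrt
    rw [← hφq, ← hφq]
    have := pow_le_pow_left₀ (hφ0 p) hpp 2
    linarith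
  have hqp : 0 < q p := by
    refine lt_of_le_of_ne (hq0 p) fun h0 ↦ ?_
    rw [← h0, zero_div, Real.sqrt_zero] at hδp
    linarith
  obtain ⟨z, sz, hz, hzq⟩ := hf.exists_gradient_chart sρ p
  have hpatch := h.principalPatch hf p
  set e := extChartAt (𝓡 n) p with he
  set x := e p with hx
  have hxt : x ∈ e.target := mem_extChartAt_target (I := 𝓡 n) p
  have hex : e.symm x = p := extChartAt_to_inv (I := 𝓡 n) p
  -- The gradient of ρ lies in the λ-space because μ, hence ρ, is constant along its own principal
  -- directions. So the leaf invariant c is stationary along it.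
  have hPz : principalProjection f N lam mu p x (z x) = z x := by
    have h1 := hz x hxt (z x - principalProjection f N lam mu p x (z x))
    have h2 : fderiv ℝ (ρ ∘ e.symm) x (z x - principalProjection f N lam mu p x (z x)) = 0 := by
      have d1 := hpatch.diff_mu hxt
      have h3 := ((hasDerivAt_inv (hmu0 (e.symm x))).comp_hasFDerivAt x d1.hasFDerivAt).fderiv
      change fderiv ℝ (ρ ∘ e.symm) x = _ at h3
      rw [h3, smul_apply, h.fderiv_mu_proj_compl hf hl p hxt, smul_zero]
    rw [h2] at h1
    have h4 := hpatch.orth x hxt (z x) (z x)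
    have h5 := hpatch.injective x hxt (z x - principalProjection f N lam mu p x (z x)) (by
      rw [← inner_self_eq_zero (𝕜 := ℝ)]
      conv_lhs => enter [2]; rw [map_sub]
      rw [inner_sub_left, h1, h4, sub_zero])
    exact (sub_eq_zero.1 h5).symm
  have dc : fderiv ℝ (c ∘ e.symm) x (z x) = 0 := by
    have h1 := hpatch.fderiv_leaf_invariant (fun y _ ↦ hlam _)
      (fun y hy v ↦ h.fderiv_mu_proj_compl hf hl p hy v)
      (fun y hy ↦ h.exists_compl_ne_zero hf hl p hy) sz hz hxt (z x)
    rw [hPz] at h1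
    rw [← h1]
    have h2 : c ∘ e.symm =ᶠ[nhds x] fun y ↦ ((mu ∘ e.symm) y)⁻¹ ^ 2
        + inner ℝ (fderiv ℝ (ambientMap f ∘ e.symm) y (z y))
          (fderiv ℝ (ambientMap f ∘ e.symm) y (z y)) := by
      filter_upwards [(isOpen_target p).mem_nhds hxt] with y hy
      rw [hzq y hy]
      rfl
    rw [h2.fderiv_eq]
  set L : ℝ := √(q p) with hL
  have hL0 : 0 < L := Real.sqrt_pos.2 hqp
  have hqx : inner ℝ (fderiv ℝ (ambientMap f ∘ e.symm) x (z x))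
      (fderiv ℝ (ambientMap f ∘ e.symm) x (z x)) = q p := by
    rw [hzq x hxt, hex]
  have hnorm : ‖fderiv ℝ (ambientMap f ∘ e.symm) x (z x)‖ = L := by
    rw [norm_eq_sqrt_real_inner, hqx]
  have dρz : fderiv ℝ (ρ ∘ e.symm) x (z x) = q p := by
    rw [← hz x hxt, hqx]
  obtain ⟨s, hs, hs2⟩ : ∃ s : ℝ, |s| = 1 ∧ 0 < s * ρ p := by
    rcases lt_or_gt_of_ne (hρ0 p) with h0 | h0
    · exact ⟨-1, by norm_num, by linarith⟩
    · exact ⟨1, by norm_num, by linarith⟩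
  -- A straight chart segment with initial velocity −s∇ρ, where s is the sign of ρ(p), so that |ρ|
  -- decreases. Its speed is L at time 0 and hence below 2L for short times.
  set g : ℝ → EuclideanSpace ℝ (Fin n) := fun t ↦ x + t • (-s • z x) with hg
  have hg0 : g 0 = x := by simp [hg]
  have dg : ∀ t, HasDerivAt g (-s • z x) t := fun t ↦
    (((hasDerivAt_id t).smul_const (-s • z x)).const_add x).congr_deriv (one_smul ℝ _)
  have cg : Continuous g := by fun_prop
  have hgt : ∀ᶠ t in nhds (0 : ℝ), g t ∈ e.target :=
    cg.continuousAt.eventually (by rw [hg0]; exact (isOpen_target p).mem_nhds hxt)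
  have hspeed : ∀ᶠ t in nhds (0 : ℝ),
      ‖fderiv ℝ (ambientMap f ∘ e.symm) (g t) (-s • z x)‖ < 2 * L := by
    have c1 : ContinuousAt (fun t ↦ fderiv ℝ (ambientMap f ∘ e.symm) (g t)) 0 := by
      refine ContinuousAt.comp (g := fderiv ℝ (ambientMap f ∘ e.symm)) ?_ cg.continuousAt
      rw [hg0]
      exact ((hpatch.smooth_f.fderiv_smooth (isOpen_target p)).continuousOn).continuousAt
        ((isOpen_target p).mem_nhds hxt)
    have c2 : ContinuousAt (fun t ↦ ‖fderiv ℝ (ambientMap f ∘ e.symm) (g t) (-s • z x)‖) 0 :=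
      (c1.clm_apply continuousAt_const).norm
    refine c2.eventually_lt continuousAt_const ?_
    rw [hg0, map_smul, norm_smul, norm_neg, Real.norm_eq_abs, hs, hnorm]
    linarith
  obtain ⟨r, hr, hball⟩ := Metric.eventually_nhds_iff.1 (hgt.and hspeed)
  have hdist : ∀ t ∈ Set.Ioo 0 r, dist p (e.symm (g t)) ≤ 2 * L * t := by
    intro t ht
    have hin : ∀ τ ∈ Set.Icc 0 t, g τ ∈ e.target
        ∧ ‖fderiv ℝ (ambientMap f ∘ e.symm) (g τ) (-s • z x)‖ < 2 * L := fun τ hτ ↦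
      hball (by rw [Real.dist_eq, sub_zero, abs_of_nonneg hτ.1]; exact hτ.2.trans_lt ht.2)
    have h1 := hf.dist_le_mul (γ := e.symm ∘ g) (a := 0) (b := t) (L := 2 * L) ht.1.le
      (by positivity) ?_ ?_
    · simpa [hg0, hex] using h1
    · refine ((contMDiffOn_extChartAt_symm (n := ∞) p).of_le (by simp)).comp
        (ContDiff.contMDiff (by fun_prop)).contMDiffOn fun τ hτ ↦ (hin τ hτ).1
    · intro τ hτ
      have h2 := hin τ ⟨hτ.1.le, hτ.2.le⟩
      have h3 := ((hpatch.diff_f h2.1).hasFDerivAt.comp_hasDerivAt τ (dg τ)).deriv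
      change deriv (ambientMap f ∘ e.symm ∘ g) τ = _ at h3
      rw [h3]
      exact h2.2.le
  have hder : HasDerivAt (fun t ↦ s * ρ (e.symm (g t)) / √(c (e.symm (g t))))
      (-(q p / √(c p))) 0 := by
    have d1 : HasDerivAt (fun t ↦ ρ (e.symm (g t))) (-s * q p) 0 := by
      have d := (sρ.contDiffOn_chart p).differentiableAt_of_isOpen (isOpen_target p) hxt
      rw [← hg0] at d
      have := d.hasFDerivAt.comp_hasDerivAt 0 (dg 0)
      rwa [hg0, map_smul, dρz] at this
    have d2 : HasDerivAt (fun t ↦ c (e.symm (g t))) 0 0 := by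
      have d := (sc.contDiffOn_chart p).differentiableAt_of_isOpen (isOpen_target p) hxt
      rw [← hg0] at d
      have := d.hasFDerivAt.comp_hasDerivAt 0 (dg 0)
      rwa [hg0, map_smul, dc, smul_zero] at this
    have d3 := d2.sqrt (hc0 _).ne'
    have d4 := (d1.const_mul s).div d3 (Real.sqrt_pos.2 (hc0 _)).ne'
    refine d4.congr_deriv ?_
    rw [hg0, hex]
    have := Real.sqrt_pos.2 (hc0 p)
    have hs1 : s * s = 1 := by rw [← abs_mul_abs_self, hs, one_mul]
    rw [show s * (-s * q p) = -q p by linear_combination (-(q p)) * hs1, zero_div, mul_zero,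
      sub_zero]
    field_simp
  have hineq : ∀ᶠ t in nhdsWithin (0 : ℝ) (Set.Ioi 0), -(δ / 4 * (2 * L))
      ≤ t⁻¹ • ((fun t ↦ s * ρ (e.symm (g t)) / √(c (e.symm (g t)))) (0 + t)
        - (fun t ↦ s * ρ (e.symm (g t)) / √(c (e.symm (g t)))) 0) := by
    have hpos : ∀ᶠ t in nhds (0 : ℝ), 0 < s * ρ (e.symm (g t)) := by
      have d := ((sρ.contDiffOn_chart p).continuousOn.continuousAt
        ((isOpen_target p).mem_nhds hxt))
      rw [← hg0] at d
      have c1 := (d.comp cg.continuousAt).const_mul s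
      refine c1.eventually (lt_mem_nhds ?_)
      simp only [Function.comp_apply]
      rw [hg0, hex]
      exact hs2
    filter_upwards [nhdsWithin_le_nhds hpos, Ioo_mem_nhdsGT hr] with t ht htr
    have e1 : ∀ p', 0 < s * ρ p' → s * ρ p' / √(c p') = φ p' := by
      intro p' h0
      simp only [hφ]
      congr 1
      have : |s * ρ p'| = |ρ p'| := by
        rw [abs_mul, hs, one_mul]
      rw [← this, abs_of_pos h0]
    simp only [zero_add]
    rw [e1 _ ht, hg0, hex, e1 _ hs2, smul_eq_mul, ← div_eq_inv_mul, le_div_iff₀ htr.1]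
    have h1 := hmin (e.symm (g t))
    have h2 := hdist t htr
    nlinarith [mul_le_mul_of_nonneg_left h2 (by positivity : 0 ≤ δ / 4)]
  -- The limit of the difference quotients gives L·√(q/c) ≤ (δ/4)·2L = Lδ/2, against √(q/c) ≥ δ.
  have hfinal := ge_of_tendsto hder.tendsto_slope_zero_right hineq
  have hsq : √(q p / c p) = L / √(c p) := Real.sqrt_div (hq0 p) _
  have hqL : q p / √(c p) = L * √(q p / c p) := by
    rw [hsq, ← mul_div_assoc, hL, Real.mul_self_sqrt (hq0 p)]
  rw [hqL] at hfinal
  nlinarith [mul_le_mul_of_nonneg_left hδp hL0.le, mul_pos hL0 hδ0]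

end NullCurvature

/-! ### Constant curvatures: the fixed orthogonal splitting of ℝ^{n+2} -/

section Splitting

variable {n : ℕ} {M : Type*} [TopologicalSpace M] [ChartedSpace (EuclideanSpace ℝ (Fin n)) M]
  [IsManifold (𝓡 n) ∞ M]
  [Bundle.RiemannianBundle (fun p : M ↦ TangentSpace (𝓡 n) p)]

theorem IsOrientedHypersurface.adjoint_differential {f : M → USphere (n + 1)}
    {N : M → EuclideanSpace ℝ (Fin (n + 1 + 1))} (hf : IsOrientedHypersurface f N) (p : M)
    (u : TangentSpace (𝓡 n) p) :
    LinearMap.adjoint (sphereDifferential f p).toLinearMap (sphereDifferential f p u) = u :=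
  ext_inner_right ℝ fun v ↦ by
    rw [LinearMap.adjoint_inner_left]
    exact hf.isometric p u v

theorem IsOrientedHypersurface.chartFrame_pseudoInverse {f : M → USphere (n + 1)}
    {N : M → EuclideanSpace ℝ (Fin (n + 1 + 1))} (hf : IsOrientedHypersurface f N) (p₀ : M)
    {y : EuclideanSpace ℝ (Fin n)} (hy : y ∈ (extChartAt (𝓡 n) p₀).target)
    (w : EuclideanSpace ℝ (Fin (n + 1 + 1))) :
    chartFrame p₀ y (pseudoInverse (fderiv ℝ (ambientMap f ∘ (extChartAt (𝓡 n) p₀).symm) y) w)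
      = LinearMap.adjoint (sphereDifferential f ((extChartAt (𝓡 n) p₀).symm y)).toLinearMap w := by
  refine ext_inner_right ℝ fun u ↦ ?_
  obtain ⟨v, rfl⟩ := (bijective_chartFrame p₀ hy).2 u
  rw [LinearMap.adjoint_inner_left, ← hf.isometric, ← hf.fderiv_ambient p₀ hy,
    ← hf.fderiv_ambient p₀ hy, inner_apply_pseudoInverse (hf.injective_fderiv_ambient p₀ hy),
    hf.fderiv_ambient p₀ hy]
  rfl

/-- The projection of `ℝ^{n+2}` to the space spanned by `N + mu f` and the image of the principal
space of `lam`. -/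
noncomputable def splittingProjection (f : M → USphere (n + 1))
    (N : M → EuclideanSpace ℝ (Fin (n + 1 + 1))) (lam mu : M → ℝ) (p : M) :
    EuclideanSpace ℝ (Fin (n + 1 + 1)) →L[ℝ] EuclideanSpace ℝ (Fin (n + 1 + 1)) :=
  LinearMap.toContinuousLinearMap
    ((sphereDifferential f p).toLinearMap ∘ₗ
      ((lam p - mu p)⁻¹ • (shapeOperator f N p - mu p • LinearMap.id)) ∘ₗ
      LinearMap.adjoint (sphereDifferential f p).toLinearMap)
  + (1 + mu p ^ 2)⁻¹ • (innerSL ℝ (N p + mu p • ambientMap f p)).smulRight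
    (N p + mu p • ambientMap f p)

theorem splittingProjection_apply (f : M → USphere (n + 1))
    (N : M → EuclideanSpace ℝ (Fin (n + 1 + 1))) (lam mu : M → ℝ) (p : M)
    (w : EuclideanSpace ℝ (Fin (n + 1 + 1))) :
    splittingProjection f N lam mu p w = sphereDifferential f p ((lam p - mu p)⁻¹ •
        (shapeOperator f N p (LinearMap.adjoint (sphereDifferential f p).toLinearMap w)
          - mu p • LinearMap.adjoint (sphereDifferential f p).toLinearMap w))
      + (1 + mu p ^ 2)⁻¹ • (inner ℝ (N p + mu p • ambientMap f p) w : ℝ) •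
        (N p + mu p • ambientMap f p) := rfl

namespace HasTwoCurvatures

variable {f : M → USphere (n + 1)} {N : M → EuclideanSpace ℝ (Fin (n + 1 + 1))}
  {lam mu : M → ℝ} {k l : ℕ} (h : HasTwoCurvatures f N lam mu k l)
  (hf : IsOrientedHypersurface f N)

include hf

theorem _root_.IsOrientedHypersurface.inner_combination (p : M) (a b c d : ℝ) :
    inner ℝ (a • N p + b • ambientMap f p) (c • N p + d • ambientMap f p) = a * c + b * d := by
  have h1 := hf.inner_ambient_self p
  have h2 := hf.inner_normal_self p
  have h3 := hf.inner_ambient_normal p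
  have h4 := hf.inner_ambient_normal p
  rw [real_inner_comm] at h4
  simp only [inner_add_left, inner_add_right, real_inner_smul_left, real_inner_smul_right, h1, h2,
    h3, h4]
  ring

theorem _root_.IsOrientedHypersurface.adjoint_differential_combination (p : M) (b : ℝ) :
    LinearMap.adjoint (sphereDifferential f p).toLinearMap (N p + b • ambientMap f p) = 0 :=
  ext_inner_right ℝ fun v ↦ by
    rw [LinearMap.adjoint_inner_left, inner_add_left, real_inner_smul_left]
    change inner ℝ (N p) (sphereDifferential f p v)
      + b * inner ℝ (ambientMap f p) (sphereDifferential f p v) = _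
    rw [hf.normal_orthogonal, hf.inner_ambient_differential]
    simp

theorem _root_.IsOrientedHypersurface.splittingProjection_add_smul (p : M) :
    splittingProjection f N lam mu p (N p + mu p • ambientMap f p)
      = N p + mu p • ambientMap f p := by
  have h1 := hf.inner_combination p 1 (mu p) 1 (mu p)
  rw [one_smul] at h1
  rw [splittingProjection_apply, hf.adjoint_differential_combination, h1, smul_smul,
    show (1 + mu p ^ 2)⁻¹ * (1 * 1 + mu p * mu p) = 1 by
      rw [one_mul, ← pow_two]; exact inv_mul_cancel₀ (by positivity)]
  simp

theorem _root_.IsOrientedHypersurface.splittingProjection_add_smul_eq_zero {p : M}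
    (hmul : 1 + lam p * mu p = 0) :
    splittingProjection f N lam mu p (N p + lam p • ambientMap f p) = 0 := by
  have h1 := hf.inner_combination p 1 (mu p) 1 (lam p)
  rw [one_smul] at h1
  rw [splittingProjection_apply, hf.adjoint_differential_combination, h1,
    show 1 * 1 + mu p * lam p = 0 by linarith]
  simp

theorem _root_.IsOrientedHypersurface.splittingProjection_differential (p : M)
    (u : TangentSpace (𝓡 n) p) :
    splittingProjection f N lam mu p (sphereDifferential f p u)
      = sphereDifferential f p ((lam p - mu p)⁻¹ • (shapeOperator f N p u - mu p • u)) := by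
  have h1 : inner ℝ (N p + mu p • ambientMap f p) (sphereDifferential f p u) = 0 := by
    rw [inner_add_left, real_inner_smul_left, hf.normal_orthogonal, hf.inner_ambient_differential]
    simp
  rw [splittingProjection_apply, hf.adjoint_differential, h1]
  simp

/-- Symmetry passes from the shape operator to this operator. It is what puts fixed vectors of the
splitting projection into the orthogonal complement of its kernel. -/
theorem _root_.IsOrientedHypersurface.inner_splittingProjection (p : M)
    (v w : EuclideanSpace ℝ (Fin (n + 1 + 1))) :
    inner ℝ (splittingProjection f N lam mu p v) w
      = inner ℝ v (splittingProjection f N lam mu p w) := by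
  have h1 : ∀ v w : EuclideanSpace ℝ (Fin (n + 1 + 1)),
      inner ℝ (splittingProjection f N lam mu p v) w
      = (lam p - mu p)⁻¹ * (inner ℝ (shapeOperator f N p
          (LinearMap.adjoint (sphereDifferential f p).toLinearMap v))
          (LinearMap.adjoint (sphereDifferential f p).toLinearMap w)
        - mu p * inner ℝ (LinearMap.adjoint (sphereDifferential f p).toLinearMap v)
          (LinearMap.adjoint (sphereDifferential f p).toLinearMap w))
      + (1 + mu p ^ 2)⁻¹ * (inner ℝ (N p + mu p • ambientMap f p) v *
        inner ℝ (N p + mu p • ambientMap f p) w) := by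
    intro v w
    rw [splittingProjection_apply, inner_add_left, real_inner_smul_left, real_inner_smul_left]
    congr 1
    have h2 := LinearMap.adjoint_inner_right (sphereDifferential f p).toLinearMap
      ((lam p - mu p)⁻¹ • (shapeOperator f N p
        (LinearMap.adjoint (sphereDifferential f p).toLinearMap v)
          - mu p • LinearMap.adjoint (sphereDifferential f p).toLinearMap v)) w
    refine h2.symm.trans ?_
    rw [real_inner_smul_left, inner_sub_left, real_inner_smul_left]
  rw [h1, real_inner_comm (splittingProjection f N lam mu p w) v, h1,
    hf.isSymmetric_shapeOperator, real_inner_comm (shapeOperator f N p _),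
    real_inner_comm (LinearMap.adjoint (sphereDifferential f p).toLinearMap w)
      (LinearMap.adjoint (sphereDifferential f p).toLinearMap v)]
  ring

include h

theorem splittingProjection_chart (p₀ : M) {y : EuclideanSpace ℝ (Fin n)}
    (hy : y ∈ (extChartAt (𝓡 n) p₀).target) :
    splittingProjection f N lam mu ((extChartAt (𝓡 n) p₀).symm y)
      = fderiv ℝ (ambientMap f ∘ (extChartAt (𝓡 n) p₀).symm) y ∘L
          principalProjection f N lam mu p₀ y ∘L
          pseudoInverse (fderiv ℝ (ambientMap f ∘ (extChartAt (𝓡 n) p₀).symm) y)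
        + (1 + (mu ∘ (extChartAt (𝓡 n) p₀).symm) y ^ 2)⁻¹ •
          (innerSL ℝ ((N ∘ (extChartAt (𝓡 n) p₀).symm) y + (mu ∘ (extChartAt (𝓡 n) p₀).symm) y •
            (ambientMap f ∘ (extChartAt (𝓡 n) p₀).symm) y)).smulRight
          ((N ∘ (extChartAt (𝓡 n) p₀).symm) y + (mu ∘ (extChartAt (𝓡 n) p₀).symm) y •
            (ambientMap f ∘ (extChartAt (𝓡 n) p₀).symm) y) := by
  ext1 w
  rw [splittingProjection_apply, ← hf.chartFrame_pseudoInverse p₀ hy,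
    ← hf.chartFrame_shapeCoord p₀ hy, ← map_smul, ← map_sub, ← h.smul_principalProjection,
    (chartFrame p₀ y).map_smul, inv_smul_smul₀ (sub_ne_zero.2 (h.ne _)), ← hf.fderiv_ambient p₀ hy]
  rfl

/-- In each chart the operator is smooth and acts on V, W and the two principal spaces as
`fderiv_projection_eq_zero` requires, so its derivative vanishes; connectedness does the rest. -/
theorem splittingProjection_eq [PreconnectedSpace M] (hk : 2 ≤ k) (hl : 2 ≤ l) {a b : ℝ}
    (hlam : ∀ p, lam p = a) (hmu : ∀ p, mu p = b) (p q : M) :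
    splittingProjection f N lam mu p = splittingProjection f N lam mu q := by
  have hmul : 1 + a * b = 0 := by
    have := h.one_add_mul_eq_zero hf hk hl p (fun y _ ↦ ?_) (fun y _ ↦ ?_)
    · rwa [hlam, hmu] at this
    · rw [show lam ∘ (extChartAt (𝓡 n) p).symm = fun _ ↦ a from funext fun _ ↦ hlam _]; simp
    · rw [show mu ∘ (extChartAt (𝓡 n) p).symm = fun _ ↦ b from funext fun _ ↦ hmu _]; simp
  refine IsLocallyConstant.apply_eq_of_preconnectedSpace
    ((IsLocallyConstant.iff_eventually_eq _).2 fun p₀ ↦ ?_) p q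
  have hpatch := h.principalPatch hf p₀
  have smooth : ContDiffOn ℝ ∞ (splittingProjection f N lam mu ∘ (extChartAt (𝓡 n) p₀).symm)
      (extChartAt (𝓡 n) p₀).target := by
    have sV := hpatch.smooth_N.add (hpatch.smooth_mu.smul hpatch.smooth_f)
    have s1 := hpatch.smooth_f.fderiv_smooth (isOpen_target p₀)
    have s2 := s1.pseudoInverse (fun y hy ↦ hf.injective_fderiv_ambient p₀ hy)
    have s3 := (contDiffOn_const (c := (1 : ℝ))).add (hpatch.smooth_mu.pow 2)
    refine ((s1.clm_comp (hpatch.smooth_P.clm_comp s2)).add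
      ((s3.inv fun y _ ↦ by positivity).smul
        (((innerSL ℝ).contDiff.comp_contDiffOn sV).smulRight sV))).congr fun y hy ↦ ?_
    exact h.splittingProjection_chart hf p₀ hy
  refine eventually_eq_of_fderiv_chart_eq_zero p₀ (isOpen_target p₀) (mem_extChartAt_target p₀)
    (smooth.differentiableOn (by simp)) fun y hy ↦ ?_
  refine hpatch.fderiv_projection_eq_zero (fun y _ ↦ ?_) (fun y _ ↦ ?_) hy
    (smooth.differentiableAt_of_isOpen (isOpen_target p₀) hy) (fun z _ ↦ ?_) (fun z hz v ↦ ?_)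
    (fun z _ ↦ ?_) (fun z hz v ↦ ?_) ?_
  · rw [show lam ∘ (extChartAt (𝓡 n) p₀).symm = fun _ ↦ a from funext fun _ ↦ hlam _]; simp
  · rw [show mu ∘ (extChartAt (𝓡 n) p₀).symm = fun _ ↦ b from funext fun _ ↦ hmu _]; simp
  · exact hf.splittingProjection_add_smul _
  · rw [hf.fderiv_ambient p₀ hz]
    refine (hf.splittingProjection_differential _ _).trans ?_
    rw [Module.End.mem_eigenspace_iff.1 (h.chartFrame_mem_eigenspace hf p₀ hz v), ← sub_smul,
      inv_smul_smul₀ (sub_ne_zero.2 (h.ne _))]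
  · exact hf.splittingProjection_add_smul_eq_zero (by rw [hlam, hmu]; exact hmul)
  · rw [hf.fderiv_ambient p₀ hz, ← h.principalProjection_swap]
    refine (hf.splittingProjection_differential _ _).trans ?_
    rw [Module.End.mem_eigenspace_iff.1 (h.swap.chartFrame_mem_eigenspace hf p₀ hz v), sub_self,
      smul_zero, map_zero]
  · simp only [Function.comp_apply, hlam, hmu]
    exact hmul

end HasTwoCurvatures

end Splitting

/-- A principal space together with one focal normal orthogonal to it gives the lower bound for the
dimension of each summand of the splitting. -/
theorem finrank_add_one_le_of_orthogonal {T H : Type*} [AddCommGroup T] [Module ℝ T]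
    [NormedAddCommGroup H] [InnerProductSpace ℝ H] [FiniteDimensional ℝ T]
    [FiniteDimensional ℝ H] (D : T →ₗ[ℝ] H)
    (hD : ∀ u, D u = 0 → u = 0) (E : Submodule ℝ T) (K : Submodule ℝ H) {v : H} (hv : v ≠ 0)
    (hvK : v ∈ K) (hE : ∀ u ∈ E, D u ∈ K) (hvD : ∀ u ∈ E, inner ℝ v (D u) = 0) :
    Module.finrank ℝ E + 1 ≤ Module.finrank ℝ K := by
  set Φ : (E × ℝ) →ₗ[ℝ] K := ((D ∘ₗ E.subtype).codRestrict K fun u ↦ hE u u.2).coprod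
    ((LinearMap.toSpanSingleton ℝ H v).codRestrict K fun t ↦ K.smul_mem t hvK) with hΦ
  have hΦa : ∀ u t, (Φ (u, t) : H) = D u + t • v := fun u t ↦ rfl
  have hinj : Function.Injective Φ := by
    rw [← LinearMap.ker_eq_bot, LinearMap.ker_eq_bot']
    rintro ⟨u, t⟩ h0
    have h1 : D u + t • v = 0 := by rw [← hΦa, h0]; rfl
    have h2 : t = 0 := by
      have := congrArg (inner ℝ v) h1
      rw [inner_add_right, hvD u u.2, real_inner_smul_right, zero_add, inner_zero_right,
        mul_eq_zero, inner_self_eq_zero] at this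
      exact this.resolve_right hv
    rw [h2, zero_smul, add_zero] at h1
    exact Prod.ext (Subtype.ext (hD _ h1)) h2
  have := LinearMap.finrank_le_finrank_of_injective hinj
  rwa [Module.finrank_prod, Module.finrank_self] at this

/-- Euclidean coordinates on a subspace and on its orthogonal complement. -/
theorem exists_orthogonal_coordinates {H : Type*} [NormedAddCommGroup H] [InnerProductSpace ℝ H]
    [FiniteDimensional ℝ H] (K : Submodule ℝ H) {r s : ℕ} (hr : Module.finrank ℝ K = r)
    (hs : Module.finrank ℝ Kᗮ = s) :
    ∃ (R : H →L[ℝ] EuclideanSpace ℝ (Fin r)) (S : H →L[ℝ] EuclideanSpace ℝ (Fin s)),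
      (∀ x y, inner ℝ (R x) (R y) + inner ℝ (S x) (S y) = (inner ℝ x y : ℝ)) ∧
      (∀ x ∈ K, S x = 0) ∧ ∀ x ∈ Kᗮ, R x = 0 := by
  subst hr hs
  refine ⟨(stdOrthonormalBasis ℝ K).repr.toContinuousLinearEquiv.toContinuousLinearMap ∘L
      K.orthogonalProjectionOnto,
    (stdOrthonormalBasis ℝ Kᗮ).repr.toContinuousLinearEquiv.toContinuousLinearMap ∘L
      Kᗮ.orthogonalProjectionOnto, fun x y ↦ ?_, fun x hx ↦ ?_, fun x hx ↦ ?_⟩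
  · have h1 := K.orthogonalDecomposition.inner_map_map x y
    rw [WithLp.prod_inner_apply, K.orthogonalDecomposition_apply,
      K.orthogonalDecomposition_apply] at h1
    rw [← h1]
    congr 1
    · exact (stdOrthonormalBasis ℝ K).repr.inner_map_map _ _
    · exact (stdOrthonormalBasis ℝ Kᗮ).repr.inner_map_map _ _
  · have : Kᗮ.orthogonalProjectionOnto x = 0 := by
      rw [Submodule.orthogonalProjectionOnto_eq_zero_iff]
      exact K.le_orthogonal_orthogonal hx
    change (stdOrthonormalBasis ℝ Kᗮ).repr (Kᗮ.orthogonalProjectionOnto x) = 0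
    rw [this, map_zero]
  · have : K.orthogonalProjectionOnto x = 0 :=
      Submodule.orthogonalProjectionOnto_eq_zero_iff.2 hx
    change (stdOrthonormalBasis ℝ K).repr (K.orthogonalProjectionOnto x) = 0
    rw [this, map_zero]

/-- Let T be the constant projection. For every p the vectors V and W lie in (ker T)ᗮ and ker T, and
(b − a)f = V − W. So the components of f have lengths √(1 + b²)/|b − a| and √(1 + a²)/|b − a|, and
the squares add up to |f|² = 1. -/
theorem HasTwoCurvatures.exists_splitting {n : ℕ} {M : Type*} [TopologicalSpace M]
    [ConnectedSpace M] [ChartedSpace (EuclideanSpace ℝ (Fin n)) M] [IsManifold (𝓡 n) ∞ M]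
    [Bundle.RiemannianBundle (fun p : M ↦ TangentSpace (𝓡 n) p)]
    {f : M → USphere (n + 1)} {N : M → EuclideanSpace ℝ (Fin (n + 1 + 1))}
    {lam mu : M → ℝ} {k l : ℕ} (h : HasTwoCurvatures f N lam mu k l)
    (hf : IsOrientedHypersurface f N) (hk : 2 ≤ k) (hl : 2 ≤ l) (hkl : k + l = n) {a b : ℝ}
    (hlam : ∀ p, lam p = a) (hmu : ∀ p, mu p = b) :
    ∃ (R : EuclideanSpace ℝ (Fin (n + 1 + 1)) →L[ℝ] EuclideanSpace ℝ (Fin (k + 1)))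
      (S : EuclideanSpace ℝ (Fin (n + 1 + 1)) →L[ℝ] EuclideanSpace ℝ (Fin (l + 1))) (r s : ℝ),
      0 < r ∧ 0 < s ∧ r ^ 2 + s ^ 2 = 1 ∧
      (∀ x y, inner ℝ (R x) (R y) + inner ℝ (S x) (S y) = (inner ℝ x y : ℝ)) ∧
      (∀ p, ‖R (ambientMap f p)‖ = r) ∧ ∀ p, ‖S (ambientMap f p)‖ = s := by
  obtain ⟨p₀⟩ : Nonempty M := inferInstance
  have hab : a ≠ b := by have := h.ne p₀; rwa [hlam, hmu] at this
  have hmul : 1 + a * b = 0 := by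
    have := h.one_add_mul_eq_zero hf hk hl p₀ (fun y _ ↦ ?_) (fun y _ ↦ ?_)
    · rwa [hlam, hmu] at this
    · rw [show lam ∘ (extChartAt (𝓡 n) p₀).symm = fun _ ↦ a from funext fun _ ↦ hlam _]; simp
    · rw [show mu ∘ (extChartAt (𝓡 n) p₀).symm = fun _ ↦ b from funext fun _ ↦ hmu _]; simp
  set T := splittingProjection f N lam mu p₀ with hT
  have hTp : ∀ p, splittingProjection f N lam mu p = T := fun p ↦
    h.splittingProjection_eq hf hk hl hlam hmu p p₀
  have hfix : ∀ x, T x = x → x ∈ T.kerᗮ := by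
    intro x hx y hy
    rw [← hx, ← hf.inner_splittingProjection p₀, ← hT, show T y = 0 from hy, inner_zero_left]
  have hV : ∀ p, N p + b • ambientMap f p ∈ T.kerᗮ := by
    intro p
    refine hfix _ ?_
    have := hf.splittingProjection_add_smul (lam := lam) (mu := mu) p
    rwa [hTp, hmu] at this
  have hW : ∀ p, N p + a • ambientMap f p ∈ T.ker := by
    intro p
    have := hf.splittingProjection_add_smul_eq_zero (lam := lam) (mu := mu) (p := p)
      (by rw [hlam, hmu, hmul])
    rwa [hTp, hlam] at this
  have hE : ∀ u ∈ Module.End.eigenspace (shapeOperator f N p₀) (lam p₀),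
      (sphereDifferential f p₀).toLinearMap u ∈ T.kerᗮ := by
    intro u hu
    refine hfix _ ((hf.splittingProjection_differential p₀ u).trans ?_)
    rw [Module.End.mem_eigenspace_iff.1 hu, ← sub_smul,
      inv_smul_smul₀ (sub_ne_zero.2 (h.ne _))]
    rfl
  have hE' : ∀ u ∈ Module.End.eigenspace (shapeOperator f N p₀) (mu p₀),
      (sphereDifferential f p₀).toLinearMap u ∈ T.ker := by
    intro u hu
    refine (hf.splittingProjection_differential p₀ u).trans ?_
    rw [Module.End.mem_eigenspace_iff.1 hu, sub_self, smul_zero, map_zero]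
  have hnorm : ∀ (p : M) (c : ℝ), ‖N p + c • ambientMap f p‖ ^ 2 = 1 + c ^ 2 := by
    intro p c
    rw [← real_inner_self_eq_norm_sq]
    have := hf.inner_combination p 1 c 1 c
    rw [one_smul] at this
    rw [this]; ring
  have hne : ∀ (p : M) (c : ℝ), N p + c • ambientMap f p ≠ 0 := by
    intro p c h0
    have := hnorm p c
    rw [h0, norm_zero] at this
    nlinarith
  have horth : ∀ (c : ℝ) (u : TangentSpace (𝓡 n) p₀),
      inner ℝ (N p₀ + c • ambientMap f p₀) ((sphereDifferential f p₀).toLinearMap u) = 0 := by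
    intro c u
    change inner ℝ _ (sphereDifferential f p₀ u) = 0
    rw [inner_add_left, real_inner_smul_left, hf.normal_orthogonal, hf.inner_ambient_differential]
    simp
  have d1 := finrank_add_one_le_of_orthogonal (sphereDifferential f p₀).toLinearMap
    (hf.injective_differential p₀) _ T.kerᗮ (hne p₀ b) (hV p₀) hE (fun u _ ↦ horth b u)
  have d2 := finrank_add_one_le_of_orthogonal (sphereDifferential f p₀).toLinearMap
    (hf.injective_differential p₀) _ T.ker (hne p₀ a) (hW p₀) hE' (fun u _ ↦ horth a u)
  have e1 := h.rank_lam p₀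
  have e2 := h.rank_mu p₀
  rw [principalMultiplicity] at e1 e2
  have d3 := T.ker.finrank_add_finrank_orthogonal
  rw [finrank_euclideanSpace_fin] at d3
  -- The summands have dimensions at least k + 1 and l + 1, with total n + 2 = (k + 1) + (l + 1), so
  -- both bounds are equalities. The kernel of T carries the coordinates S.
  obtain ⟨S, R, hRS, hS, hR⟩ := exists_orthogonal_coordinates T.ker (r := l + 1) (s := k + 1)
    (by omega) (by omega)
  have hRn : ∀ p, ‖S (ambientMap f p)‖ = √((1 + a ^ 2) / (b - a) ^ 2) := by
    intro p
    have h1 : (b - a) • S (ambientMap f p) = -S (N p + a • ambientMap f p) := by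
      rw [← map_smul, show (b - a) • ambientMap f p
        = (N p + b • ambientMap f p) - (N p + a • ambientMap f p) by module, map_sub,
        hR _ (hV p), zero_sub]
    have h2 : ‖S (N p + a • ambientMap f p)‖ ^ 2 = 1 + a ^ 2 := by
      have := hRS (N p + a • ambientMap f p) (N p + a • ambientMap f p)
      rwa [hS _ (hW p), inner_zero_left, add_zero, real_inner_self_eq_norm_sq,
        real_inner_self_eq_norm_sq, hnorm] at this
    rw [eq_comm, Real.sqrt_eq_iff_mul_self_eq (by positivity) (norm_nonneg _), ← pow_two,
      eq_comm, eq_div_iff (pow_ne_zero 2 (sub_ne_zero.2 hab.symm)), ← h2,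
      ← norm_neg (S (N p + _)), ← h1,
      norm_smul, mul_pow, Real.norm_eq_abs, sq_abs, mul_comm]
  have hSn : ∀ p, ‖R (ambientMap f p)‖ = √((1 + b ^ 2) / (b - a) ^ 2) := by
    intro p
    have h1 : (b - a) • R (ambientMap f p) = R (N p + b • ambientMap f p) := by
      rw [← map_smul, show (b - a) • ambientMap f p
        = (N p + b • ambientMap f p) - (N p + a • ambientMap f p) by module, map_sub,
        hS _ (hW p), sub_zero]
    have h2 : ‖R (N p + b • ambientMap f p)‖ ^ 2 = 1 + b ^ 2 := by
      have := hRS (N p + b • ambientMap f p) (N p + b • ambientMap f p)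
      rwa [hR _ (hV p), inner_zero_left, zero_add, real_inner_self_eq_norm_sq,
        real_inner_self_eq_norm_sq, hnorm] at this
    rw [eq_comm, Real.sqrt_eq_iff_mul_self_eq (by positivity) (norm_nonneg _), ← pow_two,
      eq_comm, eq_div_iff (pow_ne_zero 2 (sub_ne_zero.2 hab.symm)), ← h2, ← h1,
      norm_smul, mul_pow, Real.norm_eq_abs, sq_abs, mul_comm]
  have hpos : 0 < (b - a) ^ 2 := by
    have := sub_ne_zero.2 hab.symm
    positivity
  refine ⟨R, S, _, _, Real.sqrt_pos.2 (by positivity), Real.sqrt_pos.2 (by positivity), ?_,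
    fun x y ↦ by rw [add_comm]; exact hRS x y, hSn, hRn⟩
  rw [← hSn p₀, ← hRn p₀, ← real_inner_self_eq_norm_sq, ← real_inner_self_eq_norm_sq, add_comm,
    hRS, hf.inner_ambient_self]

/-! ### The inverse function theorem between manifolds -/

section InverseFunction

variable {E E' H H' M M' : Type*} [NormedAddCommGroup E] [NormedSpace ℝ E] [CompleteSpace E]
  [NormedAddCommGroup E'] [NormedSpace ℝ E'] [TopologicalSpace H] [TopologicalSpace H']
  {I : ModelWithCorners ℝ E H} {J : ModelWithCorners ℝ E' H'} [I.Boundaryless] [J.Boundaryless]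
  [TopologicalSpace M] [ChartedSpace H M] [IsManifold I ∞ M]
  [TopologicalSpace M'] [ChartedSpace H' M'] [IsManifold J ∞ M']

theorem ContMDiff.isLocalDiffeomorph_of_mfderiv_isInvertible {φ : M → M'}
    (hφ : ContMDiff I J ∞ φ) (hd : ∀ p, (mfderiv I J φ p).IsInvertible) :
    IsLocalDiffeomorph I J ∞ φ := by
  intro p
  have : IsManifold I 1 M := IsManifold.of_le (n := ∞) (by simp)
  have : IsManifold J 1 M' := IsManifold.of_le (n := ∞) (by simp)
  set e := extChartAt I p with he
  set e' := extChartAt J (φ p) with he'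
  have hOe : IsOpen e.target := isOpen_extChartAt_target p
  have hOs : IsOpen e.source := isOpen_extChartAt_source p
  have hOs' : IsOpen e'.source := isOpen_extChartAt_source (φ p)
  have hOe' : IsOpen e'.target := isOpen_extChartAt_target (φ p)
  have se : ContMDiffOn I 𝓘(ℝ, E) ∞ e e.source := by
    rw [he, extChartAt_source]; exact contMDiffOn_extChartAt
  have se' : ContMDiffOn J 𝓘(ℝ, E') ∞ e' e'.source := by
    rw [he', extChartAt_source]; exact contMDiffOn_extChartAt
  have ses : ContMDiffOn 𝓘(ℝ, E) I ∞ e.symm e.target := contMDiffOn_extChartAt_symm p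
  have ses' : ContMDiffOn 𝓘(ℝ, E') J ∞ e'.symm e'.target := contMDiffOn_extChartAt_symm (φ p)
  set g : E → E' := e' ∘ φ ∘ e.symm with hg
  set O : Set E := e.target ∩ (φ ∘ e.symm) ⁻¹' e'.source with hO
  have hOO : IsOpen O := (hφ.continuous.comp_continuousOn ses.continuousOn).isOpen_inter_preimage
    hOe hOs'
  have sg : ∀ y ∈ O, ContMDiffAt 𝓘(ℝ, E) 𝓘(ℝ, E') ∞ g y := fun y hy ↦
    (se'.contMDiffAt (hOs'.mem_nhds hy.2)).comp y
      ((hφ _).comp y (ses.contMDiffAt (hOe.mem_nhds hy.1)))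
  have sg' : ∀ y ∈ O, ContDiffAt ℝ ∞ g y := fun y hy ↦ contMDiffAt_iff_contDiffAt.1 (sg y hy)
  have dg : ∀ y ∈ O, (fderiv ℝ g y).IsInvertible := by
    intro y hy
    have h1 := isInvertible_mfderivWithin_extChartAt_symm (I := I) (x := p) hy.1
    rw [ModelWithCorners.range_eq_univ, mfderivWithin_univ] at h1
    have h2 := isInvertible_mfderiv_extChartAt (I := J) (x := φ p) hy.2
    have d1 : MDifferentiableAt 𝓘(ℝ, E) I e.symm y :=
      (ses.contMDiffAt (hOe.mem_nhds hy.1)).mdifferentiableAt (by simp)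
    have d2 : MDifferentiableAt I J φ (e.symm y) := hφ.mdifferentiableAt (by simp)
    have d3 : MDifferentiableAt J 𝓘(ℝ, E') e' (φ (e.symm y)) :=
      (se'.contMDiffAt (hOs'.mem_nhds hy.2)).mdifferentiableAt (by simp)
    rw [← mfderiv_eq_fderiv, hg, mfderiv_comp y d3 (d2.comp y d1), mfderiv_comp y d2 d1]
    exact h2.comp ((hd _).comp h1)
  have hxO : e p ∈ O := by
    refine ⟨mem_extChartAt_target p, ?_⟩
    simp only [Set.mem_preimage, Function.comp_apply, he, extChartAt_to_inv]
    exact mem_extChartAt_source (φ p)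
  choose D hD using dg
  have hasD : ∀ y, ∀ hy : y ∈ O, HasFDerivAt g (D y hy : E →L[ℝ] E') y := fun y hy ↦ by
    rw [hD y hy]
    exact ((sg' y hy).differentiableAt (by simp)).hasFDerivAt
  -- Restricting to O, where the derivative is invertible at every point, makes the local inverse
  -- smooth on its whole domain and not only at the image of the base point.
  set G := ((sg' _ hxO).toOpenPartialHomeomorph g (hasD _ hxO) (by simp)).restr O with hG
  have hGg : ⇑G = g := rfl
  have hGs : G.source ⊆ O := by
    rw [hG, OpenPartialHomeomorph.restr_source, hOO.interior_eq]
    exact Set.inter_subset_right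
  have hxG : e p ∈ G.source := by
    rw [hG, OpenPartialHomeomorph.restr_source, hOO.interior_eq]
    exact ⟨(sg' _ hxO).mem_toOpenPartialHomeomorph_source (hasD _ hxO) (by simp), hxO⟩
  have sGs : ContDiffOn ℝ ∞ G.symm G.target := fun z hz ↦
    (G.contDiffAt_symm hz (hasD _ (hGs (G.map_target hz)))
      (sg' _ (hGs (G.map_target hz)))).contDiffWithinAt
  have sG : ContDiffOn ℝ ∞ G G.source := fun y hy ↦ (sg' y (hGs hy)).contDiffWithinAt
  have hsrc : ∀ x, x ∈ (e.trans (G.toPartialEquiv.trans e'.symm)).source →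
      x ∈ e.source ∧ e x ∈ G.source ∧ G (e x) ∈ e'.target := by
    intro x hx
    simpa [PartialEquiv.trans_source] using hx
  have htgt : ∀ x, x ∈ (e.trans (G.toPartialEquiv.trans e'.symm)).target →
      x ∈ e'.source ∧ e' x ∈ G.target ∧ G.symm (e' x) ∈ e.target := by
    intro x hx
    simpa [PartialEquiv.trans_target, and_assoc] using hx
  refine ⟨⟨e.trans (G.toPartialEquiv.trans e'.symm), ?_, ?_, ?_, ?_⟩, ?_, ?_⟩
  · have h1 : IsOpen (G.source ∩ G ⁻¹' e'.target) :=
      G.continuousOn.isOpen_inter_preimage G.open_source hOe'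
    exact se.continuousOn.isOpen_inter_preimage hOs h1
  · have h1 : IsOpen (G.target ∩ G.symm ⁻¹' e.target) :=
      G.continuousOn_symm.isOpen_inter_preimage G.open_target hOe
    have h2 := se'.continuousOn.isOpen_inter_preimage hOs' h1
    convert! h2 using 1
    ext x
    simp [PartialEquiv.trans_target, and_assoc]
  · exact ses'.comp (sG.contMDiffOn.comp (se.mono fun x hx ↦ (hsrc x hx).1)
      fun x hx ↦ (hsrc x hx).2.1) fun x hx ↦ (hsrc x hx).2.2
  · exact ses.comp (sGs.contMDiffOn.comp (se'.mono fun x hx ↦ (htgt x hx).1)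
      fun x hx ↦ (htgt x hx).2.1) fun x hx ↦ (htgt x hx).2.2
  · refine ⟨mem_extChartAt_source p, hxG, ?_⟩
    change e' (φ (e.symm (e p))) ∈ e'.target
    rw [he, extChartAt_to_inv]
    exact mem_extChartAt_target (φ p)
  · intro x hx
    obtain ⟨h1, h2, -⟩ := hsrc x hx
    change φ x = e'.symm (e' (φ (e.symm (e x))))
    have h3 := (hGs h2).2
    rw [Set.mem_preimage, Function.comp_apply, e.left_inv h1] at h3
    rw [e.left_inv h1, e'.left_inv h3]

end InverseFunction

theorem contMDiff_coe_usphere (k : ℕ) :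
    ContMDiff (𝓡 k) 𝓘(ℝ, EuclideanSpace ℝ (Fin (k + 1))) ∞
      (fun x : USphere k ↦ (x : EuclideanSpace ℝ (Fin (k + 1)))) :=
  have : Fact (Module.finrank ℝ (EuclideanSpace ℝ (Fin (k + 1))) = k + 1) :=
    Fact.mk finrank_euclideanSpace_fin
  contMDiff_coe_sphere (E := EuclideanSpace ℝ (Fin (k + 1))) (m := ∞) (n := k)

/-! ### The local isometry to the product of spheres -/

section LocalIsometry

variable {n : ℕ} {M : Type*} [TopologicalSpace M] [ChartedSpace (EuclideanSpace ℝ (Fin n)) M]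
  [IsManifold (𝓡 n) ∞ M]

/-- A map of constant norm, divided by this norm, as a map to the unit sphere. -/
theorem exists_contMDiff_usphere {k : ℕ} {g : M → EuclideanSpace ℝ (Fin (k + 1))}
    (hg : ContMDiff (𝓡 n) 𝓘(ℝ, EuclideanSpace ℝ (Fin (k + 1))) ∞ g) {r : ℝ} (hr : 0 < r)
    (hgr : ∀ p, ‖g p‖ = r) :
    ∃ φ : M → USphere k, ContMDiff (𝓡 n) (𝓡 k) ∞ φ ∧
      ∀ p, g p = r • (φ p : EuclideanSpace ℝ (Fin (k + 1))) := by
  have : Fact (Module.finrank ℝ (EuclideanSpace ℝ (Fin (k + 1))) = k + 1) :=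
    Fact.mk finrank_euclideanSpace_fin
  have h1 : ContMDiff (𝓡 n) 𝓘(ℝ, EuclideanSpace ℝ (Fin (k + 1))) ∞ (fun p ↦ r⁻¹ • g p) :=
    (contDiff_const_smul r⁻¹).contMDiff.comp hg
  have h2 : ∀ p, r⁻¹ • g p ∈ Metric.sphere (0 : EuclideanSpace ℝ (Fin (k + 1))) 1 := by
    intro p
    rw [mem_sphere_zero_iff_norm, norm_smul, hgr, norm_inv, Real.norm_of_nonneg hr.le,
      inv_mul_cancel₀ hr.ne']
  refine ⟨_, ContMDiff.codRestrict_sphere (E := EuclideanSpace ℝ (Fin (k + 1))) h1 h2,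
    fun p ↦ ?_⟩
  rw [Set.val_codRestrict_apply, smul_inv_smul₀ hr.ne']

theorem mvfderiv_smul_coe_comp {k : ℕ} {E' H' P : Type*} [NormedAddCommGroup E']
    [NormedSpace ℝ E'] [TopologicalSpace H'] {J : ModelWithCorners ℝ E' H'} [TopologicalSpace P]
    [ChartedSpace H' P] {pr : P → USphere k} {φ : M → P} {p : M}
    {g : M → EuclideanSpace ℝ (Fin (k + 1))} {r : ℝ}
    (hpr : MDifferentiableAt J (𝓡 k) pr (φ p)) (hφ : MDifferentiableAt (𝓡 n) J φ p)
    (h : ∀ q, g q = r • (pr (φ q) : EuclideanSpace ℝ (Fin (k + 1)))) (w : TangentSpace (𝓡 n) p) :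
    mvfderiv (𝓡 k) (fun y : USphere k ↦ r • (y : EuclideanSpace ℝ (Fin (k + 1)))) (pr (φ p))
      (mfderiv J (𝓡 k) pr (φ p) (mfderiv (𝓡 n) J φ p w)) = mvfderiv (𝓡 n) g p w := by
  have h1 : MDifferentiableAt (𝓡 k) 𝓘(ℝ, EuclideanSpace ℝ (Fin (k + 1)))
      (fun y : USphere k ↦ r • (y : EuclideanSpace ℝ (Fin (k + 1)))) (pr (φ p)) :=
    ((contDiff_const_smul r).contMDiff.comp (contMDiff_coe_usphere k)).mdifferentiableAt (by simp)
  rw [← mfderiv_comp_apply p hpr hφ, show g = (fun y : USphere k ↦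
    r • (y : EuclideanSpace ℝ (Fin (k + 1)))) ∘ (pr ∘ φ) from funext h]
  exact (mfderiv_comp_apply p h1 (hpr.comp p hφ) w).symm

theorem mvfderiv_clm_comp {G G' : Type*} [NormedAddCommGroup G] [NormedSpace ℝ G]
    [NormedAddCommGroup G'] [NormedSpace ℝ G'] (R : G →L[ℝ] G') {g : M → G} {p : M}
    (hg : MDifferentiableAt (𝓡 n) 𝓘(ℝ, G) g p) (w : TangentSpace (𝓡 n) p) :
    mvfderiv (𝓡 n) (R ∘ g) p w = R (mvfderiv (𝓡 n) g p w) := by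
  have h1 : MDifferentiableAt 𝓘(ℝ, G) 𝓘(ℝ, G') R (g p) :=
    R.differentiableAt.mdifferentiableAt
  refine (mfderiv_comp_apply p h1 hg w).trans ?_
  rw [mfderiv_eq_fderiv, R.fderiv]
  rfl

variable [Bundle.RiemannianBundle (fun p : M ↦ TangentSpace (𝓡 n) p)]

/-- Take φ = (Rf/r, Sf/s). The product metric pulls back to ⟨R df, R df⟩ + ⟨S df, S df⟩ = ⟨df, df⟩,
the metric of M. So dφ is injective, and by equality of dimensions invertible. -/
theorem IsOrientedHypersurface.exists_isLocalDiffeomorph {f : M → USphere (n + 1)}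
    {N : M → EuclideanSpace ℝ (Fin (n + 1 + 1))} (hf : IsOrientedHypersurface f N) {k l : ℕ}
    (hkl : k + l = n)
    {R : EuclideanSpace ℝ (Fin (n + 1 + 1)) →L[ℝ] EuclideanSpace ℝ (Fin (k + 1))}
    {S : EuclideanSpace ℝ (Fin (n + 1 + 1)) →L[ℝ] EuclideanSpace ℝ (Fin (l + 1))} {r s : ℝ}
    (hr : 0 < r) (hs : 0 < s)
    (hRS : ∀ x y, inner ℝ (R x) (R y) + inner ℝ (S x) (S y) = (inner ℝ x y : ℝ))
    (hR : ∀ p, ‖R (ambientMap f p)‖ = r) (hS : ∀ p, ‖S (ambientMap f p)‖ = s) :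
    ∃ φ : M → USphere k × USphere l,
      IsLocalDiffeomorph (𝓡 n) ((𝓡 k).prod (𝓡 l)) ∞ φ ∧
      (∀ p, R (ambientMap f p) = r • ((φ p).1 : EuclideanSpace ℝ (Fin (k + 1)))) ∧
      (∀ p, S (ambientMap f p) = s • ((φ p).2 : EuclideanSpace ℝ (Fin (l + 1)))) ∧
      ∀ (p : M) (u v : TangentSpace (𝓡 n) p),
        cliffordMetric k l r s (φ p) (mfderiv (𝓡 n) ((𝓡 k).prod (𝓡 l)) φ p u)
          (mfderiv (𝓡 n) ((𝓡 k).prod (𝓡 l)) φ p v) = inner ℝ u v := by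
  have sR := R.contDiff.contMDiff.comp hf.contMDiff_ambient
  have sS := S.contDiff.contMDiff.comp hf.contMDiff_ambient
  obtain ⟨φ₁, s₁, h₁⟩ := exists_contMDiff_usphere sR hr hR
  obtain ⟨φ₂, s₂, h₂⟩ := exists_contMDiff_usphere sS hs hS
  have sφ : ContMDiff (𝓡 n) ((𝓡 k).prod (𝓡 l)) ∞ (fun p ↦ (φ₁ p, φ₂ p)) := s₁.prodMk s₂
  have hmet : ∀ (p : M) (u v : TangentSpace (𝓡 n) p),
      cliffordMetric k l r s (φ₁ p, φ₂ p)
        (mfderiv (𝓡 n) ((𝓡 k).prod (𝓡 l)) (fun p ↦ (φ₁ p, φ₂ p)) p u)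
        (mfderiv (𝓡 n) ((𝓡 k).prod (𝓡 l)) (fun p ↦ (φ₁ p, φ₂ p)) p v) = inner ℝ u v := by
    intro p u v
    have dφ := sφ.mdifferentiableAt (x := p) (by simp)
    have hfR := mvfderiv_smul_coe_comp (pr := (Prod.fst : USphere k × USphere l → USphere k))
      (p := p) mdifferentiableAt_fst dφ h₁
    have hfS := mvfderiv_smul_coe_comp (pr := (Prod.snd : USphere k × USphere l → USphere l))
      (p := p) mdifferentiableAt_snd dφ h₂
    have hR' := mvfderiv_clm_comp R (hf.mdiff_ambient p)
    have hS' := mvfderiv_clm_comp S (hf.mdiff_ambient p)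
    rw [cliffordMetric, roundMetric, roundMetric, hfR, hfR, hfS, hfS, hR', hR', hS', hS', hRS]
    exact hf.isometric p u v
  refine ⟨_, sφ.isLocalDiffeomorph_of_mfderiv_isInvertible fun p ↦ ?_, h₁, h₂, hmet⟩
  have hinj : Function.Injective (mfderiv (𝓡 n) ((𝓡 k).prod (𝓡 l)) (fun p ↦ (φ₁ p, φ₂ p)) p) := by
    refine (injective_iff_map_eq_zero _).2 fun u hu ↦ ?_
    have h3 := hmet p u u
    rw [hu] at h3
    rw [← inner_self_eq_zero (𝕜 := ℝ), ← h3]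
    simp only [cliffordMetric, roundMetric, map_zero, inner_zero_left, add_zero]
  have hdim : Module.finrank ℝ (EuclideanSpace ℝ (Fin n))
      = Module.finrank ℝ (EuclideanSpace ℝ (Fin k) × EuclideanSpace ℝ (Fin l)) := by
    simp [hkl]
  set D : EuclideanSpace ℝ (Fin n) →L[ℝ] EuclideanSpace ℝ (Fin k) × EuclideanSpace ℝ (Fin l) :=
    mfderiv (𝓡 n) ((𝓡 k).prod (𝓡 l)) (fun p ↦ (φ₁ p, φ₂ p)) p with hD
  exact ⟨(LinearEquiv.ofInjectiveOfFinrankEq D.toLinearMap hinj hdim).toContinuousLinearEquiv,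
    ContinuousLinearMap.ext fun _ ↦ rfl⟩

end LocalIsometry

/-! ### A bijectivity criterion for local homeomorphisms -/

section Sections

variable {X B : Type*} [TopologicalSpace X] [T2Space X] [ConnectedSpace X] [TopologicalSpace B]
  [PreconnectedSpace B]

/-- A local homeomorphism with local sections through all points, over open sets with connected
pairwise intersections and nonempty triple intersections, is bijective. -/
theorem IsLocalHomeomorph.bijective_of_sections {φ : X → B} (hφ : IsLocalHomeomorph φ)
    {D : B → Set B} (hD : ∀ b, IsOpen (D b)) (hself : ∀ b, b ∈ D b)
    (hsymm : ∀ a b, a ∈ D b → b ∈ D a) (hconn : ∀ a b, IsPreconnected (D a ∩ D b))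
    (htriple : ∀ a b c, (D a ∩ D b ∩ D c).Nonempty) {s : X → B → X}
    (hs : ∀ p, ContinuousOn (s p) (D (φ p))) (hsec : ∀ p, ∀ b ∈ D (φ p), φ (s p b) = b)
    (hbase : ∀ p, s p (φ p) = p) : Function.Bijective φ := by
  have sep : IsSeparatedMap φ := T2Space.isSeparatedMap φ
  have inj := hφ.isLocallyInjective
  have hagree : ∀ p q, ∀ b ∈ D (φ p) ∩ D (φ q), s p b = s q b →
      Set.EqOn (s p) (s q) (D (φ p) ∩ D (φ q)) := fun p q b hb hpq ↦
    sep.eqOn_of_comp_eqOn inj (hconn _ _) ((hs p).mono Set.inter_subset_left)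
      ((hs q).mono Set.inter_subset_right)
      (fun x hx ↦ by simp only [Function.comp_apply]; rw [hsec p x hx.1, hsec q x hx.2]) hb hpq
  -- For q' near q both q' and the value of the section of q at φ(q') lie in one domain of
  -- injectivity of φ, so that value is q' and the sections agree on the connected overlap.
  have hnear : ∀ q, ∀ᶠ q' in nhds q, Set.EqOn (s q) (s q') (D (φ q) ∩ D (φ q')) := by
    intro q
    obtain ⟨e, heq, hφe⟩ := hφ q
    have c1 : ContinuousAt (fun q' ↦ s q (φ q')) q :=
      ContinuousAt.comp (g := s q) ((hs q).continuousAt ((hD _).mem_nhds (hself _)))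
        hφ.continuous.continuousAt
    filter_upwards [c1 (show e.source ∈ nhds (s q (φ q)) by
      rw [hbase]; exact e.open_source.mem_nhds heq),
      e.open_source.mem_nhds heq, hφ.continuous.continuousAt.eventually
        ((hD (φ q)).mem_nhds (hself _))] with q' h1 h2 h3
    refine hagree q q' (φ q') ⟨h3, hself _⟩ ?_
    rw [hbase]
    exact e.injOn h1 h2 (by rw [← hφe]; exact hsec q _ h3)
  -- Agreement is transitive: a point of the triple intersection compares all three sections, and
  -- agreement at one point spreads over a connected overlap.
  have hpass : ∀ p q q', Set.EqOn (s p) (s q) (D (φ p) ∩ D (φ q)) →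
      Set.EqOn (s q) (s q') (D (φ q) ∩ D (φ q')) →
      Set.EqOn (s p) (s q') (D (φ p) ∩ D (φ q')) := by
    intro p q q' h1 h2
    obtain ⟨b, ⟨hb1, hb2⟩, hb3⟩ := htriple (φ p) (φ q) (φ q')
    exact hagree p q' b ⟨hb1, hb3⟩ ((h1 ⟨hb1, hb2⟩).trans (h2 ⟨hb2, hb3⟩))
  constructor
  · intro p p' hpp
    -- Agreement with the section of p is an open and closed condition on q, so it holds for p'.
    -- Evaluating the two sections at φ(p) = φ(p') gives p = p'.
    have hclopen : IsClopen {q | Set.EqOn (s p) (s q) (D (φ p) ∩ D (φ q))} := by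
      constructor
      · rw [← isOpen_compl_iff, isOpen_iff_mem_nhds]
        intro q hq
        filter_upwards [hnear q] with q' hq' hmem
        exact hq (hpass p q' q hmem fun b hb ↦ (hq' hb.symm).symm)
      · rw [isOpen_iff_mem_nhds]
        intro q hq
        filter_upwards [hnear q] with q' hq'
        exact hpass p q q' hq hq'
    have huniv := hclopen.eq_univ ⟨p, fun _ _ ↦ rfl⟩
    have hp' : Set.EqOn (s p) (s p') (D (φ p) ∩ D (φ p')) := by
      have := Set.mem_univ p'
      rwa [← huniv] at this
    have h1 := hp' (x := φ p) ⟨hself _, by rw [hpp]; exact hself _⟩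
    rw [hbase] at h1
    rw [h1, hpp, hbase]
  -- For b in the closure of the range, D(b) contains some φ(p); by symmetry b lies in D(φ(p)),
  -- where the section of p gives a preimage.
  · have hclopen : IsClopen (Set.range φ) := by
      refine ⟨?_, hφ.isOpenMap.isOpen_range⟩
      rw [← closure_subset_iff_isClosed]
      intro b hb
      obtain ⟨_, ha, p, rfl⟩ := mem_closure_iff.1 hb _ (hD b) (hself b)
      exact ⟨s p b, hsec p b (hsymm _ _ ha)⟩
    exact Set.range_eq_univ.1 (hclopen.eq_univ (Set.range_nonempty φ))

end Sections

/-! ### Lifting curves and contractions -/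

section PathLifting

variable {X B : Type*} [TopologicalSpace B]

/-- Lifting of a path through a local homeomorphism, by an a priori Lipschitz bound. -/
theorem IsLocalHomeomorph.exists_lift_of_dist_le [MetricSpace X] [CompleteSpace X] [T2Space B]
    {φ : X → B} (hφ : IsLocalHomeomorph φ) {c : ℝ → B} (hc : Continuous c) {L : ℝ}
    (hL : ∀ (γ : ℝ → X) (a b : ℝ), 0 ≤ a → a ≤ b → b ≤ 1 → ContinuousOn γ (Set.Icc a b) →
      (∀ t ∈ Set.Icc a b, φ (γ t) = c t) → dist (γ a) (γ b) ≤ L * (b - a))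
    {p : X} (hp : φ p = c 0) :
    ∃ γ : ℝ → X, ContinuousOn γ (Set.Icc 0 1) ∧ (∀ t ∈ Set.Icc 0 1, φ (γ t) = c t) ∧ γ 0 = p := by
  have sep : IsSeparatedMap φ := T2Space.isSeparatedMap φ
  have inj := hφ.isLocallyInjective
  set A : Set ℝ := {τ | ∃ γ : ℝ → X, ContinuousOn γ (Set.Icc 0 τ) ∧
    (∀ t ∈ Set.Icc 0 τ, φ (γ t) = c t) ∧ γ 0 = p} with hA
  have hmono : ∀ τ ∈ A, ∀ σ ≤ τ, σ ∈ A := by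
    rintro τ ⟨γ, h1, h2, h3⟩ σ hσ
    exact ⟨γ, h1.mono (Set.Icc_subset_Icc_right hσ),
      fun t ht ↦ h2 t ⟨ht.1, ht.2.trans hσ⟩, h3⟩
  suffices h : Set.Icc 0 1 ⊆ A from h (Set.right_mem_Icc.2 zero_le_one)
  have h0A : (0 : ℝ) ∈ A := by
    refine ⟨fun _ ↦ p, continuousOn_const, fun t ht ↦ ?_, rfl⟩
    rw [hp, le_antisymm ht.2 ht.1]
  refine IsClosed.Icc_subset_of_forall_exists_gt ?_ h0A ?_
  -- Closedness: by uniqueness the lifts on shorter intervals glue to one on [0, x). The a priori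
  -- bound makes it Lipschitz, so completeness supplies a limit that extends it to x.
  · rw [← closure_subset_iff_isClosed]
    intro x hx
    have hx01 : x ∈ Set.Icc (0 : ℝ) 1 := by
      have := closure_mono Set.inter_subset_right hx
      rwa [isClosed_Icc.closure_eq] at this
    refine ⟨?_, hx01⟩
    by_contra hxA
    have hlt : ∀ t < x, t ∈ A := by
      intro t ht
      obtain ⟨τ, hτ, hτA⟩ := mem_closure_iff.1 hx (Set.Ioi t) isOpen_Ioi ht
      exact hmono τ hτA.1 t (le_of_lt hτ)
    have : Nonempty X := ⟨p⟩
    choose! g hg1 hg2 hg3 using hlt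
    have hx0 : 0 < x := lt_of_le_of_ne hx01.1 fun h ↦ hxA (h ▸ h0A)
    have hagree : ∀ σ τ, 0 ≤ σ → σ ≤ τ → τ < x → Set.EqOn (g σ) (g τ) (Set.Icc 0 σ) := by
      intro σ τ h0 hστ hτ
      refine sep.eqOn_of_comp_eqOn inj isPreconnected_Icc (hg1 σ (hστ.trans_lt hτ))
        ((hg1 τ hτ).mono (Set.Icc_subset_Icc_right hστ)) (fun t ht ↦ ?_)
        (Set.left_mem_Icc.2 h0) ?_
      · simp only [Function.comp_apply]
        rw [hg2 σ (hστ.trans_lt hτ) t ht, hg2 τ hτ t ⟨ht.1, ht.2.trans hστ⟩]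
      · rw [hg3 σ (hστ.trans_lt hτ), hg3 τ hτ]
    set γ : ℝ → X := fun t ↦ g t t with hγ
    have hγg : ∀ τ < x, Set.EqOn γ (g τ) (Set.Icc 0 τ) := fun τ hτ t ht ↦
      hagree t τ ht.1 ht.2 hτ (Set.right_mem_Icc.2 ht.1)
    have hγc : ∀ t, 0 ≤ t → t < x → φ (γ t) = c t := fun t h0 ht ↦
      hg2 t ht t (Set.right_mem_Icc.2 h0)
    have hdist : ∀ a b, 0 ≤ a → a ≤ b → b < x → dist (γ a) (γ b) ≤ L * (b - a) := by
      intro a b ha hab hb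
      rw [hγg b hb ⟨ha, hab⟩, hγg b hb ⟨ha.trans hab, le_rfl⟩]
      exact hL (g b) a b ha hab (hb.le.trans hx01.2)
        ((hg1 b hb).mono (Set.Icc_subset_Icc_left ha))
        fun t ht ↦ hg2 b hb t ⟨ha.trans ht.1, ht.2⟩
    have hdist' : ∀ a ∈ Set.Ico 0 x, ∀ b ∈ Set.Ico 0 x, dist (γ a) (γ b) ≤ |L| * dist a b := by
      intro a ha b hb
      rcases le_total a b with hab | hab
      · refine (hdist a b ha.1 hab hb.2).trans ?_
        rw [dist_comm, Real.dist_eq, abs_of_nonneg (sub_nonneg.2 hab)]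
        exact mul_le_mul_of_nonneg_right (le_abs_self L) (sub_nonneg.2 hab)
      · rw [dist_comm]
        refine (hdist b a hb.1 hab ha.2).trans ?_
        rw [Real.dist_eq, abs_of_nonneg (sub_nonneg.2 hab)]
        exact mul_le_mul_of_nonneg_right (le_abs_self L) (sub_nonneg.2 hab)
    have hlip : LipschitzOnWith (Real.toNNReal |L|) γ (Set.Ico 0 x) :=
      LipschitzOnWith.of_dist_le_mul fun a ha b hb ↦ by
        rw [Real.coe_toNNReal _ (abs_nonneg L)]; exact hdist' a ha b hb
    have hne : (nhdsWithin x (Set.Ico 0 x)).NeBot := by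
      rw [← mem_closure_iff_nhdsWithin_neBot, closure_Ico hx0.ne]
      exact Set.right_mem_Icc.2 hx0.le
    have hcauchy : Cauchy (nhdsWithin x (Set.Ico 0 x)) := cauchy_nhds.mono nhdsWithin_le_nhds
    obtain ⟨q, hq⟩ := CompleteSpace.complete
      (hcauchy.map_of_le hlip.uniformContinuousOn (Filter.le_principal_iff.2 self_mem_nhdsWithin))
    have hq' : Filter.Tendsto γ (nhdsWithin x (Set.Ico 0 x)) (nhds q) := hq
    have hφq : φ q = c x := by
      refine tendsto_nhds_unique ((hφ.continuous.tendsto q).comp hq')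
        (((hc.tendsto x).mono_left nhdsWithin_le_nhds).congr' ?_)
      filter_upwards [self_mem_nhdsWithin] with t ht
      exact (hγc t ht.1 ht.2).symm
    refine hxA ⟨Function.update γ x q, ?_, fun t ht ↦ ?_, ?_⟩
    · rw [continuousOn_update_iff, Set.Icc_sdiff_right]
      exact ⟨hlip.continuousOn, fun _ ↦ hq'⟩
    · rcases ht.2.lt_or_eq with h | rfl
      · rw [Function.update_of_ne h.ne, hγc t ht.1 h]
      · rw [Function.update_self, hφq]
    · rw [Function.update_of_ne hx0.ne]
      exact hg3 0 hx0
  -- Openness: continue the lift past x with the local inverse of φ at γ(x).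
  · rintro x ⟨⟨γ, h1, h2, h3⟩, hx⟩ y hy
    obtain ⟨e, heq, hφe⟩ := hφ (γ x)
    have hcx : c x ∈ e.target := by
      rw [← h2 x ⟨hx.1, le_rfl⟩, hφe]
      exact e.map_source heq
    obtain ⟨z, hz, hzs⟩ := mem_nhdsGE_iff_exists_Icc_subset.1
      (mem_nhdsWithin_of_mem_nhds ((e.open_target.preimage hc).mem_nhds hcx))
    have hxw : x < min z y := lt_min hz hy
    refine ⟨min z y, ⟨fun t ↦ if t ≤ x then γ t else e.symm (c t), ?_, fun t ht ↦ ?_, ?_⟩,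
      hxw, min_le_right z y⟩
    · have e1 : ∀ t ∈ Set.Icc x (min z y),
          (if t ≤ x then γ t else e.symm (c t)) = e.symm (c t) := by
        intro t ht
        split_ifs with h
        · rw [le_antisymm h ht.1, ← h2 x ⟨hx.1, le_rfl⟩, hφe, e.left_inv heq]
        · rfl
      rw [← Set.Icc_union_Icc_eq_Icc hx.1 hxw.le]
      refine ContinuousOn.union_of_isClosed (h1.congr fun t ht ↦ if_pos ht.2) ?_ isClosed_Icc
        isClosed_Icc
      exact (e.continuousOn_symm.comp hc.continuousOn fun t ht ↦
        hzs ⟨ht.1, ht.2.trans (min_le_left z y)⟩).congr e1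
    · dsimp only
      split_ifs with h
      · exact h2 t ⟨ht.1, h⟩
      · rw [hφe, e.right_inv (hzs ⟨(not_le.1 h).le, ht.2.trans (min_le_left z y)⟩)]
    · dsimp only
      rw [if_pos hx.1, h3]

/-- A contraction of `D` to the point `φ p` along liftable paths gives a section on `D`. -/
theorem IsLocalHomeomorph.exists_section [TopologicalSpace X] [T2Space X] {φ : X → B}
    (hφ : IsLocalHomeomorph φ) {D : Set B} {h : unitInterval × D → B} (hc : Continuous h) {p : X}
    (hp : φ p ∈ D) (h1 : ∀ x : D, h (1, x) = x)
    (hfix : ∀ t, h (t, ⟨φ p, hp⟩) = φ p)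
    (hlift : ∀ x : D, ∃ γ : unitInterval → X, Continuous γ ∧ (∀ t, φ (γ t) = h (t, x)) ∧ γ 0 = p) :
    ∃ s : B → X, ContinuousOn s D ∧ (∀ b ∈ D, φ (s b) = b) ∧ s (φ p) = p := by
  classical
  have sep : IsSeparatedMap φ := T2Space.isSeparatedMap φ
  choose g hg1 hg2 hg3 using hlift
  -- Lifts chosen separately for each x are jointly continuous, since they all start at the same
  -- point p.
  have hcont : Continuous (fun q : unitInterval × D ↦ g q.2 q.1) := by
    refine hφ.continuous_lift sep (⟨h, hc⟩ : C(unitInterval × D, B))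
      (funext fun q ↦ hg2 q.2 q.1) ?_ fun x ↦ hg1 x
    simp only [hg3]
    exact continuous_const
  have hgs : Continuous (fun x : D ↦ g x 1) := hcont.comp (by fun_prop : Continuous fun x : D ↦
    ((1 : unitInterval), x))
  refine ⟨fun b ↦ if hb : b ∈ D then g ⟨b, hb⟩ 1 else p, ?_, fun b hb ↦ ?_, ?_⟩
  · rw [continuousOn_iff_continuous_domRestrict]
    refine hgs.congr fun x ↦ ?_
    simp [Set.domRestrict_apply]
  · dsimp only
    rw [dif_pos hb, hg2, h1]
  · dsimp only
    rw [dif_pos hp]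
    refine (sep.const_of_comp hφ.isLocallyInjective (hg1 _) (fun t t' ↦ ?_) 1 0).trans (hg3 _)
    rw [hg2, hg2, hfix, hfix]

end PathLifting

/-! ### Connectedness and great circle arcs on spheres -/

section Sphere

/-- Stereographic projection from u turns the set into the complement of at most one point of ℝ^k,
connected because k ≥ 2. -/
theorem isPreconnected_usphere_compl_pair {k : ℕ} (hk : 2 ≤ k) (u v : USphere k) :
    IsPreconnected ({u, v}ᶜ : Set (USphere k)) := by
  have : Fact (Module.finrank ℝ (EuclideanSpace ℝ (Fin (k + 1))) = k + 1) :=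
    Fact.mk finrank_euclideanSpace_fin
  set e := stereographic' (E := EuclideanSpace ℝ (Fin (k + 1))) k u with he
  have hs : e.source = {u}ᶜ := stereographic'_source u
  have ht : e.target = Set.univ := stereographic'_target u
  have hcount : (e.symm ⁻¹' {v}).Countable := by
    refine Set.Subsingleton.countable fun a ha b hb ↦ ?_
    refine e.symm.injOn (x₁ := a) (x₂ := b) ?_ ?_ (ha.trans hb.symm) <;>
      simp [ht]
  have hrank : 1 < Module.rank ℝ (EuclideanSpace ℝ (Fin k)) := by
    rw [← Module.finrank_eq_rank, finrank_euclideanSpace_fin]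
    exact_mod_cast hk
  have h1 := (hcount.isConnected_compl_of_one_lt_rank hrank).isPreconnected
  have h2 : ContinuousOn e.symm (e.symm ⁻¹' {v})ᶜ :=
    e.continuousOn_symm.mono (by rw [ht]; exact Set.subset_univ _)
  convert! h1.image _ h2 using 1
  ext x
  constructor
  · intro hx
    have hxs : x ∈ e.source := by
      rw [hs]
      exact fun h ↦ hx (Or.inl h)
    refine ⟨e x, ?_, e.left_inv hxs⟩
    rw [Set.mem_compl_iff, Set.mem_preimage, e.left_inv hxs]
    exact fun h ↦ hx (Or.inr h)
  · rintro ⟨y, hy, rfl⟩ (h | h)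
    · have := e.map_target (x := y) (by rw [ht]; trivial)
      rw [hs] at this
      exact this h
    · exact hy h

theorem preconnectedSpace_usphere {k : ℕ} (hk : 2 ≤ k) : PreconnectedSpace (USphere k) := by
  refine isPreconnected_iff_preconnectedSpace.1 (isPreconnected_sphere ?_ _ _)
  rw [← Module.finrank_eq_rank, finrank_euclideanSpace_fin]
  exact_mod_cast (by omega : 1 < k + 1)

/-- Needed to find a point off three given antipodes. A connected Hausdorff space with two distinct
points, here x and −x, is infinite. -/
theorem infinite_usphere {k : ℕ} (hk : 2 ≤ k) : Infinite (USphere k) := by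
  have := preconnectedSpace_usphere hk
  have hrank : 0 < Module.rank ℝ (EuclideanSpace ℝ (Fin (k + 1))) := by
    rw [← Module.finrank_eq_rank, finrank_euclideanSpace_fin]
    exact_mod_cast k.succ_pos
  have : Nontrivial (USphere k) := by
    have := (rank_pos_iff_nontrivial (R := ℝ)).1 hrank
    obtain ⟨x, hx⟩ := NormedSpace.sphere_nonempty (E := EuclideanSpace ℝ (Fin (k + 1)))
      (x := 0) (r := 1) |>.2 zero_le_one
    exact ⟨⟨x, hx⟩, -⟨x, hx⟩, fun h ↦ ne_neg_of_mem_unit_sphere ℝ ⟨x, hx⟩ h⟩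
  exact PreconnectedSpace.infinite

variable {k : ℕ}

/-- If the segment meets 0, comparing the norms of the two terms gives τ = 1/2 and so y' = −y. -/
theorem sphereSegment_ne_zero {y y' : USphere k} (h : y' ≠ -y) {τ : ℝ} (h0 : 0 ≤ τ) (h1 : τ ≤ 1) :
    (1 - τ) • (y : EuclideanSpace ℝ (Fin (k + 1))) + τ • (y' : EuclideanSpace ℝ (Fin (k + 1)))
      ≠ 0 := by
  intro hz
  have hn : ‖(1 - τ) • (y : EuclideanSpace ℝ (Fin (k + 1)))‖
      = ‖τ • (y' : EuclideanSpace ℝ (Fin (k + 1)))‖ := by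
    rw [eq_neg_of_add_eq_zero_left hz, norm_neg]
  rw [norm_smul, norm_smul, norm_eq_of_mem_sphere, norm_eq_of_mem_sphere, Real.norm_of_nonneg h0,
    Real.norm_of_nonneg (sub_nonneg.2 h1), mul_one, mul_one] at hn
  have hτ : τ = 1 / 2 := by linarith
  apply h
  ext1
  rw [coe_neg_sphere]
  have h2 : (1 / 2 : ℝ) • ((y' : EuclideanSpace ℝ (Fin (k + 1))) + y) = 0 := by
    refine Eq.trans ?_ hz
    rw [hτ]; module
  exact eq_neg_of_add_eq_zero_left ((smul_eq_zero_iff_right (by norm_num)).1 h2)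

/-- The point of the segment from `y` to `y'` at a smooth time that is constant outside `[0, 1]`. -/
noncomputable def sphereSegment (y y' : USphere k) (t : ℝ) : EuclideanSpace ℝ (Fin (k + 1)) :=
  (1 - Real.smoothTransition t) • (y : EuclideanSpace ℝ (Fin (k + 1)))
    + Real.smoothTransition t • (y' : EuclideanSpace ℝ (Fin (k + 1)))

theorem sphereSegment_transition_ne_zero {y y' : USphere k} (h : y' ≠ -y) (t : ℝ) :
    sphereSegment y y' t ≠ 0 :=
  sphereSegment_ne_zero h (Real.smoothTransition.nonneg t) (Real.smoothTransition.le_one t)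

/-- The great circle arc from `y` to a point `y'` that is not antipodal. -/
noncomputable def sphereArc (y y' : USphere k) (h : y' ≠ -y) : ℝ → USphere k :=
  Set.codRestrict (fun t ↦ ‖sphereSegment y y' t‖⁻¹ • sphereSegment y y' t) _ fun t ↦ by
    rw [mem_sphere_zero_iff_norm, norm_smul, norm_inv, norm_norm,
      inv_mul_cancel₀ (norm_ne_zero_iff.2 (sphereSegment_transition_ne_zero h t))]

theorem coe_sphereArc (y y' : USphere k) (h : y' ≠ -y) (t : ℝ) :
    (sphereArc y y' h t : EuclideanSpace ℝ (Fin (k + 1)))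
      = ‖sphereSegment y y' t‖⁻¹ • sphereSegment y y' t := rfl

theorem contMDiff_sphereArc (y y' : USphere k) (h : y' ≠ -y) :
    ContMDiff 𝓘(ℝ, ℝ) (𝓡 k) ∞ (sphereArc y y' h) := by
  have : Fact (Module.finrank ℝ (EuclideanSpace ℝ (Fin (k + 1))) = k + 1) :=
    Fact.mk finrank_euclideanSpace_fin
  have h1 : ContDiff ℝ ∞ (sphereSegment y y') :=
    ((contDiff_const.sub Real.smoothTransition.contDiff).smul contDiff_const).add
      (Real.smoothTransition.contDiff.smul contDiff_const)
  have h2 : ContDiff ℝ ∞ (fun t ↦ ‖sphereSegment y y' t‖⁻¹ • sphereSegment y y' t) :=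
    ((h1.norm ℝ (sphereSegment_transition_ne_zero h)).inv fun t ↦
      norm_ne_zero_iff.2 (sphereSegment_transition_ne_zero h t)).smul h1
  exact ContMDiff.codRestrict_sphere (E := EuclideanSpace ℝ (Fin (k + 1))) h2.contMDiff _

theorem sphereArc_zero (y y' : USphere k) (h : y' ≠ -y) : sphereArc y y' h 0 = y := by
  ext1
  rw [coe_sphereArc, sphereSegment, Real.smoothTransition.zero_of_nonpos le_rfl]
  simp

theorem sphereArc_one (y y' : USphere k) (h : y' ≠ -y) : sphereArc y y' h 1 = y' := by
  ext1
  rw [coe_sphereArc, sphereSegment, Real.smoothTransition.one_of_one_le le_rfl]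
  simp

theorem sphereArc_self (y : USphere k) (h : y ≠ -y) (t : ℝ) : sphereArc y y h t = y := by
  ext1
  rw [coe_sphereArc, sphereSegment, ← add_smul]
  simp

theorem continuous_sphereArc {A : Type*} [TopologicalSpace A] (y : USphere k) {g : A → USphere k}
    {τ : A → ℝ} (hg : Continuous g) (hτ : Continuous τ) (h : ∀ a, g a ≠ -y) :
    Continuous (fun a ↦ sphereArc y (g a) (h a) (τ a)) := by
  have h1 : Continuous (fun a ↦ sphereSegment y (g a) (τ a)) := by
    have hσ := Real.smoothTransition.continuous.comp hτ
    exact ((continuous_const.sub hσ).smul continuous_const).add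
      (hσ.smul (continuous_subtype_val.comp hg))
  exact Continuous.subtype_mk ((h1.norm.inv₀ fun a ↦
    norm_ne_zero_iff.2 (sphereSegment_transition_ne_zero (h a) (τ a))).smul h1) _

end Sphere

/-- Continuous lifts of smooth curves through a local diffeomorphism are smooth. -/
theorem IsLocalDiffeomorph.contMDiffOn_lift {E E' H H' X B : Type*} [NormedAddCommGroup E]
    [NormedSpace ℝ E] [NormedAddCommGroup E'] [NormedSpace ℝ E'] [TopologicalSpace H]
    [TopologicalSpace H'] {I : ModelWithCorners ℝ E H} {J : ModelWithCorners ℝ E' H'}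
    [TopologicalSpace X] [ChartedSpace H X] [TopologicalSpace B] [ChartedSpace H' B]
    {φ : X → B} (hφ : IsLocalDiffeomorph I J ∞ φ) {c : ℝ → B} (hc : ContMDiff 𝓘(ℝ, ℝ) J ∞ c)
    {γ : ℝ → X} {s : Set ℝ} (hγ : ContinuousOn γ s) (hlift : ∀ t ∈ s, φ (γ t) = c t) :
    ContMDiffOn 𝓘(ℝ, ℝ) I ∞ γ s := by
  intro t ht
  obtain ⟨Φ, hmem, hΦ⟩ := hφ (γ t)
  have hct : c t ∈ Φ.target := by
    rw [← hlift t ht, hΦ hmem]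
    exact Φ.map_source hmem
  have h1 : ContMDiffAt 𝓘(ℝ, ℝ) I ∞ (Φ.invFun ∘ c) t :=
    (Φ.contMDiffOn_invFun.contMDiffAt (Φ.open_target.mem_nhds hct)).comp t (hc t)
  refine h1.contMDiffWithinAt.congr_of_eventuallyEq_of_mem ?_ ht
  filter_upwards [hγ t ht (Φ.open_source.mem_nhds hmem), self_mem_nhdsWithin] with τ h2 h3
  change γ τ = Φ.invFun (c τ)
  rw [← hlift τ h3, hΦ h2]
  exact (Φ.left_inv h2).symm

/-! ### The global isometry -/

section Clifford

variable {n : ℕ} {M : Type*} [MetricSpace M] [ConnectedSpace M] [CompleteSpace M]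
  [ChartedSpace (EuclideanSpace ℝ (Fin n)) M] [IsManifold (𝓡 n) ∞ M]
  [Bundle.RiemannianBundle (fun p : M ↦ TangentSpace (𝓡 n) p)]
  [IsContMDiffRiemannianBundle (𝓡 n) ∞ (EuclideanSpace ℝ (Fin n))
    (fun p : M ↦ TangentSpace (𝓡 n) p)]
  [IsRiemannianManifold (𝓡 n) M]

/-- Lengths of lifts of a smooth curve are bounded, as `φ` determines the hypersurface. -/
theorem IsOrientedHypersurface.exists_dist_lift_le {f : M → USphere (n + 1)}
    {N : M → EuclideanSpace ℝ (Fin (n + 1 + 1))} (hf : IsOrientedHypersurface f N) {k l : ℕ}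
    {R : EuclideanSpace ℝ (Fin (n + 1 + 1)) →L[ℝ] EuclideanSpace ℝ (Fin (k + 1))}
    {S : EuclideanSpace ℝ (Fin (n + 1 + 1)) →L[ℝ] EuclideanSpace ℝ (Fin (l + 1))} {r s : ℝ}
    (hRS : ∀ x y, inner ℝ (R x) (R y) + inner ℝ (S x) (S y) = (inner ℝ x y : ℝ))
    {φ : M → USphere k × USphere l} (hφ : IsLocalDiffeomorph (𝓡 n) ((𝓡 k).prod (𝓡 l)) ∞ φ)
    (hR : ∀ p, R (ambientMap f p) = r • ((φ p).1 : EuclideanSpace ℝ (Fin (k + 1))))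
    (hS : ∀ p, S (ambientMap f p) = s • ((φ p).2 : EuclideanSpace ℝ (Fin (l + 1))))
    {c : ℝ → USphere k × USphere l} (hc : ContMDiff 𝓘(ℝ, ℝ) ((𝓡 k).prod (𝓡 l)) ∞ c) :
    ∃ L : ℝ, ∀ (γ : ℝ → M) (a b : ℝ), 0 ≤ a → a ≤ b → b ≤ 1 → ContinuousOn γ (Set.Icc a b) →
      (∀ t ∈ Set.Icc a b, φ (γ t) = c t) → dist (γ a) (γ b) ≤ L * (b - a) := by
  -- The pair (R, S) is an isometry, so f can be recovered from φ. For any lift γ of c, the curve f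
  -- ∘ γ is therefore the fixed smooth curve G, whose speed is bounded on [0, 1].
  have hinv : ∀ x, R.adjoint (R x) + S.adjoint (S x) = x := fun x ↦
    ext_inner_right ℝ fun y ↦ by
      rw [inner_add_left, ContinuousLinearMap.adjoint_inner_left,
        ContinuousLinearMap.adjoint_inner_left, hRS]
  set G : ℝ → EuclideanSpace ℝ (Fin (n + 1 + 1)) := fun t ↦
    R.adjoint (r • ((c t).1 : EuclideanSpace ℝ (Fin (k + 1))))
      + S.adjoint (s • ((c t).2 : EuclideanSpace ℝ (Fin (l + 1)))) with hG
  have sG : ContDiff ℝ ∞ G := by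
    have s1 : ContDiff ℝ ∞ (fun t ↦ ((c t).1 : EuclideanSpace ℝ (Fin (k + 1)))) :=
      contMDiff_iff_contDiff.1 ((contMDiff_coe_usphere k).comp (contMDiff_fst.comp hc))
    have s2 : ContDiff ℝ ∞ (fun t ↦ ((c t).2 : EuclideanSpace ℝ (Fin (l + 1)))) :=
      contMDiff_iff_contDiff.1 ((contMDiff_coe_usphere l).comp (contMDiff_snd.comp hc))
    exact ((R.adjoint).contDiff.comp (s1.const_smul r)).add
      ((S.adjoint).contDiff.comp (s2.const_smul s))
  obtain ⟨L, hL⟩ := isCompact_Icc.exists_bound_of_continuousOn (s := Set.Icc (0 : ℝ) 1)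
    (sG.continuous_deriv (by simp)).continuousOn
  have hL0 : 0 ≤ L := (norm_nonneg _).trans (hL 0 (by simp))
  refine ⟨L, fun γ a b ha hab hb hγ hlift ↦ hf.dist_le_mul hab hL0
    ((hφ.contMDiffOn_lift hc hγ hlift).of_le (by simp)) fun t ht ↦ ?_⟩
  have h1 : ambientMap f ∘ γ =ᶠ[nhds t] G := by
    filter_upwards [Ioo_mem_nhds ht.1 ht.2] with τ hτ
    simp only [hG, Function.comp_apply]
    rw [← hlift τ ⟨hτ.1.le, hτ.2.le⟩, ← hR, ← hS, hinv]
  rw [h1.deriv_eq]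
  exact hL t ⟨ha.trans ht.1.le, ht.2.le.trans hb⟩

/-- D(b) consists of the pairs with neither factor antipodal to that of b. It contracts to b along
products of great circle arcs, which lift to M by the length bound and completeness, giving
sections. Overlaps are products of spheres minus at most two points, connected as k, l ≥ 2. -/
theorem IsOrientedHypersurface.bijective_of_isLocalDiffeomorph {f : M → USphere (n + 1)}
    {N : M → EuclideanSpace ℝ (Fin (n + 1 + 1))} (hf : IsOrientedHypersurface f N) {k l : ℕ}
    (hk : 2 ≤ k) (hl : 2 ≤ l)
    {R : EuclideanSpace ℝ (Fin (n + 1 + 1)) →L[ℝ] EuclideanSpace ℝ (Fin (k + 1))}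
    {S : EuclideanSpace ℝ (Fin (n + 1 + 1)) →L[ℝ] EuclideanSpace ℝ (Fin (l + 1))} {r s : ℝ}
    (hRS : ∀ x y, inner ℝ (R x) (R y) + inner ℝ (S x) (S y) = (inner ℝ x y : ℝ))
    {φ : M → USphere k × USphere l} (hφ : IsLocalDiffeomorph (𝓡 n) ((𝓡 k).prod (𝓡 l)) ∞ φ)
    (hR : ∀ p, R (ambientMap f p) = r • ((φ p).1 : EuclideanSpace ℝ (Fin (k + 1))))
    (hS : ∀ p, S (ambientMap f p) = s • ((φ p).2 : EuclideanSpace ℝ (Fin (l + 1)))) :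
    Function.Bijective φ := by
  have := preconnectedSpace_usphere hk
  have := preconnectedSpace_usphere hl
  have := infinite_usphere hk
  have := infinite_usphere hl
  set D : USphere k × USphere l → Set (USphere k × USphere l) := fun b ↦
    {-b.1}ᶜ ×ˢ {-b.2}ᶜ with hD
  have hself₁ : ∀ (j : ℕ) (y : USphere j), y ≠ -y := fun j y ↦ ne_neg_of_mem_unit_sphere ℝ y
  have hself : ∀ b, b ∈ D b := fun b ↦ ⟨hself₁ k b.1, hself₁ l b.2⟩
  have hsection : ∀ p, ∃ σ : USphere k × USphere l → M,
      ContinuousOn σ (D (φ p)) ∧ (∀ b ∈ D (φ p), φ (σ b) = b) ∧ σ (φ p) = p := by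
    intro p
    refine hφ.isLocalHomeomorph.exists_section (h := fun q : unitInterval × D (φ p) ↦
      (sphereArc (φ p).1 q.2.1.1 q.2.2.1 q.1, sphereArc (φ p).2 q.2.1.2 q.2.2.2 q.1))
      ?_ (hself _) (fun x ↦ ?_) (fun t ↦ ?_) (fun x ↦ ?_)
    · exact (continuous_sphereArc _ (by fun_prop) (by fun_prop) _).prodMk
        (continuous_sphereArc _ (by fun_prop) (by fun_prop) _)
    · exact Prod.ext (sphereArc_one _ _ x.2.1) (sphereArc_one _ _ x.2.2)
    · exact Prod.ext (sphereArc_self _ (hself₁ k _) _) (sphereArc_self _ (hself₁ l _) _)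
    · obtain ⟨L, hL⟩ := hf.exists_dist_lift_le hRS hφ hR hS
        ((contMDiff_sphereArc (φ p).1 x.1.1 x.2.1).prodMk
          (contMDiff_sphereArc (φ p).2 x.1.2 x.2.2))
      obtain ⟨γ, hγ1, hγ2, hγ3⟩ := hφ.isLocalHomeomorph.exists_lift_of_dist_le
        (((contMDiff_sphereArc (φ p).1 x.1.1 x.2.1).prodMk
          (contMDiff_sphereArc (φ p).2 x.1.2 x.2.2)).continuous) hL (p := p)
        (Prod.ext (sphereArc_zero _ _ x.2.1).symm (sphereArc_zero _ _ x.2.2).symm)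
      exact ⟨fun t ↦ γ t, hγ1.comp_continuous continuous_subtype_val fun t ↦ t.2,
        fun t ↦ hγ2 t t.2, by simpa using hγ3⟩
  choose σ hσ1 hσ2 hσ3 using hsection
  refine hφ.isLocalHomeomorph.bijective_of_sections (D := D)
    (fun b ↦ isClosed_singleton.isOpen_compl.prod isClosed_singleton.isOpen_compl) hself
    (fun a b hab ↦ ⟨fun h ↦ hab.1 ?_, fun h ↦ hab.2 ?_⟩) (fun a b ↦ ?_) (fun a b c ↦ ?_)
    hσ1 hσ2 hσ3
  · rw [Set.mem_singleton_iff] at h ⊢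
    rw [h, neg_neg]
  · rw [Set.mem_singleton_iff] at h ⊢
    rw [h, neg_neg]
  · have e1 : D a ∩ D b = {-a.1, -b.1}ᶜ ×ˢ {-a.2, -b.2}ᶜ := by
      ext x
      simp only [hD, Set.mem_inter_iff, Set.mem_prod, Set.mem_compl_iff, Set.mem_singleton_iff,
        Set.mem_insert_iff, not_or]
      tauto
    rw [e1]
    exact (isPreconnected_usphere_compl_pair hk _ _).prod
      (isPreconnected_usphere_compl_pair hl _ _)
  · obtain ⟨u, hu⟩ := (Set.toFinite ({-a.1, -b.1, -c.1} : Set (USphere k))).exists_notMem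
    obtain ⟨v, hv⟩ := (Set.toFinite ({-a.2, -b.2, -c.2} : Set (USphere l))).exists_notMem
    simp only [Set.mem_insert_iff, Set.mem_singleton_iff, not_or] at hu hv
    exact ⟨(u, v), ⟨⟨hu.1, hv.1⟩, hu.2.1, hv.2.1⟩, hu.2.2, hv.2.2⟩

theorem HasTwoCurvatures.exists_isometricToClifford {f : M → USphere (n + 1)}
    {N : M → EuclideanSpace ℝ (Fin (n + 1 + 1))} {lam mu : M → ℝ} {k l : ℕ}
    (h : HasTwoCurvatures f N lam mu k l) (hf : IsOrientedHypersurface f N) (hk : 2 ≤ k)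
    (hl : 2 ≤ l) (hkl : k + l = n) {a b : ℝ} (hlam : ∀ p, lam p = a) (hmu : ∀ p, mu p = b) :
    ∃ r s : ℝ, 0 < r ∧ 0 < s ∧ r ^ 2 + s ^ 2 = 1 ∧ IsometricToClifford n M k l r s := by
  obtain ⟨R, S, r, s, hr, hs, hrs, hRS, hR, hS⟩ := h.exists_splitting hf hk hl hkl hlam hmu
  obtain ⟨φ, hφ, h1, h2, hmet⟩ := hf.exists_isLocalDiffeomorph hkl hr hs hRS hR hS
  exact ⟨r, s, hr, hs, hrs, hφ.diffeomorphOfBijective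
    (hf.bijective_of_isLocalDiffeomorph hk hl hRS hφ h1 h2), hmet⟩

end Clifford

/-- A complete connected oriented hypersurface of the unit sphere with constant `m`-th mean
curvature, and with exactly two distinct principal curvatures at each point, both of multiplicity
greater than `1`, is isometric to a Clifford product `S^k(a) × S^{n-k}(b)`, `2 ≤ k ≤ n - 2`. -/
theorem theorem2p1 {n m : ℕ} (hm : 1 ≤ m) (hmn : m ≤ n)
    {M : Type*} [MetricSpace M] [ConnectedSpace M] [CompleteSpace M]
    [ChartedSpace (EuclideanSpace ℝ (Fin n)) M] [IsManifold (𝓡 n) ∞ M]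
    [Bundle.RiemannianBundle (fun p : M ↦ TangentSpace (𝓡 n) p)]
    [IsContMDiffRiemannianBundle (𝓡 n) ∞ (EuclideanSpace ℝ (Fin n))
      (fun p : M ↦ TangentSpace (𝓡 n) p)]
    [IsRiemannianManifold (𝓡 n) M]
    (f : M → USphere (n + 1)) (N : M → EuclideanSpace ℝ (Fin (n + 1 + 1)))
    (hf : IsOrientedHypersurface f N)
    (hH : ∃ c : ℝ, ∀ p : M, meanCurvature m f N p = c)
    (htwo : ∀ p : M, (principalCurvatures f N p).ncard = 2)
    (hmult : ∀ p : M, ∀ c ∈ principalCurvatures f N p, 1 < principalMultiplicity f N p c) :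
    ∃ (k : ℕ) (a b : ℝ), 2 ≤ k ∧ k ≤ n - 2 ∧ 0 < a ∧ 0 < b ∧ a ^ 2 + b ^ 2 = 1 ∧
      IsometricToClifford n M k (n - k) a b := by
  obtain ⟨lam, mu, k, l, h, hk, hl, hkl⟩ := hf.exists_hasTwoCurvatures htwo hmult
  obtain ⟨c, hc⟩ := hH
  obtain ⟨a, b, hlam, hmu⟩ | h0 | h0 := h.constant_or_zero hf hm hmn hk hl hkl hc
  · obtain ⟨r, s, hr, hs, hrs, hiso⟩ := h.exists_isometricToClifford hf hk hl hkl hlam hmu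
    have hlk : l = n - k := by omega
    exact ⟨k, r, s, hk, by omega, hr, hs, hrs, hlk ▸ hiso⟩
  · exact (h.not_forall_eq_zero hf hk hl h0).elim
  · exact (h.swap.not_forall_eq_zero hf hl hk h0).elim
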